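/- Write $(f*g)(t)=\int_0^t f(t-s)g(s)\,ds$ and $\widehat f(\lambda)=\int_0^\infty e^{-\lambda t}f(t)\,dt$. A pair $(k,\ell)$ of locally integrable functions on the half-line $\mathbb R_+$ is of type $(\mathcal{PC})$ if $k$ is nonnegative and nonincreasing on $(0,\infty)$ and $k*\ell=1$ on $(0,\infty)$. Define pairs $(\phi_n,\psi_n)$, $n\ge 1$, recursively: let $$\phi_1(t)=\int_0^1\frac{t^{\alpha-1}}{\Gamma(\alpha)}\,d\alpha,\qquad \psi_1(t)=\int_0^\infty\frac{e^{-st}}{1+s}\,ds ,\qquad t>0;$$ given $\psi_n$, for $\delta\in(0,1)$ let $\omega_n^\delta$ be the locally integrable completely monotone function with $\widehat{\omega_n^\delta}=(\widehat{\psi_n})^\delta$ and $\varphi_n^\delta$ the locally integrable completely monotone function with $\omega_n^\delta*\varphi_n^\delta=1$ on $(0,\infty)$, put $\phi_{n+1}(t)=\int_0^1\varphi_n^\delta(t)\,d\delta$ for $t>0$, and let $\psi_{n+1}$ be the locally integrable completely monotone function with $\phi_{n+1}*\psi_{n+1}=1$ on $(0,\infty)$. For $\eta,\nu>0$ consider the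 non-local in time telegraph equation $$\partial_t^2\bigl(k*k*(u-u_0)\bigr)+\eta\,\partial_t\bigl(k*(u-u_0)\bigr)-\nu\,\partial_z^2u=0,\quad t>0,\ z\in\mathbb R,\qquad u(0,\cdot)=u_0=\delta_0,\quad \partial_t\bigl(k*k*(u-u_0)\bigr)\big|_{t=0^+}=0 .$$ A fundamental solution is a function $U(t,z)$, $t>0$, $z\in\mathbb R$, with $U(t,\cdot)\in L^1(\mathbb R)$ and $\sup_{0<t\le T}\|U(t,\cdot)\|_{L^1}<\infty$ for all $T>0$, such that for every $\chi\in C_c^\infty(\mathbb R)$ the function $t\mapsto\int U(t,z)\chi(z)\,dz$ is continuous on $(0,\infty)$ and the equation, with the time derivatives existing pointwise, and both initial conditions hold after pairing with $\chi$ in the variable $z$. Let $n\ge 2$, $\eta,\nu>0$ and $(k,\ell)=(\phi_n,\psi_n)$. Then $(k,\ell)$ is of type $(\mathcal{PC})$, $\phi_n$ is completely monotone, a fundamental solution exists, and every fundamental solution $U(t,\cdot)$ is a probability density for every $t>0$. Let $X(t)$, $t>0$, be any family of real random variables on a probability space such that $X(t)$ has density $U(t,\cdot)$, where $U$ is a fundamental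 solution. Then $X(t)$ has finite second moment for every $t>0$, and $$\mathrm{Var}[X(t)]\sim\frac{2\nu}{\eta}\log^{[n]}(t)\quad\text{as }t\to\infty,\qquad \log^{[n]}=\underbrace{\log\circ\cdots\circ\log}_{n\text{ times}},$$ in particular $\mathrm{Var}[X(t)]=o\bigl((\log t)^\delta\bigr)$ as $t\to\infty$ for every $\delta>0$, so that the variance grows more slowly than any logarithm; moreover $$\mathrm{Var}[X(t)]\sim\nu\,t^2\bigl(\log(1/t)\bigr)^{2n}\quad\text{as }t\to0^+ .$$ -/

import Mathlib

open MeasureTheory ProbabilityTheory Set Filter Topology Asymptotics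
open scoped ContDiff

namespace SlowVariance

/-- The class `L_{1,loc}(ℝ₊)`: integrable on every bounded interval `(0, T]`. -/
def LocInt (f : ℝ → ℝ) : Prop :=
  ∀ T : ℝ, 0 < T → IntegrableOn f (Ioc 0 T)

/-- Convolution on the half-line, `(f ∗ g)(t) = ∫₀ᵗ f (t - s) g s ds`. -/
noncomputable def conv (f g : ℝ → ℝ) (t : ℝ) : ℝ :=
  ∫ s in (0 : ℝ)..t, f (t - s) * g s

/-- Laplace transform of a function on the half-line. -/
noncomputable def laplace (f : ℝ → ℝ) (x : ℝ) : ℝ :=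
  ∫ t in Ioi (0 : ℝ), Real.exp (-(x * t)) * f t

/-- Completely monotone functions on `(0, ∞)`. -/
def IsCM (f : ℝ → ℝ) : Prop :=
  ContDiffOn ℝ ∞ f (Ioi 0) ∧
    ∀ m : ℕ, ∀ t : ℝ, 0 < t → 0 ≤ (-1 : ℝ) ^ m * iteratedDeriv m f t

/-- Pairs of type `(PC)`: `k` is locally integrable, nonnegative and nonincreasing, `ℓ` is locally
integrable, and `k ∗ ℓ = 1` on `(0, ∞)`. -/
structure IsPC (k l : ℝ → ℝ) : Prop where
  locInt_left : LocInt k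
  locInt_right : LocInt l
  nonneg : ∀ t : ℝ, 0 < t → 0 ≤ k t
  antitone : AntitoneOn k (Ioi 0)
  conv_eq_one : ∀ t : ℝ, 0 < t → conv k l t = 1

/-- The locally integrable completely monotone function with Laplace transform `F`. Its values on
`(0, ∞)` are determined by `F` if it exists; otherwise the value is an arbitrary function. -/
noncomputable def invLaplace (F : ℝ → ℝ) : ℝ → ℝ :=
  Classical.epsilon fun f : ℝ → ℝ =>
    IsCM f ∧ LocInt f ∧ ∀ x : ℝ, 0 < x → laplace f x = F x

/-- The locally integrable completely monotone function `ℓ` with `k ∗ ℓ = 1` on `(0, ∞)`. Its values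
on `(0, ∞)` are determined by `k` if it exists; otherwise the value is an arbitrary function. -/
noncomputable def partner (k : ℝ → ℝ) : ℝ → ℝ :=
  Classical.epsilon fun l : ℝ → ℝ =>
    IsCM l ∧ LocInt l ∧ ∀ t : ℝ, 0 < t → conv k l t = 1

/-- `φ₁(t) = ∫₀¹ t^(α-1) / Γ(α) dα`. -/
noncomputable def phiOne (t : ℝ) : ℝ :=
  ∫ α in (0 : ℝ)..1, t ^ (α - 1) / Real.Gamma α

/-- `ψ₁(t) = ∫₀^∞ e^(-st) / (1 + s) ds`. -/
noncomputable def psiOne (t : ℝ) : ℝ :=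
  ∫ s in Ioi (0 : ℝ), Real.exp (-(s * t)) / (1 + s)

/-- `ω^δ`, the completely monotone function whose Laplace transform is the `δ`-th power of that of
`ψ`. -/
noncomputable def powKernel (ψ : ℝ → ℝ) (δ : ℝ) : ℝ → ℝ :=
  invLaplace fun x => laplace ψ x ^ δ

/-- `φ_{n+1}` in terms of `ψ_n`: the integral over `δ ∈ (0, 1)` of the completely monotone functions
`φ_n^δ` with `ω_n^δ ∗ φ_n^δ = 1`. -/
noncomputable def nextPhi (ψ : ℝ → ℝ) (t : ℝ) : ℝ :=
  ∫ δ in (0 : ℝ)..1, partner (powKernel ψ δ) t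

/-- The sequence of pairs; entry `m` is `(φ_{m+1}, ψ_{m+1})`. -/
noncomputable def kernelPair : ℕ → (ℝ → ℝ) × (ℝ → ℝ)
  | 0 => (phiOne, psiOne)
  | m + 1 => (nextPhi (kernelPair m).2, partner (nextPhi (kernelPair m).2))

/-- The kernel `φ_n`, for `n ≥ 1`. -/
noncomputable def phi (n : ℕ) : ℝ → ℝ := (kernelPair (n - 1)).1

/-- The kernel `ψ_n`, for `n ≥ 1`. -/
noncomputable def psi (n : ℕ) : ℝ → ℝ := (kernelPair (n - 1)).2

/-- Test functions of the space variable. -/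
def IsTest (χ : ℝ → ℝ) : Prop := ContDiff ℝ ∞ χ ∧ HasCompactSupport χ

/-- The pairing of `U(t, ·)` with a function `χ` of the space variable. -/
noncomputable def pairing (U : ℝ → ℝ → ℝ) (χ : ℝ → ℝ) (t : ℝ) : ℝ :=
  ∫ z, χ z * U t z

/-- The pairing of `U(t, ·) - δ₀` with `χ`. -/
noncomputable def deviation (U : ℝ → ℝ → ℝ) (χ : ℝ → ℝ) (t : ℝ) : ℝ :=
  pairing U χ t - χ 0

/-- `U(t, z)`, `t > 0`, is a fundamental solution of the non-local telegraph equation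
`∂ₜ²(k ∗ k ∗ (u - u₀)) + η ∂ₜ(k ∗ (u - u₀)) - ν ∂_z² u = 0`, `u(0, ·) = u₀ = δ₀`,
in the weak sense in the space variable: the functions `U(t, ·)` are integrable, with norms bounded
for bounded `t`, they depend weakly continuously on `t`, and the equation holds pointwise in `t`
after pairing with any test function of `z`. The second initial condition is that
`∂ₜ(k ∗ k ∗ (u - u₀))` vanishes at `t = 0`. Only the values of `U` at `t > 0` matter. -/
structure IsFundamentalSolution (k : ℝ → ℝ) (η ν : ℝ) (U : ℝ → ℝ → ℝ) : Prop where
  integrable : ∀ t : ℝ, 0 < t → Integrable (U t)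
  bounded : ∀ T : ℝ, 0 < T → ∃ C : ℝ, ∀ t ∈ Ioc 0 T, ∫ z, |U t z| ≤ C
  continuousOn : ∀ χ : ℝ → ℝ, IsTest χ → ContinuousOn (pairing U χ) (Ioi 0)
  initial : ∀ χ : ℝ → ℝ, IsTest χ → Tendsto (pairing U χ) (𝓝[>] 0) (𝓝 (χ 0))
  initial_deriv : ∀ χ : ℝ → ℝ, IsTest χ →
    Tendsto (deriv (conv k (conv k (deviation U χ)))) (𝓝[>] 0) (𝓝 0)
  differentiable_conv : ∀ χ : ℝ → ℝ, IsTest χ → ∀ t : ℝ, 0 < t →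
    DifferentiableAt ℝ (conv k (deviation U χ)) t
  differentiable_conv_conv : ∀ χ : ℝ → ℝ, IsTest χ → ∀ t : ℝ, 0 < t →
    DifferentiableAt ℝ (conv k (conv k (deviation U χ))) t
  differentiable_deriv : ∀ χ : ℝ → ℝ, IsTest χ → ∀ t : ℝ, 0 < t →
    DifferentiableAt ℝ (deriv (conv k (conv k (deviation U χ)))) t
  equation : ∀ χ : ℝ → ℝ, IsTest χ → ∀ t : ℝ, 0 < t →
    deriv (deriv (conv k (conv k (deviation U χ)))) t
      + η * deriv (conv k (deviation U χ)) t
      - ν * pairing U (deriv (deriv χ)) t = 0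

/-- The random variable `Y` has the probability density `f` with respect to Lebesgue measure. -/
def HasDensity {Ω : Type*} [MeasurableSpace Ω] (P : Measure Ω) (Y : Ω → ℝ) (f : ℝ → ℝ) : Prop :=
  AEMeasurable Y P ∧ P.map Y = volume.withDensity fun z => ENNReal.ofReal (f z)

end SlowVariance

/-! Put `g_0(λ) = λ` and `g_{n+1} = (g_n - 1) / log g_n`. The transform of `ψ_n` is `1/g_n`, and for
`n ≥ 2` that of `φ_n` is `g_n/λ`: the kernel `φ_n^δ` has transform `g_n^δ/λ`, and `∫₀¹ g_n^δ dδ =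
g_{n+1}`. All positivity rests on `g_n` being a complete Bernstein function. This is handled in
logarithmic coordinates: `L = log g_n` is a function of `ζ = log λ` on the closed strip `|Im ζ| ≤
π`, where the two banks of the cut have become regular edges. One step of the recursion preserves,
and even improves, the required bounds on `L` (`PreCBF.step`). Cauchy's theorem on rectangles yields
Stieltjes representations with continuous boundary densities (`StripFun.tendsto_integral`), so the
kernels are Laplace transforms of explicit nonnegative densities. Uniqueness of the Laplace
transform identifies them with the chosen functions of the statement (`cmFor_psi`, `cmFor_phi`).

Existence. In the time transform a solution must be `a/(2λ) exp(-a|z|)` with `ν a² = g(g + η)`. The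
function `sqrt (g(g + η))` is again of the same class (`LogCBF.logM`). It is approximated by bounded
functions `b < ε⁻²` of this class, and `exp(-τb)` is a positive multiple of the exponential series
in the Stieltjes function `ε⁻² - b`; hence the inverse transforms are nonnegative
(`LogCBF.solReg_nonneg`), and so is their limit (`LogCBF.sol_laplace`).

Uniqueness and moments. Let `r` have transform `1/(g + η)` and put `κ = ℓ * r`. The equation with
its initial conditions implies `⟨U, χ⟩ - χ(0) = ν κ * ⟨U, χ''⟩`
(`IsFundamentalSolution.deviation_eq`). Cut-offs extend this to functions of quadratic growth. For
the difference of two solutions, cosines and sines lead to a scalar Volterra equation with only the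
zero solution, so the Fourier transform of the difference vanishes. The functions `1`, `z`, `z²`
give mass one, mean zero and variance `2ν ∫₀ᵗ κ` (`WeakVolterra.variance_eq`).

Asymptotics. By partial fractions `ηκ = ℓ - r`, and `∫₀ᵗ r` stays bounded, so at infinity only `∫₀ᵗ
ℓ` counts. It is equivalent to `1/g_n(1/t)`, and each recursion step replaces `1/g_n` by its
logarithm up to a factor tending to one. At time zero the leading terms of `ℓ` and `r` coincide and
partial fractions are of no use; there `x/g_n(x) ~ (log x)^n` at infinity gives both kernels the
size `log(1/t)^n`, and `κ` is squeezed between `t ℓ(t) r(t)` and Chebyshev's bound. The passage from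
transforms to functions needs no general Tauberian theorem: for Stieltjes functions the error is
bounded, under the integral sign, by a multiple of a difference of transform values at `1/t` and
`2/t`. -/

namespace SlowVariance

/-! ### Convolution of kernels with an integrable singularity at time zero. -/

/-- Nonnegative, nonincreasing, locally integrable functions on the half-line. -/
structure Kern (f : ℝ → ℝ) : Prop where
  nonneg : ∀ t : ℝ, 0 < t → 0 ≤ f t
  anti : AntitoneOn f (Ioi 0)
  locInt : LocInt f

/-- Continuous functions on `(0, ∞)` which are dominated on bounded intervals by nonincreasing
locally integrable functions. -/
structure Dom (q : ℝ → ℝ) : Prop where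
  cont : ContinuousOn q (Ioi 0)
  bound : ∀ T : ℝ, 0 < T → ∃ l, Kern l ∧ ∀ t ∈ Ioc 0 T, |q t| ≤ l t

/-- Functions with an absolutely convergent Laplace transform on `(0, ∞)`. -/
def LA (f : ℝ → ℝ) : Prop :=
  ∀ x : ℝ, 0 < x → IntegrableOn (fun t => Real.exp (-(x * t)) * f t) (Ioi 0)

theorem Kern.const {c : ℝ} (hc : 0 ≤ c) : Kern fun _ => c :=
  ⟨fun _ _ => hc, fun _ _ _ _ _ => le_rfl, fun T _ => by simp⟩

theorem Kern.add {f g : ℝ → ℝ} (hf : Kern f) (hg : Kern g) : Kern fun t => f t + g t :=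
  ⟨fun t ht => add_nonneg (hf.nonneg t ht) (hg.nonneg t ht),
    fun _ ha _ hb hab => add_le_add (hf.anti ha hb hab) (hg.anti ha hb hab),
    fun T hT => (hf.locInt T hT).add (hg.locInt T hT)⟩

theorem Kern.const_mul {f : ℝ → ℝ} (hf : Kern f) {c : ℝ} (hc : 0 ≤ c) : Kern fun t => c * f t :=
  ⟨fun t ht => mul_nonneg hc (hf.nonneg t ht),
    fun _ ha _ hb hab => mul_le_mul_of_nonneg_left (hf.anti ha hb hab) hc,
    fun T hT => (hf.locInt T hT).const_mul c⟩

theorem Kern.comp_half {f : ℝ → ℝ} (hf : Kern f) : Kern fun t => f (t / 2) := by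
  refine ⟨fun t ht => hf.nonneg _ (by positivity), fun a ha b hb hab => ?_, fun T hT => ?_⟩
  · simp only [mem_Ioi] at ha hb
    exact hf.anti (by simp; positivity) (by simp; positivity) (by linarith)
  · have h := hf.locInt (T / 2) (by positivity)
    rw [← intervalIntegrable_iff_integrableOn_Ioc_of_le (by positivity)] at h ⊢
    have := h.comp_mul_left (c := (2 : ℝ)⁻¹)
    simp only [zero_div] at this
    convert this using 2
    · ring_nf
    · ring

theorem Kern.laplace_integrable {f : ℝ → ℝ} (hf : Kern f) : LA f := by
  intro x hx
  rw [← Ioc_union_Ioi_eq_Ioi (zero_le_one' ℝ)]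
  refine IntegrableOn.union ?_ ?_
  · have h := hf.locInt 1 one_pos
    refine h.bdd_mul (c := 1) (by fun_prop) ?_
    refine (ae_restrict_iff' measurableSet_Ioc).2 (ae_of_all _ fun t ht => ?_)
    rw [Real.norm_eq_abs, abs_of_pos (Real.exp_pos _), Real.exp_le_one_iff]
    have := mul_pos hx ht.1
    linarith
  · have h1 : IntegrableOn (fun t => Real.exp (-x * t)) (Ioi 1) := exp_neg_integrableOn_Ioi 1 hx
    have hm : AEStronglyMeasurable f (volume.restrict (Ioi 1)) :=
      (aemeasurable_restrict_of_antitoneOn measurableSet_Ioi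
        (hf.anti.mono (Ioi_subset_Ioi zero_le_one))).aestronglyMeasurable
    have h2 := h1.mul_bdd (c := f 1) hm (by
      refine (ae_restrict_iff' measurableSet_Ioi).2 (ae_of_all _ fun t ht => ?_)
      have ht' : (1 : ℝ) < t := ht
      rw [Real.norm_eq_abs, abs_of_nonneg (hf.nonneg t (by linarith))]
      exact hf.anti (by simp) (by simp; linarith) ht'.le)
    simp only [neg_mul] at h2
    exact h2

theorem LocInt.intervalIntegrable {f : ℝ → ℝ} (hf : LocInt f) {t : ℝ} (ht : 0 < t) :
    IntervalIntegrable f volume 0 t :=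
  (intervalIntegrable_iff_integrableOn_Ioc_of_le ht.le).2 (hf t ht)

theorem LocInt.intervalIntegrable_sub {f : ℝ → ℝ} (hf : LocInt f) {t : ℝ} (ht : 0 < t) :
    IntervalIntegrable (fun s => f (t - s)) volume 0 t := by
  have := (hf.intervalIntegrable ht).comp_sub_left t
  simpa using this.symm

/-- One of the two arguments is at least `t/2`, and monotonicity bounds that factor by its value
there. This separates the singularities at the two ends of the convolution interval. -/
theorem Kern.mul_le {f g : ℝ → ℝ} (hf : Kern f) (hg : Kern g) {t s : ℝ} (hs : s ∈ Ioo 0 t) :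
    f (t - s) * g s ≤ f (t / 2) * g s + g (t / 2) * f (t - s) := by
  have h1 : 0 < t - s := by linarith [hs.2]
  have h2 : 0 < t := hs.1.trans hs.2
  have h3 : 0 < t / 2 := by positivity
  have f0 := hf.nonneg _ h1
  have g0 := hg.nonneg _ hs.1
  have f2 := hf.nonneg _ h3
  have g2 := hg.nonneg _ h3
  rcases le_total s (t / 2) with h | h
  · have := hf.anti (a := t / 2) (b := t - s) h3 h1 (by linarith)
    nlinarith
  · have := hg.anti (a := t / 2) (b := s) h3 hs.1 h
    nlinarith

theorem Kern.intervalIntegrable_mul {f g : ℝ → ℝ} (hf : Kern f) (hg : Kern g) {t : ℝ} (ht : 0 < t) :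
    IntervalIntegrable (fun s => f (t - s) * g s) volume 0 t := by
  have h1 := hf.locInt.intervalIntegrable_sub ht
  have h2 := hg.locInt.intervalIntegrable ht
  have h3 := (h2.const_mul (f (t / 2))).add (h1.const_mul (g (t / 2)))
  rw [intervalIntegrable_iff_integrableOn_Ioo_of_le ht.le] at *
  refine Integrable.mono' h3 (h1.aestronglyMeasurable.mul h2.aestronglyMeasurable) ?_
  refine (ae_restrict_iff' measurableSet_Ioo).2 (ae_of_all _ fun s hs => ?_)
  rw [Real.norm_eq_abs, abs_of_nonneg]
  · exact hf.mul_le hg hs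
  · exact mul_nonneg (hf.nonneg _ (by linarith [hs.2])) (hg.nonneg _ hs.1)

theorem Kern.conv_le {f g : ℝ → ℝ} (hf : Kern f) (hg : Kern g) {t : ℝ} (ht : 0 < t) :
    conv f g t ≤ f (t / 2) * (∫ s in (0 : ℝ)..t, g s) + g (t / 2) * ∫ s in (0 : ℝ)..t, f s := by
  have h1 := hf.locInt.intervalIntegrable_sub ht
  have h2 := hg.locInt.intervalIntegrable ht
  have h3 : ∫ s in (0 : ℝ)..t, f (t - s) = ∫ s in (0 : ℝ)..t, f s := by
    rw [intervalIntegral.integral_comp_sub_left]; simp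
  rw [← h3, ← intervalIntegral.integral_const_mul, ← intervalIntegral.integral_const_mul,
    ← intervalIntegral.integral_add (h2.const_mul _) (h1.const_mul _)]
  exact intervalIntegral.integral_mono_on_of_le_Ioo ht.le (hf.intervalIntegrable_mul hg ht)
    ((h2.const_mul _).add (h1.const_mul _)) fun s hs => hf.mul_le hg hs

/-- Rescaling to a fixed interval of integration lets continuity in `t` follow from dominated
convergence. -/
theorem conv_eq_mul_integral (f g : ℝ → ℝ) {t : ℝ} (ht : 0 < t) :
    conv f g t = t * ∫ θ in (0 : ℝ)..1, f (t - t * θ) * g (t * θ) := by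
  have := intervalIntegral.integral_comp_mul_left (a := 0) (b := 1)
    (fun s => f (t - s) * g s) ht.ne'
  rw [this]
  simp [conv, ht.ne']

theorem Dom.abs_mul_le {f g l l' : ℝ → ℝ} {T : ℝ} (hf : ∀ t ∈ Ioc 0 T, |f t| ≤ l t)
    (hg : ∀ t ∈ Ioc 0 T, |g t| ≤ l' t) {t s : ℝ} (ht : t ≤ T) (hs : s ∈ Ioo 0 t) :
    |f (t - s) * g s| ≤ l (t - s) * l' s := by
  have h1 := hf (t - s) ⟨by linarith [hs.2], by linarith [hs.1]⟩
  have h2 := hg s ⟨hs.1, by linarith [hs.2]⟩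
  rw [abs_mul]
  exact mul_le_mul h1 h2 (abs_nonneg _) ((abs_nonneg _).trans h1)

theorem continuousOn_mul_sub {f g : ℝ → ℝ} (hf : ContinuousOn f (Ioi 0))
    (hg : ContinuousOn g (Ioi 0)) (t : ℝ) : ContinuousOn (fun s => f (t - s) * g s) (Ioo 0 t) :=
  (hf.comp (by fun_prop) fun s hs => by simpa using hs.2).mul (hg.mono Ioo_subset_Ioi_self)

theorem Dom.intervalIntegrable_mul {f g : ℝ → ℝ} (hf : Dom f) (hg : Dom g) {t : ℝ} (ht : 0 < t) :
    IntervalIntegrable (fun s => f (t - s) * g s) volume 0 t := by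
  obtain ⟨l, hl, hfl⟩ := hf.bound t ht
  obtain ⟨l', hl', hgl⟩ := hg.bound t ht
  have h := hl.intervalIntegrable_mul hl' ht
  rw [intervalIntegrable_iff_integrableOn_Ioo_of_le ht.le] at *
  refine Integrable.mono' h
    ((continuousOn_mul_sub hf.cont hg.cont t).aestronglyMeasurable measurableSet_Ioo) ?_
  exact (ae_restrict_iff' measurableSet_Ioo).2 (ae_of_all _ fun s hs =>
    Dom.abs_mul_le hfl hgl le_rfl hs)

theorem Dom.conv_bound {f g l l' : ℝ → ℝ} {T : ℝ} (hf : Dom f) (hg : Dom g) (hl : Kern l)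
    (hl' : Kern l') (hfl : ∀ t ∈ Ioc 0 T, |f t| ≤ l t) (hgl : ∀ t ∈ Ioc 0 T, |g t| ≤ l' t)
    {t : ℝ} (ht : t ∈ Ioc 0 T) : |conv f g t| ≤ conv l l' t := by
  have h1 := (hf.intervalIntegrable_mul hg ht.1)
  refine (intervalIntegral.abs_integral_le_integral_abs ht.1.le).trans ?_
  exact intervalIntegral.integral_mono_on_of_le_Ioo ht.1.le h1.abs
    (hl.intervalIntegrable_mul hl' ht.1) fun s hs => Dom.abs_mul_le hfl hgl ht.2 hs

theorem Dom.continuousOn_conv {f g : ℝ → ℝ} (hf : Dom f) (hg : Dom g) :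
    ContinuousOn (conv f g) (Ioi 0) := by
  intro t₀ ht₀
  have ht₀ : 0 < t₀ := ht₀
  refine ContinuousAt.continuousWithinAt ?_
  obtain ⟨l, hl, hfl⟩ := hf.bound (2 * t₀) (by positivity)
  obtain ⟨l', hl', hgl⟩ := hg.bound (2 * t₀) (by positivity)
  have hev : ∀ᶠ t in 𝓝 t₀, t ∈ Ioo (t₀ / 2) (2 * t₀) :=
    isOpen_Ioo.mem_nhds ⟨by linarith, by linarith⟩
  have heq : conv f g =ᶠ[𝓝 t₀] fun t => t * ∫ θ in (0 : ℝ)..1, f (t - t * θ) * g (t * θ) := by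
    filter_upwards [hev] with t ht
    exact conv_eq_mul_integral f g (by linarith [ht.1])
  refine ContinuousAt.congr (f := fun t => t * ∫ θ in (0 : ℝ)..1, f (t - t * θ) * g (t * θ)) ?_
    heq.symm
  refine continuousAt_id.mul ?_
  have hmem : ∀ t ∈ Ioo (t₀ / 2) (2 * t₀), ∀ θ ∈ Ioo (0 : ℝ) 1, t * θ ∈ Ioo 0 t := by
    intro t ht θ hθ
    have : 0 < t := by linarith [ht.1]
    exact ⟨mul_pos this hθ.1, by nlinarith [hθ.2]⟩
  have hne : ∀ᵐ θ : ℝ, θ ≠ 1 := by simp [ae_iff]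
  have h2 : 0 < t₀ / 2 := by positivity
  -- For `t > t₀/2` both arguments are larger than those belonging to `t₀/2`, so the nonincreasing
  -- majorants taken at `t₀/2` dominate uniformly in `t`.
  refine intervalIntegral.continuousAt_of_dominated_interval
    (bound := fun θ => l (t₀ / 2 - t₀ / 2 * θ) * l' (t₀ / 2 * θ)) ?_ ?_ ?_ ?_
  · filter_upwards [hev] with t ht
    rw [uIoc_of_le zero_le_one, ← restrict_Ioo_eq_restrict_Ioc]
    refine ContinuousOn.aestronglyMeasurable ?_ measurableSet_Ioo
    exact (continuousOn_mul_sub hf.cont hg.cont t).comp (by fun_prop) fun θ hθ => hmem t ht θ hθ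
  · filter_upwards [hev] with t ht
    filter_upwards [hne] with θ hθ1 hθ
    rw [uIoc_of_le zero_le_one] at hθ
    have hθ' : θ ∈ Ioo (0 : ℝ) 1 := ⟨hθ.1, lt_of_le_of_ne hθ.2 hθ1⟩
    refine (Dom.abs_mul_le hfl hgl ht.2.le (hmem t ht θ hθ')).trans ?_
    have ht0 : 0 < t := by linarith [ht.1]
    have e1 : 0 < t₀ / 2 * θ := mul_pos h2 hθ.1
    have e2 : 0 < t₀ / 2 - t₀ / 2 * θ := by nlinarith [hθ'.2]
    have e3 : t₀ / 2 * θ ≤ t * θ := by nlinarith [ht.1, hθ.1]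
    have e4 : t₀ / 2 - t₀ / 2 * θ ≤ t - t * θ := by nlinarith [ht.1, hθ'.2]
    exact mul_le_mul (hl.anti e2 (e2.trans_le e4) e4) (hl'.anti e1 (e1.trans_le e3) e3)
      (hl'.nonneg _ (e1.trans_le e3)) (hl.nonneg _ e2)
  · have := (hl.intervalIntegrable_mul hl' h2).comp_mul_left (c := t₀ / 2)
    simpa [h2.ne', ht₀.ne'] using this
  · filter_upwards [hne] with θ hθ1 hθ
    rw [uIoc_of_le zero_le_one] at hθ
    have hθ' : θ ∈ Ioo (0 : ℝ) 1 := ⟨hθ.1, lt_of_le_of_ne hθ.2 hθ1⟩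
    have h3 := hmem t₀ ⟨by linarith, by linarith⟩ θ hθ'
    have c1 : ContinuousAt f (t₀ - t₀ * θ) := hf.cont.continuousAt (Ioi_mem_nhds (by linarith [h3.2]))
    have c2 : ContinuousAt g (t₀ * θ) := hg.cont.continuousAt (Ioi_mem_nhds h3.1)
    exact (c1.comp (f := fun t => t - t * θ) (by fun_prop)).mul
      (c2.comp (f := fun t => t * θ) (by fun_prop))

theorem Kern.integral_mono {f : ℝ → ℝ} (hf : Kern f) {t T : ℝ} (ht : 0 < t) (hT : t ≤ T) :
    ∫ s in (0 : ℝ)..t, f s ≤ ∫ s in (0 : ℝ)..T, f s := by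
  refine intervalIntegral.integral_mono_interval le_rfl ht.le hT ?_
    (hf.locInt.intervalIntegrable (ht.trans_le hT))
  exact (ae_restrict_iff' measurableSet_Ioc).2 (ae_of_all _ fun s hs => hf.nonneg s hs.1)

theorem Kern.integral_nonneg {f : ℝ → ℝ} (hf : Kern f) {t : ℝ} (ht : 0 < t) :
    0 ≤ ∫ s in (0 : ℝ)..t, f s := by
  rw [intervalIntegral.integral_of_le ht.le]
  exact setIntegral_nonneg measurableSet_Ioc fun s hs => hf.nonneg s hs.1

theorem Dom.conv {f g : ℝ → ℝ} (hf : Dom f) (hg : Dom g) : Dom (conv f g) := by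
  refine ⟨hf.continuousOn_conv hg, fun T hT => ?_⟩
  obtain ⟨l, hl, hfl⟩ := hf.bound T hT
  obtain ⟨l', hl', hgl⟩ := hg.bound T hT
  refine ⟨fun t => (∫ s in (0 : ℝ)..T, l' s) * l (t / 2) + (∫ s in (0 : ℝ)..T, l s) * l' (t / 2),
    (hl.comp_half.const_mul (hl'.integral_nonneg hT)).add
      (hl'.comp_half.const_mul (hl.integral_nonneg hT)), fun t ht => ?_⟩
  refine (hf.conv_bound hg hl hl' hfl hgl ht).trans ((hl.conv_le hl' ht.1).trans ?_)
  have h2 : 0 < t / 2 := half_pos ht.1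
  have := mul_le_mul_of_nonneg_left (hl'.integral_mono ht.1 ht.2) (hl.nonneg _ h2)
  have := mul_le_mul_of_nonneg_left (hl.integral_mono ht.1 ht.2) (hl'.nonneg _ h2)
  linarith

theorem Dom.add {f g : ℝ → ℝ} (hf : Dom f) (hg : Dom g) : Dom fun t => f t + g t := by
  refine ⟨hf.cont.add hg.cont, fun T hT => ?_⟩
  obtain ⟨l, hl, hfl⟩ := hf.bound T hT
  obtain ⟨l', hl', hgl⟩ := hg.bound T hT
  exact ⟨_, hl.add hl', fun t ht => (abs_add_le _ _).trans (add_le_add (hfl t ht) (hgl t ht))⟩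

theorem Dom.const_mul {f : ℝ → ℝ} (hf : Dom f) (c : ℝ) : Dom fun t => c * f t := by
  refine ⟨continuousOn_const.mul hf.cont, fun T hT => ?_⟩
  obtain ⟨l, hl, hfl⟩ := hf.bound T hT
  refine ⟨_, hl.const_mul (abs_nonneg c), fun t ht => ?_⟩
  rw [abs_mul]
  exact mul_le_mul_of_nonneg_left (hfl t ht) (abs_nonneg c)

theorem Kern.dom {f : ℝ → ℝ} (hf : Kern f) (hc : ContinuousOn f (Ioi 0)) : Dom f :=
  ⟨hc, fun _ _ => ⟨f, hf, fun t ht => (abs_of_nonneg (hf.nonneg t ht.1)).le⟩⟩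

theorem Dom.of_bounded {f : ℝ → ℝ} (hc : ContinuousOn f (Ioi 0))
    (hb : ∀ T : ℝ, 0 < T → ∃ C : ℝ, ∀ t ∈ Ioc 0 T, |f t| ≤ C) : Dom f := by
  refine ⟨hc, fun T hT => ?_⟩
  obtain ⟨C, hC⟩ := hb T hT
  have : 0 ≤ C := (abs_nonneg _).trans (hC T ⟨hT, le_rfl⟩)
  exact ⟨_, Kern.const this, hC⟩

theorem Dom.const (c : ℝ) : Dom fun _ => c :=
  Dom.of_bounded continuousOn_const fun _ _ => ⟨|c|, fun _ _ => le_rfl⟩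

theorem Dom.locInt {f : ℝ → ℝ} (hf : Dom f) : LocInt f := by
  intro T hT
  obtain ⟨l, hl, hfl⟩ := hf.bound T hT
  refine Integrable.mono' (hl.locInt T hT)
    ((hf.cont.mono Ioc_subset_Ioi_self).aestronglyMeasurable measurableSet_Ioc) ?_
  exact (ae_restrict_iff' measurableSet_Ioc).2 (ae_of_all _ hfl)

theorem conv_congr {f f' g g' : ℝ → ℝ} {t : ℝ} (hf : ∀ s ∈ Ioo 0 t, f s = f' s)
    (hg : ∀ s ∈ Ioo 0 t, g s = g' s) (ht : 0 < t) : conv f g t = conv f' g' t := by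
  unfold conv
  rw [intervalIntegral.integral_of_le ht.le, intervalIntegral.integral_of_le ht.le,
    integral_Ioc_eq_integral_Ioo, integral_Ioc_eq_integral_Ioo]
  refine setIntegral_congr_fun measurableSet_Ioo fun s hs => ?_
  rw [hg s hs, hf (t - s) ⟨by linarith [hs.2], by linarith [hs.1]⟩]

theorem conv_comm (f g : ℝ → ℝ) (t : ℝ) : conv f g t = conv g f t := by
  have := intervalIntegral.integral_comp_sub_left (a := 0) (b := t) (fun s => f s * g (t - s)) t
  simp only [sub_sub_cancel, sub_self, sub_zero] at this
  rw [conv, conv, this]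
  congr 1; ext s; ring

theorem conv_add {f g h : ℝ → ℝ} (hf : Dom f) (hg : Dom g) (hh : Dom h) {t : ℝ} (ht : 0 < t) :
    conv f (fun s => g s + h s) t = conv f g t + conv f h t := by
  unfold conv
  rw [← intervalIntegral.integral_add (hf.intervalIntegrable_mul hg ht)
    (hf.intervalIntegrable_mul hh ht)]
  congr 1; ext s; ring

theorem conv_const_mul (f g : ℝ → ℝ) (c t : ℝ) :
    conv f (fun s => c * g s) t = c * conv f g t := by
  unfold conv
  rw [← intervalIntegral.integral_const_mul]
  congr 1; ext s; ring

theorem conv_one (f : ℝ → ℝ) (t : ℝ) : conv (fun _ => 1) f t = ∫ s in (0 : ℝ)..t, f s := by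
  simp [conv]

theorem Dom.hasDerivAt_conv_one {f : ℝ → ℝ} (hf : Dom f) {t : ℝ} (ht : 0 < t) :
    HasDerivAt (SlowVariance.conv (fun _ => 1) f) (f t) t := by
  have h1 : SlowVariance.conv (fun _ => 1) f = fun t => ∫ s in (0 : ℝ)..t, f s :=
    funext (conv_one f)
  rw [h1]
  have hc : ContinuousAt f t := hf.cont.continuousAt (Ioi_mem_nhds ht)
  refine intervalIntegral.integral_hasDerivAt_right (hf.locInt.intervalIntegrable ht) ?_ hc
  exact hf.cont.stronglyMeasurableAtFilter isOpen_Ioi t ht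

/-! ### The Laplace transform: convolution and linearity. -/

theorem LA.conv {f g : ℝ → ℝ} (hf : LA f) (hg : LA g) : LA (SlowVariance.conv f g) := by
  intro x hx
  have := (integrable_posConvolution (hg x hx) (hf x hx)
    (ContinuousLinearMap.mul ℝ ℝ)).integrableOn (s := Ioi 0)
  refine this.congr_fun (fun t ht => ?_) measurableSet_Ioi
  simp only [posConvolution, indicator_of_mem ht]
  rw [SlowVariance.conv, ← intervalIntegral.integral_const_mul]
  refine intervalIntegral.integral_congr fun s _ => ?_
  simp only [ContinuousLinearMap.mul_apply']
  rw [show -(x * t) = -(x * s) + -(x * (t - s)) by ring, Real.exp_add]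
  ring

theorem laplace_conv {f g : ℝ → ℝ} (hf : LA f) (hg : LA g) {x : ℝ} (hx : 0 < x) :
    laplace (conv f g) x = laplace f x * laplace g x := by
  have := integral_posConvolution (hg x hx) (hf x hx) (ContinuousLinearMap.mul ℝ ℝ)
  simp only [ContinuousLinearMap.mul_apply'] at this
  rw [laplace, laplace, laplace, mul_comm, ← this]
  refine setIntegral_congr_fun measurableSet_Ioi fun t ht => ?_
  rw [SlowVariance.conv, ← intervalIntegral.integral_const_mul]
  refine intervalIntegral.integral_congr fun s _ => ?_
  rw [show -(x * t) = -(x * s) + -(x * (t - s)) by ring, Real.exp_add]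
  ring

theorem LA.add {f g : ℝ → ℝ} (hf : LA f) (hg : LA g) : LA fun t => f t + g t := by
  intro x hx
  refine ((hf x hx).add (hg x hx)).congr (ae_of_all _ fun t => ?_)
  simp only [Pi.add_apply]; ring

theorem LA.sub {f g : ℝ → ℝ} (hf : LA f) (hg : LA g) : LA fun t => f t - g t := by
  intro x hx
  refine ((hf x hx).sub (hg x hx)).congr (ae_of_all _ fun t => ?_)
  simp only [Pi.sub_apply]; ring

theorem LA.const_mul {f : ℝ → ℝ} (hf : LA f) (c : ℝ) : LA fun t => c * f t := by
  intro x hx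
  refine ((hf x hx).const_mul c).congr (ae_of_all _ fun t => ?_)
  simp only; ring

theorem LA.of_bounded {f : ℝ → ℝ} (hc : ContinuousOn f (Ioi 0)) {C : ℝ}
    (hb : ∀ t : ℝ, 0 < t → |f t| ≤ C) : LA f := by
  intro x hx
  have hC : 0 ≤ C := (abs_nonneg _).trans (hb 1 one_pos)
  refine Integrable.mono' ((Kern.const hC).laplace_integrable x hx) (ContinuousOn.aestronglyMeasurable
    (ContinuousOn.mul (by fun_prop) hc) measurableSet_Ioi) ?_
  refine (ae_restrict_iff' measurableSet_Ioi).2 (ae_of_all _ fun t ht => ?_)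
  rw [Real.norm_eq_abs, abs_mul, abs_of_pos (Real.exp_pos _)]
  exact mul_le_mul_of_nonneg_left (hb t ht) (Real.exp_pos _).le

theorem laplace_add {f g : ℝ → ℝ} (hf : LA f) (hg : LA g) {x : ℝ} (hx : 0 < x) :
    laplace (fun t => f t + g t) x = laplace f x + laplace g x := by
  unfold laplace
  rw [← integral_add (hf x hx) (hg x hx)]
  congr 1; ext t; ring

theorem laplace_sub {f g : ℝ → ℝ} (hf : LA f) (hg : LA g) {x : ℝ} (hx : 0 < x) :
    laplace (fun t => f t - g t) x = laplace f x - laplace g x := by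
  unfold laplace
  rw [← integral_sub (hf x hx) (hg x hx)]
  congr 1; ext t; ring

theorem laplace_const_mul (f : ℝ → ℝ) (c x : ℝ) :
    laplace (fun t => c * f t) x = c * laplace f x := by
  unfold laplace
  rw [← integral_const_mul]
  congr 1; ext t; ring

theorem laplace_const {x : ℝ} (hx : 0 < x) (c : ℝ) : laplace (fun _ => c) x = c / x := by
  unfold laplace
  rw [integral_mul_const]
  simp only [← neg_mul]
  have h := integral_exp_mul_Ioi (a := -x) (by linarith) 0
  rw [h]
  simp [div_eq_inv_mul]

theorem laplace_congr {f g : ℝ → ℝ} (h : ∀ t : ℝ, 0 < t → f t = g t) (x : ℝ) :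
    laplace f x = laplace g x :=
  setIntegral_congr_fun measurableSet_Ioi fun t ht => by rw [h t ht]

/-! ### Positivity and uniqueness from the Laplace transform. -/

theorem LA.pow_integrable {f : ℝ → ℝ} (hf : LA f) (n : ℕ) :
    IntegrableOn (fun t => Real.exp (-t) ^ n * (Real.exp (-t) * f t)) (Ioi 0) := by
  have := hf (n + 1) (by positivity)
  refine this.congr_fun (fun t _ => ?_) measurableSet_Ioi
  simp only
  rw [← mul_assoc, ← pow_succ, ← Real.exp_nat_mul]
  congr 2; push_cast; ring

theorem laplace_nat (f : ℝ → ℝ) (n : ℕ) :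
    ∫ t in Ioi (0 : ℝ), Real.exp (-t) ^ n * (Real.exp (-t) * f t) = laplace f (n + 1) := by
  unfold laplace
  congr 1 with t
  rw [← mul_assoc, ← pow_succ, ← Real.exp_nat_mul]
  congr 2; push_cast; ring

/-- In the variable `y = exp(-t)` the transform at `n + 1` is the `n`-th moment of the weight
`exp(-t) f(t) dt`, so the values at positive integers determine integrals against all polynomials in
`y`. -/
theorem LA.poly_integrable {f : ℝ → ℝ} (hf : LA f) (p : Polynomial ℝ) :
    IntegrableOn (fun t => p.eval (Real.exp (-t)) * (Real.exp (-t) * f t)) (Ioi 0) := by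
  simp only [Polynomial.eval_eq_sum_range, Finset.sum_mul]
  refine integrable_finsetSum _ fun i _ => ?_
  simpa only [mul_assoc] using (hf.pow_integrable i).const_mul (p.coeff i)

theorem LA.poly_integral {f : ℝ → ℝ} (hf : LA f) (p : Polynomial ℝ) :
    ∫ t in Ioi (0 : ℝ), p.eval (Real.exp (-t)) * (Real.exp (-t) * f t) =
      ∑ i ∈ Finset.range (p.natDegree + 1), p.coeff i * laplace f (i + 1) := by
  simp only [Polynomial.eval_eq_sum_range, Finset.sum_mul]
  rw [integral_finsetSum]
  · refine Finset.sum_congr rfl fun i _ => ?_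
    rw [← laplace_nat, ← integral_const_mul]
    simp only [mul_assoc]
  · intro i _
    have := (hf.pow_integrable i).const_mul (p.coeff i)
    simp only [← mul_assoc] at this ⊢
    exact this

/-- A continuous function is nonnegative if its Laplace transform is a pointwise limit of Laplace
transforms of nonnegative functions. -/
theorem nonneg_of_tendsto_laplace {f : ℝ → ℝ} (hf : LA f) (hc : ContinuousOn f (Ioi 0))
    (F : ℕ → ℝ → ℝ) (hF : ∀ N, LA (F N)) (h0 : ∀ N, ∀ t : ℝ, 0 < t → 0 ≤ F N t)
    (hlim : ∀ x : ℝ, 0 < x → Tendsto (fun N => laplace (F N) x) atTop (𝓝 (laplace f x))) :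
    ∀ t : ℝ, 0 < t → 0 ≤ f t := by
  intro t₀ ht₀
  by_contra! hneg
  -- The integral against a polynomial is a finite combination of transform values, so its sign
  -- survives the limit `N → ∞`.
  have hpoly : ∀ p : Polynomial ℝ, (∀ y ∈ Icc (0 : ℝ) 1, 0 ≤ p.eval y) →
      0 ≤ ∫ t in Ioi (0 : ℝ), p.eval (Real.exp (-t)) * (Real.exp (-t) * f t) := by
    intro p hp
    rw [hf.poly_integral p]
    refine ge_of_tendsto' (tendsto_finsetSum _ fun i _ =>
      (hlim (i + 1) (by positivity)).const_mul (p.coeff i)) fun N => ?_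
    rw [← (hF N).poly_integral p]
    refine setIntegral_nonneg measurableSet_Ioi fun t ht => ?_
    refine mul_nonneg (hp _ ⟨(Real.exp_pos _).le, ?_⟩) (mul_nonneg (Real.exp_pos _).le (h0 N t ht))
    simpa using le_of_lt ht
  have hf1 : IntegrableOn (fun t => Real.exp (-t) * f t) (Ioi 0) := by
    simpa using hf.pow_integrable 0
  have hev : ∀ᶠ t in 𝓝 t₀, f t < 0 ∧ 0 < t :=
    ((hc.continuousAt (Ioi_mem_nhds ht₀)).eventually_lt_const hneg).and (Ioi_mem_nhds ht₀)
  have hlog : ContinuousAt (fun y => -Real.log y) (Real.exp (-t₀)) :=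
    (Real.continuousAt_log (Real.exp_pos _).ne').neg
  have hev2 : ∀ᶠ y in 𝓝 (Real.exp (-t₀)), f (-Real.log y) < 0 := by
    have : Tendsto (fun y => -Real.log y) (𝓝 (Real.exp (-t₀))) (𝓝 t₀) := by
      simpa [ContinuousAt] using hlog
    exact (this.eventually hev).mono fun y hy => hy.1
  obtain ⟨c, hc0, hcf⟩ := Metric.eventually_nhds_iff.1 hev2
  -- A tent around `exp(-t₀)`, supported where `f(-log y) < 0`; the integral against it cannot be
  -- positive.
  set φ : ℝ → ℝ := fun y => max 0 (c - |y - Real.exp (-t₀)|) with hφ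
  have hφc : Continuous φ := by fun_prop
  have hφ0 : ∀ y, 0 ≤ φ y := fun y => le_max_left _ _
  have hφle : ∀ y, φ y ≤ c := fun y => max_le hc0.le (by linarith [abs_nonneg (y - Real.exp (-t₀))])
  have hφint : IntegrableOn (fun t => φ (Real.exp (-t)) * (Real.exp (-t) * f t)) (Ioi 0) := by
    refine hf1.bdd_mul (c := c) (by fun_prop) (ae_of_all _ fun t => ?_)
    rw [Real.norm_eq_abs, abs_of_nonneg (hφ0 _)]
    exact hφle _
  have hneg' : ∀ t : ℝ, φ (Real.exp (-t)) * (Real.exp (-t) * f t) ≤ 0 := by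
    intro t
    rcases eq_or_lt_of_le (hφ0 (Real.exp (-t))) with h | h
    · rw [← h]; simp
    · have h1 : |Real.exp (-t) - Real.exp (-t₀)| < c := by
        by_contra! hcon
        have : φ (Real.exp (-t)) = 0 := max_eq_left (by linarith)
        exact h.ne' this
      have := hcf (y := Real.exp (-t)) h1
      simp only [Real.log_exp, neg_neg] at this
      exact mul_nonpos_of_nonneg_of_nonpos h.le
        (mul_nonpos_of_nonneg_of_nonpos (Real.exp_pos _).le this.le)
  have hI : 0 ≤ ∫ t in Ioi (0 : ℝ), φ (Real.exp (-t)) * (Real.exp (-t) * f t) := by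
    set A := ∫ t in Ioi (0 : ℝ), |Real.exp (-t) * f t| with hA
    have hA0 : 0 ≤ A := integral_nonneg fun _ => abs_nonneg _
    refine le_of_forall_pos_lt_add fun e he => ?_
    -- Chosen so that `2εA < e`, the `+ 1` covering `A = 0`. Adding `ε` to a polynomial within `ε`
    -- of the tent makes it nonnegative on `[0, 1]` and keeps it within `2ε`.
    have hε : 0 < e / (2 * A + 1) / 2 := by positivity
    set ε := e / (2 * A + 1) / 2
    obtain ⟨p, hp⟩ := exists_polynomial_near_of_continuousOn 0 1 φ hφc.continuousOn ε hε
    have h1 := hpoly (p + Polynomial.C ε) fun y hy => by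
      have := (abs_lt.1 (hp y hy)).1
      simp only [Polynomial.eval_add, Polynomial.eval_C]
      linarith [hφ0 y]
    have h2 : ∫ t in Ioi (0 : ℝ), (p + Polynomial.C ε).eval (Real.exp (-t)) * (Real.exp (-t) * f t)
        ≤ ∫ t in Ioi (0 : ℝ), (φ (Real.exp (-t)) * (Real.exp (-t) * f t)
          + 2 * ε * |Real.exp (-t) * f t|) := by
      refine setIntegral_mono_on (hf.poly_integrable _)
        (hφint.add (hf1.abs.const_mul (2 * ε))) measurableSet_Ioi fun t ht => ?_
      have hy : Real.exp (-t) ∈ Icc (0 : ℝ) 1 :=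
        ⟨(Real.exp_pos _).le, by simpa using le_of_lt ht⟩
      have := abs_lt.1 (hp _ hy)
      simp only [Polynomial.eval_add, Polynomial.eval_C]
      have h3 : |p.eval (Real.exp (-t)) + ε - φ (Real.exp (-t))| ≤ 2 * ε :=
        abs_le.2 ⟨by linarith, by linarith⟩
      have h4 : (p.eval (Real.exp (-t)) + ε - φ (Real.exp (-t))) * (Real.exp (-t) * f t) ≤
          2 * ε * |Real.exp (-t) * f t| := by
        refine (le_abs_self _).trans ?_
        rw [abs_mul]
        exact mul_le_mul_of_nonneg_right h3 (abs_nonneg _)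
      linarith
    rw [integral_add hφint (hf1.abs.const_mul (2 * ε)), integral_const_mul] at h2
    have h5 : 2 * ε * A < e := by
      have : 2 * ε * A = e * (A / (2 * A + 1)) := by simp only [ε]; field_simp
      rw [this]
      have : A / (2 * A + 1) < 1 := by rw [div_lt_one (by positivity)]; linarith
      nlinarith
    linarith
  have hI0 : ∫ t in Ioi (0 : ℝ), φ (Real.exp (-t)) * (Real.exp (-t) * f t) = 0 :=
    le_antisymm (setIntegral_nonpos measurableSet_Ioi fun t _ => hneg' t) hI
  have hae := (integral_eq_zero_iff_of_nonneg (f := fun t => -(φ (Real.exp (-t)) *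
    (Real.exp (-t) * f t))) (fun t => by simpa using hneg' t) hφint.neg).1
    (by rw [integral_neg, hI0, neg_zero])
  rw [Filter.EventuallyEq, ae_restrict_iff' measurableSet_Ioi] at hae
  -- The integrand vanishes almost everywhere, yet is nonzero on a whole neighbourhood of `t₀`,
  -- which has positive measure.
  have hopen : ∀ᶠ t in 𝓝 t₀, ¬ (t ∈ Ioi (0 : ℝ) → -(φ (Real.exp (-t)) *
      (Real.exp (-t) * f t)) = 0) := by
    have h1 : ∀ᶠ t in 𝓝 t₀, 0 < φ (Real.exp (-t)) := by
      have h2 : Continuous fun t => φ (Real.exp (-t)) := by fun_prop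
      refine h2.continuousAt.eventually_const_lt ?_
      simp [hφ, hc0]
    filter_upwards [hev, h1] with t h2 h3 h4
    have := h4 h2.2
    have h5 := mul_pos h3 (mul_pos (Real.exp_pos (-t)) (neg_pos.2 h2.1))
    linarith
  obtain ⟨s, hs, hso, hst⟩ := mem_nhds_iff.1 hopen
  have hpos := hso.measure_pos volume ⟨t₀, hst⟩
  have : volume s = 0 := by
    refine measure_mono_null (fun t ht => ?_) hae
    exact hs ht
  exact hpos.ne' this

/-- Uniqueness for the Laplace transform of continuous functions. -/
theorem eq_of_laplace_eq {f g : ℝ → ℝ} (hf : LA f) (hg : LA g) (hfc : ContinuousOn f (Ioi 0))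
    (hgc : ContinuousOn g (Ioi 0)) (h : ∀ x : ℝ, 0 < x → laplace f x = laplace g x) :
    ∀ t : ℝ, 0 < t → f t = g t := by
  have key : ∀ {f g : ℝ → ℝ}, LA f → LA g → ContinuousOn f (Ioi 0) → ContinuousOn g (Ioi 0) →
      (∀ x : ℝ, 0 < x → laplace f x = laplace g x) → ∀ t : ℝ, 0 < t → g t ≤ f t := by
    intro f g hf hg hfc hgc h t ht
    -- The transform of `f - g` is zero, so the constant sequence of zero functions is an admissible
    -- approximation.
    have := nonneg_of_tendsto_laplace (hf.sub hg) (hfc.sub hgc) (fun _ _ => 0)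
      (fun _ => (Kern.const le_rfl).laplace_integrable) (fun _ _ _ => le_rfl) (fun x hx => by
        rw [laplace_sub hf hg hx, h x hx, laplace_const hx, sub_self, zero_div]
        exact tendsto_const_nhds) t ht
    linarith
  intro t ht
  exact le_antisymm (key hg hf hgc hfc (fun x hx => (h x hx).symm) t ht) (key hf hg hfc hgc h t ht)

/-! ### Algebra of convolution and behaviour near time zero. -/

/-- Freezing a function after time `T` changes no convolution up to `T` and provides a Laplace
transform. Identities local in time, such as associativity, can then be checked on transforms
without any growth hypothesis. -/
theorem Dom.truncate {f : ℝ → ℝ} (hf : Dom f) {T : ℝ} (hT : 0 < T) :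
    Dom (fun t => f (min t T)) ∧ LA fun t => f (min t T) := by
  obtain ⟨l, hl, hfl⟩ := hf.bound T hT
  have hk : Kern fun t => l (min t T) := by
    refine ⟨fun t ht => hl.nonneg _ (lt_min ht hT), fun a ha b hb hab =>
      hl.anti (lt_min ha hT) (lt_min hb hT) (min_le_min_right _ hab), fun S hS => ?_⟩
    refine IntegrableOn.mono_set (t := Ioc 0 T ∪ Ioc T (max S T)) (IntegrableOn.union ?_ ?_) ?_
    · refine (hl.locInt T hT).congr_fun (fun t ht => ?_) measurableSet_Ioc
      simp only [min_eq_left ht.2]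
    · refine IntegrableOn.congr_fun (f := fun _ => l T) (by simp) (fun t ht => ?_) measurableSet_Ioc
      simp only [min_eq_right ht.1.le]
    · rw [Ioc_union_Ioc_eq_Ioc hT.le (le_max_right _ _)]
      exact Ioc_subset_Ioc_right (le_max_left _ _)
  have hc : ContinuousOn (fun t => f (min t T)) (Ioi 0) :=
    hf.cont.comp (by fun_prop) fun t ht => lt_min ht hT
  have hb : ∀ t : ℝ, 0 < t → |f (min t T)| ≤ l (min t T) := fun t ht =>
    hfl _ ⟨lt_min ht hT, min_le_right _ _⟩
  refine ⟨⟨hc, fun _ _ => ⟨_, hk, fun t ht => hb t ht.1⟩⟩, fun x hx => ?_⟩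
  refine Integrable.mono' (hk.laplace_integrable x hx) (ContinuousOn.aestronglyMeasurable
    (ContinuousOn.mul (by fun_prop) hc) measurableSet_Ioi) ?_
  refine (ae_restrict_iff' measurableSet_Ioi).2 (ae_of_all _ fun t ht => ?_)
  rw [Real.norm_eq_abs, abs_mul, abs_of_pos (Real.exp_pos _)]
  exact mul_le_mul_of_nonneg_left (hb t ht) (Real.exp_pos _).le

theorem conv_assoc {f g h : ℝ → ℝ} (hf : Dom f) (hg : Dom g) (hh : Dom h) {T : ℝ} (hT : 0 < T) :
    conv (conv f g) h T = conv f (conv g h) T := by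
  obtain ⟨df, lf⟩ := hf.truncate hT
  obtain ⟨dg, lg⟩ := hg.truncate hT
  obtain ⟨dh, lh⟩ := hh.truncate hT
  have heq : ∀ {q : ℝ → ℝ} {s : ℝ}, s ∈ Ioo 0 T → q s = q (min s T) := fun hs => by
    rw [min_eq_left hs.2.le]
  have hconv : ∀ {q r : ℝ → ℝ} {s : ℝ}, s ∈ Ioo 0 T →
      conv q r s = conv (fun t => q (min t T)) (fun t => r (min t T)) s := fun hs =>
    conv_congr (fun u hu => heq ⟨hu.1, hu.2.trans hs.2⟩) (fun u hu => heq ⟨hu.1, hu.2.trans hs.2⟩)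
      hs.1
  rw [conv_congr (fun s hs => hconv hs) (fun s hs => heq hs) hT,
    conv_congr (f := f) (g := conv g h) (fun s hs => heq hs) (fun s hs => hconv hs) hT]
  refine eq_of_laplace_eq ((lf.conv lg).conv lh) (lf.conv (lg.conv lh))
    ((df.conv dg).conv dh).cont (df.conv (dg.conv dh)).cont (fun x hx => ?_) T hT
  rw [laplace_conv (lf.conv lg) lh hx, laplace_conv lf lg hx, laplace_conv lf (lg.conv lh) hx,
    laplace_conv lg lh hx, mul_assoc]

theorem conv_left_comm {f g h : ℝ → ℝ} (hf : Dom f) (hg : Dom g) (hh : Dom h) {T : ℝ}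
    (hT : 0 < T) : conv f (conv g h) T = conv g (conv f h) T := by
  rw [← conv_assoc hf hg hh hT, ← conv_assoc hg hf hh hT]
  exact conv_congr (fun s _ => conv_comm f g s) (fun _ _ => rfl) hT

/-- The convolution of a locally integrable function with a bounded one is small near `0`. -/
theorem Dom.abs_conv_le {f g : ℝ → ℝ} (hf : Dom f) (hg : Dom g) {t C : ℝ} (ht : 0 < t)
    (hC : ∀ s ∈ Ioc 0 t, |g s| ≤ C) :
    |SlowVariance.conv f g t| ≤ C * ∫ s in (0 : ℝ)..t, |f s| := by
  have h3 : ∫ s in (0 : ℝ)..t, |f (t - s)| = ∫ s in (0 : ℝ)..t, |f s| := by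
    rw [intervalIntegral.integral_comp_sub_left (fun s => |f s|)]; simp
  refine (intervalIntegral.abs_integral_le_integral_abs ht.le).trans ?_
  rw [← h3, ← intervalIntegral.integral_const_mul]
  refine intervalIntegral.integral_mono_on_of_le_Ioo ht.le (hf.intervalIntegrable_mul hg ht).abs
    ((hf.locInt.intervalIntegrable_sub ht).abs.const_mul C) fun s hs => ?_
  rw [abs_mul, mul_comm]
  exact mul_le_mul_of_nonneg_right (hC s ⟨hs.1, hs.2.le⟩) (abs_nonneg _)

theorem Dom.exists_abs_conv_le {f g : ℝ → ℝ} (hf : Dom f) (hg : Dom g)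
    (hb : ∀ T : ℝ, 0 < T → ∃ C : ℝ, ∀ t ∈ Ioc 0 T, |g t| ≤ C) (T : ℝ) (hT : 0 < T) :
    ∃ C : ℝ, ∀ t ∈ Ioc 0 T, |SlowVariance.conv f g t| ≤ C := by
  obtain ⟨C, hC⟩ := hb T hT
  have hC0 : 0 ≤ C := (abs_nonneg _).trans (hC T ⟨hT, le_rfl⟩)
  refine ⟨C * ∫ s in (0 : ℝ)..T, |f s|, fun t ht => (hf.abs_conv_le hg ht.1
    fun s hs => hC s ⟨hs.1, hs.2.trans ht.2⟩).trans (mul_le_mul_of_nonneg_left ?_ hC0)⟩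
  exact intervalIntegral.integral_mono_interval le_rfl ht.1.le ht.2 (ae_of_all _ fun _ =>
    abs_nonneg _) (hf.locInt.intervalIntegrable hT).abs

theorem LocInt.tendsto_integral {f : ℝ → ℝ} (hf : LocInt f) :
    Tendsto (fun t => ∫ s in (0 : ℝ)..t, f s) (𝓝[>] 0) (𝓝 0) := by
  have h1 : ContinuousOn (fun t => ∫ s in (0 : ℝ)..t, f s) (Icc 0 1) := by
    rw [← uIcc_of_le zero_le_one]
    refine intervalIntegral.continuousOn_primitive_interval (μ := volume) ?_
    rw [uIcc_of_le zero_le_one]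
    exact (integrableOn_Icc_iff_integrableOn_Ioc (μ := volume)).2 (hf 1 one_pos)
  have h2 := h1 0 (by simp)
  rw [ContinuousWithinAt, intervalIntegral.integral_same] at h2
  refine h2.mono_left ?_
  rw [nhdsWithin_le_iff]
  exact mem_of_superset (Ioo_mem_nhdsGT one_pos) Ioo_subset_Icc_self

theorem Dom.tendsto_conv_zero {f g : ℝ → ℝ} (hf : Dom f) (hg : Dom g) {T C : ℝ} (hT : 0 < T)
    (hC : ∀ s ∈ Ioc 0 T, |g s| ≤ C) :
    Tendsto (SlowVariance.conv f g) (𝓝[>] 0) (𝓝 0) := by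
  have habs : LocInt fun s => |f s| := fun T hT => (hf.locInt T hT).abs
  have h1 := habs.tendsto_integral.const_mul C
  rw [mul_zero] at h1
  refine squeeze_zero_norm' ?_ h1
  filter_upwards [Ioo_mem_nhdsGT hT] with t ht
  exact hf.abs_conv_le hg ht.1 fun s hs => hC s ⟨hs.1, hs.2.trans ht.2.le⟩

/-! ### Completely monotone kernels. -/

theorem IsCM.continuousOn {f : ℝ → ℝ} (hf : IsCM f) : ContinuousOn f (Ioi 0) := hf.1.continuousOn

theorem IsCM.kern {f : ℝ → ℝ} (hf : IsCM f) (hl : LocInt f) : Kern f := by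
  refine ⟨fun t ht => by simpa using hf.2 0 t ht, ?_, hl⟩
  refine antitoneOn_of_deriv_nonpos (convex_Ioi 0) hf.continuousOn ?_ ?_
  · rw [interior_Ioi]
    exact hf.1.differentiableOn (by simp)
  · rw [interior_Ioi]
    intro t ht
    have := hf.2 1 t ht
    simp only [pow_one, iteratedDeriv_one] at this
    linarith

theorem IsCM.dom {f : ℝ → ℝ} (hf : IsCM f) (hl : LocInt f) : Dom f :=
  (hf.kern hl).dom hf.continuousOn

/-- The relation `k ∗ ℓ = 1` in terms of Laplace transforms. -/
theorem conv_eq_one_iff {k l : ℝ → ℝ} (hk : Kern k) (hkc : ContinuousOn k (Ioi 0)) (hl : Kern l)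
    (hlc : ContinuousOn l (Ioi 0)) :
    (∀ t : ℝ, 0 < t → conv k l t = 1) ↔ ∀ x : ℝ, 0 < x → laplace k x * laplace l x = 1 / x := by
  constructor
  · intro h x hx
    rw [← laplace_conv hk.laplace_integrable hl.laplace_integrable hx, laplace_congr h,
      laplace_const hx]
  · intro h
    refine eq_of_laplace_eq (hk.laplace_integrable.conv hl.laplace_integrable)
      (Kern.const zero_le_one).laplace_integrable ((hk.dom hkc).conv (hl.dom hlc)).cont
      continuousOn_const fun x hx => ?_
    rw [laplace_conv hk.laplace_integrable hl.laplace_integrable hx, h x hx, laplace_const hx]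

/-! ### The logarithmic strip and the Stieltjes representation. -/

/-- The closed strip `|Im ζ| ≤ π`, which the exponential maps onto the slit plane with both banks of
the cut. -/
def Strip : Set ℂ := {z | |z.im| ≤ Real.pi}

/-- Neighbourhoods of the right end of the strip. -/
noncomputable def stripTop : Filter ℂ := comap Complex.re atTop ⊓ 𝓟 Strip

/-- Neighbourhoods of the left end of the strip. -/
noncomputable def stripBot : Filter ℂ := comap Complex.re atBot ⊓ 𝓟 Strip

/-- The point `x + iπ` of the upper boundary of the strip. -/
noncomputable def edge (x : ℝ) : ℂ := x + Real.pi * Complex.I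

/-- Holomorphic functions on the strip, real on the real axis, with the decay of a Stieltjes function
in the variable `exp ζ`. -/
structure StripFun (Φ : ℂ → ℂ) : Prop where
  diff : ∀ z ∈ Strip, DifferentiableAt ℂ Φ z
  conj : ∀ z ∈ Strip, Φ (starRingEnd ℂ z) = starRingEnd ℂ (Φ z)
  top : Tendsto Φ stripTop (𝓝 0)
  bot : Tendsto (fun z => Complex.exp z * Φ z) stripBot (𝓝 0)

/-- The boundary density of a function on the strip. -/
noncomputable def dens (Φ : ℂ → ℂ) (x : ℝ) : ℝ := -(Φ (edge x)).im * Real.exp x / Real.pi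

@[simp] theorem edge_re (x : ℝ) : (edge x).re = x := by simp [edge]
@[simp] theorem edge_im (x : ℝ) : (edge x).im = Real.pi := by simp [edge]
theorem edge_mem (x : ℝ) : edge x ∈ Strip := by simp [Strip, abs_of_pos Real.pi_pos]
theorem ofReal_mem_strip (x : ℝ) : (x : ℂ) ∈ Strip := by simp [Strip, Real.pi_pos.le]
theorem continuous_edge : Continuous edge := by unfold edge; fun_prop
theorem exp_edge (x : ℝ) : Complex.exp (edge x) = -(Real.exp x : ℝ) := by
  simp [edge, Complex.exp_add, Complex.exp_pi_mul_I]

theorem mem_strip_of_mem_Icc {x y : ℝ} (hy : y ∈ Icc (-Real.pi) Real.pi) :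
    (x : ℂ) + y * Complex.I ∈ Strip := by
  simpa [Strip] using abs_le.2 hy

theorem conj_mem_strip {z : ℂ} (hz : z ∈ Strip) : starRingEnd ℂ z ∈ Strip := by
  simpa [Strip] using hz

theorem tendsto_re_stripTop : Tendsto Complex.re stripTop atTop :=
  tendsto_comap.mono_left inf_le_left

theorem tendsto_re_stripBot : Tendsto Complex.re stripBot atBot :=
  tendsto_comap.mono_left inf_le_left

theorem eventually_mem_stripTop : ∀ᶠ z in stripTop, z ∈ Strip :=
  mem_inf_of_right (mem_principal_self _)

theorem eventually_mem_stripBot : ∀ᶠ z in stripBot, z ∈ Strip :=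
  mem_inf_of_right (mem_principal_self _)

theorem tendsto_stripTop {ι : Type*} {l : Filter ι} {f : ι → ℂ} (h1 : Tendsto (fun i => (f i).re) l atTop)
    (h2 : ∀ i, f i ∈ Strip) : Tendsto f l stripTop :=
  tendsto_inf.2 ⟨tendsto_comap_iff.2 h1, tendsto_principal.2 (Eventually.of_forall h2)⟩

theorem tendsto_stripBot {ι : Type*} {l : Filter ι} {f : ι → ℂ} (h1 : Tendsto (fun i => (f i).re) l atBot)
    (h2 : ∀ i, f i ∈ Strip) : Tendsto f l stripBot :=
  tendsto_inf.2 ⟨tendsto_comap_iff.2 h1, tendsto_principal.2 (Eventually.of_forall h2)⟩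

theorem tendsto_exp_neg_stripTop : Tendsto (fun z => Complex.exp (-z)) stripTop (𝓝 0) := by
  rw [tendsto_zero_iff_norm_tendsto_zero]
  simp only [Complex.norm_exp, Complex.neg_re]
  exact Real.tendsto_exp_neg_atTop_nhds_zero.comp tendsto_re_stripTop

theorem tendsto_exp_stripBot : Tendsto Complex.exp stripBot (𝓝 0) := by
  rw [tendsto_zero_iff_norm_tendsto_zero]
  simp only [Complex.norm_exp]
  exact Real.tendsto_exp_atBot.comp tendsto_re_stripBot

/-- A limit at one end of the strip passes to the integrals over vertical segments. -/
theorem tendsto_vertical_integral {H : ℂ → ℂ} (hH : ContinuousOn H Strip) {F : Filter ℂ} {c : ℂ}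
    (hF : Tendsto H F (𝓝 c)) {l : Filter ℝ} [l.IsCountablyGenerated]
    (hl : ∀ s ∈ F, ∀ᶠ R : ℝ in l, ∀ y ∈ Icc (-Real.pi) Real.pi, (R : ℂ) + y * Complex.I ∈ s) :
    Tendsto (fun R : ℝ => ∫ y in (-Real.pi)..Real.pi, H (R + y * Complex.I)) l
      (𝓝 (2 * Real.pi * c)) := by
  have hpi : -Real.pi ≤ Real.pi := by linarith [Real.pi_pos]
  have h1 : (2 * Real.pi * c : ℂ) = ∫ _ in (-Real.pi)..Real.pi, c := by
    simp [two_mul]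
  rw [h1]
  refine intervalIntegral.tendsto_integral_filter_of_dominated_convergence
    (fun _ => ‖c‖ + 1) ?_ ?_ (by simp) ?_
  · refine Eventually.of_forall fun R => ?_
    rw [uIoc_of_le hpi]
    refine ContinuousOn.aestronglyMeasurable ?_ measurableSet_Ioc
    exact hH.comp (by fun_prop) fun y hy => mem_strip_of_mem_Icc ⟨hy.1.le, hy.2⟩
  · have : ∀ᶠ z in F, ‖H z‖ ≤ ‖c‖ + 1 :=
      (hF.norm.eventually_lt_const (lt_add_one _)).mono fun _ h => h.le
    filter_upwards [hl _ this] with R hR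
    refine ae_of_all _ fun y hy => hR y ?_
    rw [uIoc_of_le hpi] at hy
    exact ⟨hy.1.le, hy.2⟩
  · refine ae_of_all _ fun y hy => ?_
    rw [uIoc_of_le hpi] at hy
    intro s hs
    exact (hl _ (hF hs)).mono fun R hR => hR y ⟨hy.1.le, hy.2⟩

theorem eventually_stripTop {s : Set ℂ} (hs : s ∈ stripTop) :
    ∀ᶠ R : ℝ in atTop, ∀ y ∈ Icc (-Real.pi) Real.pi, (R : ℂ) + y * Complex.I ∈ s := by
  rw [stripTop, mem_inf_principal, mem_comap] at hs
  obtain ⟨t, ht, hts⟩ := hs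
  filter_upwards [ht] with R hR y hy
  exact hts (by simpa using hR) (mem_strip_of_mem_Icc hy)

theorem eventually_stripBot {s : Set ℂ} (hs : s ∈ stripBot) :
    ∀ᶠ R : ℝ in atBot, ∀ y ∈ Icc (-Real.pi) Real.pi, (R : ℂ) + y * Complex.I ∈ s := by
  rw [stripBot, mem_inf_principal, mem_comap] at hs
  obtain ⟨t, ht, hts⟩ := hs
  filter_upwards [ht] with R hR y hy
  exact hts (by simpa using hR) (mem_strip_of_mem_Icc hy)

/-- The exponential glues the two edges together, but over a positive real value there is only one
point: another would differ by a nonzero multiple of `2πi`, and the strip reaches only to height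
`π`. -/
theorem exp_eq_exp_strip {z : ℂ} (hz : z ∈ Strip) {a : ℝ}
    (h : Complex.exp z = Complex.exp (a : ℂ)) : z = a := by
  obtain ⟨n, hn⟩ := Complex.exp_eq_exp_iff_exists_int.1 h
  have him := congrArg Complex.im hn
  have e : ((n : ℂ) * (2 * Real.pi * Complex.I)) = ((n * (2 * Real.pi) : ℝ) : ℂ) * Complex.I := by
    push_cast; ring
  rw [e] at him hn
  simp only [Complex.add_im, Complex.ofReal_im, Complex.mul_I_im, Complex.ofReal_re, zero_add] at him
  have h2 : |z.im| ≤ Real.pi := hz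
  rw [him, abs_mul, abs_of_pos Real.two_pi_pos] at h2
  have hn0 : n = 0 := by
    by_contra hne
    have : (1 : ℝ) ≤ |(n : ℝ)| := by exact_mod_cast Int.one_le_abs hne
    nlinarith [Real.pi_pos]
  rw [hn, hn0]; simp

theorem StripFun.continuous_edge {Φ : ℂ → ℂ} (hd : ∀ z ∈ Strip, DifferentiableAt ℂ Φ z) :
    Continuous fun x => Φ (edge x) :=
  continuous_iff_continuousAt.2 fun x =>
    (hd _ (edge_mem x)).continuousAt.comp (f := edge) SlowVariance.continuous_edge.continuousAt

theorem continuous_dens {Φ : ℂ → ℂ} (hd : ∀ z ∈ Strip, DifferentiableAt ℂ Φ z) :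
    Continuous (dens Φ) := by
  unfold dens
  exact (((Complex.continuous_im.comp (StripFun.continuous_edge hd)).neg).mul
    Real.continuous_exp).div_const _

theorem conj_edge (x : ℝ) : starRingEnd ℂ (edge x) = x + ((-Real.pi : ℝ) : ℂ) * Complex.I := by
  simp [edge]

/-- The Stieltjes representation, as an improper integral. -/
theorem StripFun.tendsto_integral {Φ : ℂ → ℂ} (h : StripFun Φ) (a : ℝ) :
    Tendsto (fun R : ℝ => ∫ x in (-R)..R, dens Φ x / (Real.exp x + Real.exp a)) atTop
      (𝓝 (Φ a).re) := by
  -- This is `(Φ z - Φ a) exp z / (exp z - exp a)` with the singularity at `a` removed. Subtracting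
  -- `Φ a` makes the value to be represented appear as a limit at the right end instead of a
  -- residue.
  set H : ℂ → ℂ := fun z => dslope Φ a z / dslope Complex.exp a z * Complex.exp z with hHdef
  have hHne : ∀ z, z ≠ (a : ℂ) → H z =
      (Φ z - Φ a) * Complex.exp z / (Complex.exp z - Complex.exp a) := by
    intro z hz
    have : z - a ≠ 0 := sub_ne_zero.2 hz
    simp only [hHdef, dslope_of_ne _ hz, slope_def_field]
    rw [div_div_div_cancel_right₀ this]
    ring
  have hdne : ∀ z ∈ Strip, dslope Complex.exp a z ≠ 0 := by
    intro z hz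
    by_cases hza : z = a
    · rw [hza, dslope_same, Complex.deriv_exp]
      exact Complex.exp_ne_zero _
    · rw [dslope_of_ne _ hza, slope_def_field]
      refine div_ne_zero (sub_ne_zero.2 fun hh => hza (exp_eq_exp_strip hz hh)) (sub_ne_zero.2 hza)
  have hHc : ContinuousOn H Strip := by
    intro z hz
    have h1 : ContinuousAt (dslope Φ a) z := by
      by_cases hza : z = a
      · rw [hza, continuousAt_dslope_same]; exact h.diff _ (ofReal_mem_strip a)
      · rw [continuousAt_dslope_of_ne hza]; exact (h.diff _ hz).continuousAt
    have h2 : ContinuousAt (dslope Complex.exp a) z := by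
      by_cases hza : z = a
      · rw [hza, continuousAt_dslope_same]; exact Complex.differentiableAt_exp
      · rw [continuousAt_dslope_of_ne hza]; exact Complex.continuous_exp.continuousAt
    exact ((h1.div h2 (hdne z hz)).mul Complex.continuous_exp.continuousAt).continuousWithinAt
  have hHd : ∀ z ∈ Strip, z ≠ a → DifferentiableAt ℂ H z := by
    intro z hz hza
    have h1 : DifferentiableAt ℂ (dslope Φ a) z :=
      (differentiableAt_dslope_of_ne hza).2 (h.diff z hz)
    have h2 : DifferentiableAt ℂ (dslope Complex.exp a) z :=
      (differentiableAt_dslope_of_ne hza).2 Complex.differentiableAt_exp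
    exact (h1.div h2 (hdne z hz)).mul Complex.differentiableAt_exp
  have hea : Complex.exp a ≠ 0 := Complex.exp_ne_zero _
  -- At the right end the quotient of exponentials tends to one and `Φ` to zero; at the left end
  -- everything vanishes by the decay of `exp z * Φ z`.
  have hT : Tendsto H stripTop (𝓝 (-Φ a)) := by
    have h1 : Tendsto (fun z => (Φ z - Φ a) / (1 - Complex.exp a * Complex.exp (-z))) stripTop
        (𝓝 ((0 - Φ a) / (1 - Complex.exp a * 0))) :=
      (h.top.sub_const _).div ((tendsto_exp_neg_stripTop.const_mul _).const_sub 1) (by simp)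
    simp only [zero_sub, mul_zero, sub_zero, div_one] at h1
    refine h1.congr' ?_
    filter_upwards [tendsto_re_stripTop.eventually_gt_atTop a] with z hz
    have hza : z ≠ a := fun hh => by rw [hh] at hz; simp at hz
    rw [hHne z hza, Complex.exp_neg]
    have := Complex.exp_ne_zero z
    rw [mul_div_assoc, div_eq_mul_inv]
    congr 1
    rw [← inv_div]
    congr 1
    field_simp
  have hB : Tendsto H stripBot (𝓝 0) := by
    have h1 : Tendsto (fun z => (Complex.exp z * Φ z - Φ a * Complex.exp z) /
        (Complex.exp z - Complex.exp a)) stripBot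
        (𝓝 ((0 - Φ a * 0) / (0 - Complex.exp a))) :=
      (h.bot.sub (tendsto_exp_stripBot.const_mul _)).div (tendsto_exp_stripBot.sub_const _)
        (by simp [hea])
    simp only [mul_zero, sub_zero, zero_div] at h1
    refine h1.congr' ?_
    filter_upwards [tendsto_re_stripBot.eventually_lt_atBot a] with z hz
    have hza : z ≠ a := fun hh => by rw [hh] at hz; simp at hz
    rw [hHne z hza]
    ring
  have hVT := tendsto_vertical_integral hHc hT (l := atTop) fun s hs => eventually_stripTop hs
  have hVB := tendsto_vertical_integral hHc hB (l := atBot) fun s hs => eventually_stripBot hs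
  have hVB' := hVB.comp tendsto_neg_atTop_atBot
  have hpi : -Real.pi ≤ Real.pi := by linarith [Real.pi_pos]
  -- On both edges `exp z` is the same negative number, so `Φ a` cancels and only the jump `conj Φ -
  -- Φ`, twice an imaginary part, remains.
  have hedge : ∀ x : ℝ, H (x + ((-Real.pi : ℝ) : ℂ) * Complex.I) - H (x + (Real.pi : ℂ) * Complex.I)
      = ((2 * Real.pi * (dens Φ x / (Real.exp x + Real.exp a)) : ℝ) : ℂ) * Complex.I := by
    intro x
    have hne : edge x ≠ a := fun hh => by
      have := congrArg Complex.im hh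
      simp [Real.pi_ne_zero] at this
    have hne' : starRingEnd ℂ (edge x) ≠ a := fun hh => by
      have := congrArg Complex.im hh
      simp [Real.pi_ne_zero] at this
    have hpos : (Real.exp x : ℂ) + Real.exp a ≠ 0 := by
      exact_mod_cast (add_pos (Real.exp_pos x) (Real.exp_pos a)).ne'
    have e1 : Complex.exp (starRingEnd ℂ (edge x)) = -(Real.exp x : ℝ) := by
      rw [Complex.exp_conj, exp_edge]
      rw [map_neg, Complex.conj_ofReal]
    rw [← conj_edge, show (x : ℂ) + Real.pi * Complex.I = edge x from rfl, hHne _ hne, hHne _ hne',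
      h.conj _ (edge_mem x), e1, exp_edge, ← Complex.ofReal_exp a]
    have e2 : (starRingEnd ℂ (Φ (edge x)) - Φ (edge x)) =
        ((-2 * (Φ (edge x)).im : ℝ) : ℂ) * Complex.I := by
      rw [← neg_sub, Complex.sub_conj]; push_cast; ring
    have e3 : -(Real.exp x : ℂ) - Real.exp a ≠ 0 := by
      rw [← neg_add']; exact neg_ne_zero.2 hpos
    rw [← sub_div, ← sub_mul, sub_sub_sub_cancel_right, e2, dens, ← neg_add',
      show 2 * Real.pi * (-(Φ (edge x)).im * Real.exp x / Real.pi / (Real.exp x + Real.exp a)) =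
        -2 * (Φ (edge x)).im * Real.exp x / (Real.exp x + Real.exp a) by field_simp]
    push_cast at hpos ⊢
    rw [mul_neg, neg_div_neg_eq]
    ring
  have hcont : ∀ c ∈ Icc (-Real.pi) Real.pi, Continuous fun x : ℝ => H (x + (c : ℂ) * Complex.I) := by
    intro c hc
    rw [← continuousOn_univ]
    exact hHc.comp (by fun_prop) fun x _ => mem_strip_of_mem_Icc hc
  have hrect : ∀ R : ℝ, ∫ x in (-R)..R, dens Φ x / (Real.exp x + Real.exp a) =
      ((2 * Real.pi : ℂ)⁻¹ * ((∫ y in (-Real.pi)..Real.pi, H (((-R : ℝ) : ℂ) + y * Complex.I)) -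
        ∫ y in (-Real.pi)..Real.pi, H (R + y * Complex.I))).re := by
    intro R
    have hsub : ∀ S : Set ℝ, S ×ℂ uIcc (-Real.pi) Real.pi ⊆ Strip := by
      intro S z hz
      have := hz.2
      rw [mem_preimage, uIcc_of_le hpi] at this
      exact abs_le.2 this
    -- At the point `a` only continuity of `H` has been shown; it is the exceptional point of
    -- Cauchy's theorem.
    have hr := Complex.integral_boundary_rect_eq_zero_of_differentiable_on_off_countable H
      (⟨-R, -Real.pi⟩ : ℂ) ⟨R, Real.pi⟩ {(a : ℂ)} (countable_singleton _)
      (hHc.mono (hsub _)) (fun z hz => hHd z (hsub (uIcc (-R) R) ⟨by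
        have := hz.1.1; exact Ioo_subset_Icc_self this, by
        have := hz.1.2; exact Ioo_subset_Icc_self this⟩) hz.2)
    simp only at hr
    have hi1 := (hcont (-Real.pi) (by simp [Real.pi_pos.le])).intervalIntegrable (μ := volume) (-R) R
    have hi2 := (hcont Real.pi (by simp [Real.pi_pos.le])).intervalIntegrable (μ := volume) (-R) R
    rw [← intervalIntegral.integral_sub hi1 hi2] at hr
    simp only [hedge] at hr
    rw [intervalIntegral.integral_mul_const, intervalIntegral.integral_ofReal,
      intervalIntegral.integral_const_mul] at hr
    set A := ∫ x in (-R)..R, dens Φ x / (Real.exp x + Real.exp a)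
    set B := ∫ y in (-Real.pi)..Real.pi, H (R + y * Complex.I)
    set C := ∫ y in (-Real.pi)..Real.pi, H (((-R : ℝ) : ℂ) + y * Complex.I)
    have hpi0 : (Real.pi : ℂ) ≠ 0 := by exact_mod_cast Real.pi_ne_zero
    have h2 : ((2 * Real.pi * A : ℝ) : ℂ) = C - B := by
      have : Complex.I * (((2 * Real.pi * A : ℝ) : ℂ) + B - C) = 0 := by
        rw [← hr]; simp only [smul_eq_mul]; ring
      rcases mul_eq_zero.1 this with h3 | h3
      · exact absurd h3 Complex.I_ne_zero
      · linear_combination h3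
    rw [← h2]
    have h3 : (2 * Real.pi : ℂ)⁻¹ * ((2 * Real.pi * A : ℝ) : ℂ) = A := by
      push_cast; field_simp
    rw [h3, Complex.ofReal_re]
  simp only [hrect]
  have hlim := ((hVB'.sub hVT).const_mul ((2 * Real.pi : ℂ)⁻¹))
  have hpi0 : (Real.pi : ℂ) ≠ 0 := by exact_mod_cast Real.pi_ne_zero
  have hval : ((2 * Real.pi : ℂ)⁻¹ * (2 * Real.pi * 0 - 2 * Real.pi * -Φ a)) = Φ a := by
    field_simp; ring
  rw [hval] at hlim
  exact (Complex.continuous_re.tendsto _).comp hlim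

theorem StripFun.integral_eq {Φ : ℂ → ℂ} (h : StripFun Φ) (a : ℝ)
    (hi : Integrable fun x => dens Φ x / (Real.exp x + Real.exp a)) :
    ∫ x, dens Φ x / (Real.exp x + Real.exp a) = (Φ a).re :=
  tendsto_nhds_unique (intervalIntegral_tendsto_integral hi tendsto_neg_atTop_atBot tendsto_id)
    (h.tendsto_integral a)

theorem dens_nonneg {Φ : ℂ → ℂ} (h0 : ∀ x, (Φ (edge x)).im ≤ 0) (x : ℝ) : 0 ≤ dens Φ x :=
  div_nonneg (mul_nonneg (neg_nonneg.2 (h0 x)) (Real.exp_pos x).le) Real.pi_pos.le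

/-- When the density has a sign, the truncated integrals are those of its absolute value, so
convergence of the improper integral is already integrability. -/
theorem StripFun.integrable {Φ : ℂ → ℂ} (h : StripFun Φ) (h0 : ∀ x, (Φ (edge x)).im ≤ 0) (a : ℝ) :
    Integrable fun x => dens Φ x / (Real.exp x + Real.exp a) := by
  have hc : Continuous fun x => dens Φ x / (Real.exp x + Real.exp a) :=
    (continuous_dens h.diff).div (by fun_prop) fun x =>
      (add_pos (Real.exp_pos x) (Real.exp_pos a)).ne'
  refine integrable_of_intervalIntegral_norm_tendsto (Φ a).re (fun i : ℝ =>
    (hc.integrableOn_Ioc)) tendsto_neg_atTop_atBot tendsto_id ?_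
  refine (h.tendsto_integral a).congr fun R => ?_
  refine intervalIntegral.integral_congr fun x _ => ?_
  rw [Real.norm_eq_abs, abs_of_nonneg (div_nonneg (dens_nonneg h0 x)
    (add_pos (Real.exp_pos x) (Real.exp_pos a)).le)]

/-! ### Completely monotone functions given by densities. -/

/-- The Laplace transform of a density given in logarithmic coordinates. -/
noncomputable def sFun (w : ℝ → ℝ) (t : ℝ) : ℝ := ∫ x, Real.exp (-(t * Real.exp x)) * w x

/-- Densities with a convergent Stieltjes transform. -/
structure SDens (w : ℝ → ℝ) : Prop where
  cont : Continuous w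
  int : Integrable fun x => w x / (Real.exp x + 1)

theorem pow_mul_exp_le {y t : ℝ} (hy : 0 ≤ y) (ht : 0 < t) (m : ℕ) :
    y ^ m * Real.exp (-(t * y)) ≤ m.factorial / t ^ m := by
  have h := Real.pow_div_factorial_le_exp (t * y) (by positivity) m
  rw [Real.exp_neg, ← div_eq_mul_inv, div_le_div_iff₀ (Real.exp_pos _) (by positivity)]
  rw [div_le_iff₀ (by positivity), mul_pow] at h
  linarith

/-- Uniformity for `t ≥ t₀` permits repeated differentiation under the integral when only the
Stieltjes integrability of the density is available. -/
theorem exists_pow_mul_exp_le {t₀ : ℝ} (ht₀ : 0 < t₀) (m : ℕ) : ∃ C : ℝ, 0 ≤ C ∧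
    ∀ t : ℝ, t₀ ≤ t → ∀ x : ℝ, Real.exp x ^ m * Real.exp (-(t * Real.exp x)) ≤
      C / (Real.exp x + 1) := by
  refine ⟨(m + 1).factorial / t₀ ^ (m + 1) + m.factorial / t₀ ^ m, by positivity,
    fun t ht x => ?_⟩
  have hx := Real.exp_pos x
  have h1 : Real.exp (-(t * Real.exp x)) ≤ Real.exp (-(t₀ * Real.exp x)) := by
    rw [Real.exp_le_exp]; nlinarith
  rw [le_div_iff₀ (by positivity)]
  have h2 := pow_mul_exp_le hx.le ht₀ (m + 1)
  have h3 := pow_mul_exp_le hx.le ht₀ m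
  calc Real.exp x ^ m * Real.exp (-(t * Real.exp x)) * (Real.exp x + 1)
      ≤ Real.exp x ^ m * Real.exp (-(t₀ * Real.exp x)) * (Real.exp x + 1) := by gcongr
    _ = Real.exp x ^ (m + 1) * Real.exp (-(t₀ * Real.exp x)) +
        Real.exp x ^ m * Real.exp (-(t₀ * Real.exp x)) := by ring
    _ ≤ _ := add_le_add h2 h3

theorem SDens.integrable_of_bound {w : ℝ → ℝ} (hw : SDens w) {g : ℝ → ℝ} (hg : Continuous g) {C : ℝ}
    (h : ∀ x, |g x| ≤ C / (Real.exp x + 1)) : Integrable fun x => g x * w x := by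
  refine Integrable.mono' (hw.int.norm.const_mul C) (hg.mul hw.cont).aestronglyMeasurable
    (ae_of_all _ fun x => ?_)
  rw [norm_mul, norm_div, Real.norm_eq_abs, Real.norm_eq_abs, Real.norm_eq_abs,
    abs_of_pos (add_pos (Real.exp_pos x) one_pos)]
  have := mul_le_mul_of_nonneg_right (h x) (abs_nonneg (w x))
  calc _ ≤ _ := this
    _ = _ := by ring

theorem SDens.integrable_div {w : ℝ → ℝ} (hw : SDens w) {l : ℝ} (hl : 0 < l) :
    Integrable fun x => w x / (Real.exp x + l) := by
  have := hw.integrable_of_bound (g := fun x => (Real.exp x + l)⁻¹) (C := 1 + l⁻¹)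
    (Continuous.inv₀ (by fun_prop) fun x => (add_pos (Real.exp_pos x) hl).ne') fun x => by
      have hx := Real.exp_pos x
      rw [abs_of_pos (by positivity), inv_eq_one_div, div_le_div_iff₀ (by positivity) (by positivity)]
      have : (1 + l⁻¹) * (Real.exp x + l) = Real.exp x + 1 + (l + l⁻¹ * Real.exp x) := by
        field_simp; ring
      rw [this]
      have : 0 ≤ l + l⁻¹ * Real.exp x := by positivity
      linarith
  simpa only [div_eq_inv_mul] using this

theorem SDens.integrable_exp {w : ℝ → ℝ} (hw : SDens w) (m : ℕ) {t : ℝ} (ht : 0 < t) :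
    Integrable fun x => (-Real.exp x) ^ m * Real.exp (-(t * Real.exp x)) * w x := by
  obtain ⟨C, -, hC⟩ := exists_pow_mul_exp_le ht m
  refine hw.integrable_of_bound (by fun_prop) (C := C) fun x => ?_
  rw [abs_mul, abs_pow, abs_neg, abs_of_pos (Real.exp_pos _), abs_of_pos (Real.exp_pos _)]
  exact hC t le_rfl x

theorem SDens.hasDerivAt {w : ℝ → ℝ} (hw : SDens w) (m : ℕ) {t : ℝ} (ht : 0 < t) :
    HasDerivAt (fun t => ∫ x, (-Real.exp x) ^ m * Real.exp (-(t * Real.exp x)) * w x)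
      (∫ x, (-Real.exp x) ^ (m + 1) * Real.exp (-(t * Real.exp x)) * w x) t := by
  obtain ⟨C, hC0, hC⟩ := exists_pow_mul_exp_le (half_pos ht) (m + 1)
  refine (hasDerivAt_integral_of_dominated_loc_of_deriv_le (s := Ioi (t / 2))
    (bound := fun x => C * ‖w x / (Real.exp x + 1)‖)
    (F := fun t x => (-Real.exp x) ^ m * Real.exp (-(t * Real.exp x)) * w x)
    (F' := fun t x => (-Real.exp x) ^ (m + 1) * Real.exp (-(t * Real.exp x)) * w x)
    (Ioi_mem_nhds (by linarith)) ?_ (hw.integrable_exp m ht) ?_ ?_ (hw.int.norm.const_mul C) ?_).2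
  · refine Eventually.of_forall fun s => Continuous.aestronglyMeasurable ?_
    have := hw.cont
    fun_prop
  · have := hw.cont
    exact Continuous.aestronglyMeasurable (by fun_prop)
  · refine ae_of_all _ fun x s hs => ?_
    rw [norm_mul, norm_mul, norm_pow, norm_neg, norm_div, Real.norm_eq_abs, Real.norm_eq_abs,
      Real.norm_eq_abs, Real.norm_eq_abs, abs_of_pos (Real.exp_pos _), abs_of_pos (Real.exp_pos _),
      abs_of_pos (add_pos (Real.exp_pos x) one_pos)]
    have := mul_le_mul_of_nonneg_right (hC s (le_of_lt hs) x) (abs_nonneg (w x))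
    calc _ ≤ _ := this
      _ = _ := by ring
  · refine ae_of_all _ fun x s _ => ?_
    have h1 : HasDerivAt (fun t => -(t * Real.exp x)) (-(1 * Real.exp x)) s :=
      ((hasDerivAt_id s).mul_const _).neg
    have h2 := (h1.exp.const_mul ((-Real.exp x) ^ m)).mul_const (w x)
    refine h2.congr_deriv ?_
    rw [pow_succ]; ring

theorem contDiffOn_of_hasDerivAt {F : ℕ → ℝ → ℝ}
    (h : ∀ m, ∀ t : ℝ, 0 < t → HasDerivAt (F m) (F (m + 1) t) t) :
    ContDiffOn ℝ ∞ (F 0) (Ioi 0) ∧ ∀ m, ∀ t : ℝ, 0 < t → iteratedDeriv m (F 0) t = F m t := by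
  constructor
  · rw [contDiffOn_infty]
    intro n
    suffices ∀ n m : ℕ, ContDiffOn ℝ n (F m) (Ioi 0) from this n 0
    intro n
    induction n with
    | zero =>
      intro m
      exact contDiffOn_zero.2 fun t ht => (h m t ht).continuousAt.continuousWithinAt
    | succ n ih =>
      intro m
      push_cast
      refine (contDiffOn_succ_iff_deriv_of_isOpen isOpen_Ioi).2
        ⟨fun t ht => (h m t ht).differentiableAt.differentiableWithinAt, by simp, ?_⟩
      exact (ih (m + 1)).congr fun t ht => (h m t ht).deriv
  · intro m
    induction m with
    | zero => intro t _; simp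
    | succ m ih =>
      intro t ht
      rw [iteratedDeriv_succ]
      have : iteratedDeriv m (F 0) =ᶠ[𝓝 t] F m := by
        filter_upwards [Ioi_mem_nhds ht] with s hs using ih s hs
      rw [this.deriv_eq, (h m t ht).deriv]

theorem SDens.isCM {w : ℝ → ℝ} (hw : SDens w) (h0 : ∀ x, 0 ≤ w x) : IsCM (sFun w) := by
  have h := contDiffOn_of_hasDerivAt
    (F := fun m t => ∫ x, (-Real.exp x) ^ m * Real.exp (-(t * Real.exp x)) * w x)
    fun m t ht => hw.hasDerivAt m ht
  have e : sFun w = fun t => ∫ x, (-Real.exp x) ^ 0 * Real.exp (-(t * Real.exp x)) * w x := by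
    ext t; simp [sFun]
  rw [e]
  refine ⟨h.1, fun m t ht => ?_⟩
  rw [h.2 m t ht, ← integral_const_mul]
  refine integral_nonneg fun x => ?_
  simp only [Pi.zero_apply]
  rw [← mul_assoc, ← mul_assoc, ← mul_pow]
  have := Real.exp_pos x
  have := h0 x
  have : 0 ≤ -1 * -Real.exp x := by linarith
  positivity

theorem integral_exp_neg_Ioi {a : ℝ} (ha : 0 < a) :
    ∫ t in Ioi (0 : ℝ), Real.exp (-a * t) = a⁻¹ := by
  rw [integral_exp_mul_Ioi (by linarith)]
  simp

theorem SDens.laplace_aux {w : ℝ → ℝ} (hw : SDens w) {l : ℝ} (hl : 0 < l) :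
    Integrable (Function.uncurry fun (t x : ℝ) =>
      Real.exp (-(l * t)) * (Real.exp (-(t * Real.exp x)) * w x))
      ((volume.restrict (Ioi 0)).prod volume) := by
  have hc := hw.cont
  have hmeas : AEStronglyMeasurable (Function.uncurry fun (t x : ℝ) =>
      Real.exp (-(l * t)) * (Real.exp (-(t * Real.exp x)) * w x))
      ((volume.restrict (Ioi 0)).prod volume) := by
    refine Continuous.aestronglyMeasurable ?_
    simp only [Function.uncurry_def]
    fun_prop
  have hexp : ∀ x : ℝ, IntegrableOn (fun t => Real.exp (-(Real.exp x + l) * t)) (Ioi 0) :=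
    fun x => exp_neg_integrableOn_Ioi 0 (add_pos (Real.exp_pos x) hl)
  have heq : ∀ t x : ℝ, Real.exp (-(l * t)) * (Real.exp (-(t * Real.exp x)) * w x) =
      Real.exp (-(Real.exp x + l) * t) * w x := by
    intro t x
    rw [← mul_assoc, ← Real.exp_add]
    congr 2; ring
  refine (integrable_prod_iff' hmeas).2 ⟨ae_of_all _ fun x => ?_, ?_⟩
  · simp only [Function.uncurry_apply_pair, heq]
    exact (hexp x).mul_const _
  · simp only [Function.uncurry_apply_pair, heq]
    refine (hw.integrable_div hl).norm.congr (ae_of_all _ fun x => ?_)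
    simp only [norm_mul, Real.norm_eq_abs, abs_of_pos (Real.exp_pos _)]
    rw [integral_mul_const, integral_exp_neg_Ioi (add_pos (Real.exp_pos x) hl), abs_div,
      abs_of_pos (add_pos (Real.exp_pos x) hl), div_eq_inv_mul]

theorem SDens.la {w : ℝ → ℝ} (hw : SDens w) : LA (sFun w) := by
  intro l hl
  have := (hw.laplace_aux hl).integral_prod_left
  simp only [Function.uncurry_apply_pair, integral_const_mul] at this
  exact this

theorem SDens.laplace_eq {w : ℝ → ℝ} (hw : SDens w) {l : ℝ} (hl : 0 < l) :
    laplace (sFun w) l = ∫ x, w x / (Real.exp x + l) := by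
  have h := integral_integral_swap (hw.laplace_aux hl)
  simp only [integral_const_mul] at h
  rw [laplace]
  simp only [sFun]
  rw [h]
  congr 1 with x
  have : ∀ t : ℝ, Real.exp (-(l * t)) * (Real.exp (-(t * Real.exp x)) * w x) =
      Real.exp (-(Real.exp x + l) * t) * w x := by
    intro t
    rw [← mul_assoc, ← Real.exp_add]
    congr 2; ring
  simp only [this]
  rw [integral_mul_const, integral_exp_neg_Ioi (add_pos (Real.exp_pos x) hl), div_eq_inv_mul]

theorem SDens.continuousOn {w : ℝ → ℝ} (hw : SDens w) : ContinuousOn (sFun w) (Ioi 0) := by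
  intro t ht
  have := (hw.hasDerivAt 0 ht).continuousAt.continuousWithinAt (s := Ioi 0)
  simp only [pow_zero, one_mul] at this
  exact this

theorem LA.locInt {f : ℝ → ℝ} (hf : LA f) : LocInt f := by
  intro T hT
  have h1 := (hf 1 one_pos).mono_set (Ioc_subset_Ioi_self : Ioc 0 T ⊆ Ioi 0)
  have h2 : IntegrableOn (fun t => Real.exp t * (Real.exp (-(1 * t)) * f t)) (Ioc 0 T) := by
    refine h1.bdd_mul (c := Real.exp T) (by fun_prop) ?_
    refine (ae_restrict_iff' measurableSet_Ioc).2 (ae_of_all _ fun t ht => ?_)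
    rw [Real.norm_eq_abs, abs_of_pos (Real.exp_pos _), Real.exp_le_exp]
    exact ht.2
  refine h2.congr_fun (fun t _ => ?_) measurableSet_Ioc
  simp only
  rw [← mul_assoc, ← Real.exp_add]
  simp

theorem StripFun.sDens {Φ : ℂ → ℂ} (h : StripFun Φ) (h0 : ∀ x, (Φ (edge x)).im ≤ 0) :
    SDens (dens Φ) :=
  ⟨continuous_dens h.diff, by simpa using h.integrable h0 0⟩

theorem StripFun.laplace_eq {Φ : ℂ → ℂ} (h : StripFun Φ) (hw : SDens (dens Φ)) {l : ℝ} (hl : 0 < l) :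
    laplace (sFun (dens Φ)) l = (Φ (Real.log l)).re := by
  have h1 := hw.integrable_div hl
  have h2 := h.integral_eq (Real.log l) (by simpa [Real.exp_log hl] using h1)
  rw [hw.laplace_eq hl, ← h2, Real.exp_log hl]

/-! ### The function `(exp w - 1) / w` on the strip. -/

/-- The entire function `(exp w - 1) / w = ∫₀¹ exp (α w) dα`. -/
noncomputable def expQuot : ℂ → ℂ := dslope Complex.exp 0

theorem expQuot_of_ne {w : ℂ} (hw : w ≠ 0) : expQuot w = (Complex.exp w - 1) / w := by
  rw [expQuot, dslope_of_ne _ hw, slope_def_field]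
  simp

theorem differentiable_expQuot : Differentiable ℂ expQuot := by
  rw [← differentiableOn_univ, expQuot, Complex.differentiableOn_dslope univ_mem]
  exact Complex.differentiable_exp.differentiableOn

theorem expQuot_eq_integral (w : ℂ) : expQuot w = ∫ α in (0 : ℝ)..1, Complex.exp (α * w) := by
  by_cases hw : w = 0
  · simp [hw, expQuot, dslope_same]
  · simp only [mul_comm _ w]
    rw [expQuot_of_ne hw, integral_exp_mul_complex hw]
    simp

theorem expQuot_conj (w : ℂ) : expQuot (starRingEnd ℂ w) = starRingEnd ℂ (expQuot w) := by
  by_cases hw : w = 0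
  · simp [hw, expQuot, dslope_same]
  · rw [expQuot_of_ne hw, expQuot_of_ne (by simpa using hw), Complex.exp_conj]
    simp

theorem expQuot_im (w : ℂ) : (expQuot w).im =
    ∫ α in (0 : ℝ)..1, Real.exp (α * w.re) * Real.sin (α * w.im) := by
  rw [expQuot_eq_integral, ← Complex.imCLM_apply, ← ContinuousLinearMap.intervalIntegral_comp_comm]
  · simp [Complex.exp_im]
  · exact (by fun_prop : Continuous fun α : ℝ => Complex.exp (α * w)).intervalIntegrable _ _

theorem expQuot_re (w : ℂ) : (expQuot w).re =
    ∫ α in (0 : ℝ)..1, Real.exp (α * w.re) * Real.cos (α * w.im) := by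
  rw [expQuot_eq_integral, ← Complex.reCLM_apply, ← ContinuousLinearMap.intervalIntegral_comp_comm]
  · simp [Complex.exp_re]
  · exact (by fun_prop : Continuous fun α : ℝ => Complex.exp (α * w)).intervalIntegrable _ _

/-- In the average of `exp(αw)` over `0 < α < 1` each term has argument `α Im w`, strictly inside
`(0, π)` even when `Im w = π`. This is how a closed bound on arguments improves to an open one. -/
theorem expQuot_im_pos {w : ℂ} (h0 : 0 < w.im) (h1 : w.im ≤ Real.pi) : 0 < (expQuot w).im := by
  rw [expQuot_im]
  refine intervalIntegral.intervalIntegral_pos_of_pos_on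
    ((by fun_prop : Continuous fun α : ℝ => Real.exp (α * w.re) *
      Real.sin (α * w.im)).intervalIntegrable _ _) (fun α hα => ?_) one_pos
  refine mul_pos (Real.exp_pos _) (Real.sin_pos_of_pos_of_lt_pi (mul_pos hα.1 h0) ?_)
  nlinarith [hα.2]

theorem expQuot_mem_slitPlane {w : ℂ} (h : |w.im| ≤ Real.pi) : expQuot w ∈ Complex.slitPlane := by
  rcases lt_trichotomy w.im 0 with h0 | h0 | h0
  · have h1 := expQuot_im_pos (w := starRingEnd ℂ w) (by simpa using h0)
      (by simpa using (neg_le_abs w.im).trans h)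
    rw [expQuot_conj] at h1
    exact Or.inr (by simp only [Complex.conj_im] at h1; linarith)
  · left
    rw [expQuot_re, h0]
    refine intervalIntegral.intervalIntegral_pos_of_pos_on
      ((by fun_prop : Continuous fun α : ℝ => Real.exp (α * w.re) *
        Real.cos (α * 0)).intervalIntegrable _ _) (fun α _ => ?_) one_pos
    simp [Real.exp_pos]
  · exact Or.inr (expQuot_im_pos h0 ((le_abs_self _).trans h)).ne'

/-- This absorbs `‖w‖ ≤ |Re w| + π` in the lower bounds below. As `π < 4`, the left side is at most
`y + y²/2`. -/
theorem add_pi_mul_le {y : ℝ} (hy : 0 < y) : y / 4 * (y + Real.pi) ≤ Real.exp y - 1 := by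
  have h1 := Real.quadratic_le_exp_of_nonneg hy.le
  nlinarith [Real.pi_lt_four, sq_nonneg y]

theorem norm_le_re_add_pi {w : ℂ} (h : |w.im| ≤ Real.pi) : ‖w‖ ≤ |w.re| + Real.pi :=
  (Complex.norm_le_abs_re_add_abs_im w).trans (by linarith)

/-- After taking logarithms, the lower bound sends the new function to infinity, while the upper
bound leaves it behind `Re w` by at least `log (Re w / 2)`. In the companion for `Re w < 0` the two
bounds exchange these roles. -/
theorem norm_expQuot_of_re_pos {w : ℂ} (h : |w.im| ≤ Real.pi) (hy : 0 < w.re) :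
    w.re / 4 ≤ ‖expQuot w‖ ∧ ‖expQuot w‖ ≤ Real.exp w.re * (2 / w.re) := by
  have hw : w ≠ 0 := fun h0 => by simp [h0] at hy
  have hn : 0 < ‖w‖ := norm_pos_iff.2 hw
  have h1 : w.re ≤ ‖w‖ := Complex.re_le_norm w
  have h2 := norm_le_re_add_pi h
  rw [abs_of_pos hy] at h2
  rw [expQuot_of_ne hw, norm_div]
  have h3 : ‖Complex.exp w‖ = Real.exp w.re := Complex.norm_exp w
  have h4 := norm_sub_norm_le (Complex.exp w) 1
  have h5 := norm_sub_le (Complex.exp w) 1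
  rw [h3, norm_one] at h4 h5
  have h6 : 1 ≤ Real.exp w.re := Real.one_le_exp hy.le
  constructor
  · rw [le_div_iff₀ hn]
    have := add_pi_mul_le hy
    nlinarith
  · rw [div_le_iff₀ hn]
    have : Real.exp w.re * (2 / w.re) * ‖w‖ ≥ Real.exp w.re * (2 / w.re) * w.re := by
      have : 0 ≤ Real.exp w.re * (2 / w.re) := by positivity
      gcongr
    have e : Real.exp w.re * (2 / w.re) * w.re = 2 * Real.exp w.re := by field_simp
    linarith

theorem norm_expQuot_of_re_neg {w : ℂ} (h : |w.im| ≤ Real.pi) (hy : w.re < 0) :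
    Real.exp w.re * (-w.re / 4) ≤ ‖expQuot w‖ ∧ ‖expQuot w‖ ≤ 2 / (-w.re) := by
  have hw : w ≠ 0 := fun h0 => by simp [h0] at hy
  have hn : 0 < ‖w‖ := norm_pos_iff.2 hw
  have h1 : -w.re ≤ ‖w‖ := (neg_le_abs _).trans (Complex.abs_re_le_norm w)
  have h2 := norm_le_re_add_pi h
  rw [abs_of_neg hy] at h2
  rw [expQuot_of_ne hw, norm_div]
  have h3 : ‖Complex.exp w‖ = Real.exp w.re := Complex.norm_exp w
  have h4 := norm_sub_norm_le 1 (Complex.exp w)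
  have h5 := norm_sub_le (Complex.exp w) 1
  rw [norm_sub_rev] at h4
  rw [h3, norm_one] at h4 h5
  have h6 : Real.exp w.re ≤ 1 := Real.exp_le_one_iff.2 hy.le
  have hs : 0 < -w.re := by linarith
  constructor
  · rw [le_div_iff₀ hn]
    have h7 := add_pi_mul_le hs
    have h8 : Real.exp w.re * (Real.exp (-w.re) - 1) = 1 - Real.exp w.re := by
      rw [mul_sub, ← Real.exp_add]; simp
    have h9 : -w.re / 4 * ‖w‖ ≤ Real.exp (-w.re) - 1 := by nlinarith
    have := mul_le_mul_of_nonneg_left h9 (Real.exp_pos w.re).le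
    linarith
  · rw [div_le_iff₀ hn]
    have : 2 / (-w.re) * ‖w‖ ≥ 2 / (-w.re) * (-w.re) := by
      have : 0 ≤ 2 / (-w.re) := by positivity
      gcongr
    have e : 2 / (-w.re) * (-w.re) = 2 := div_mul_cancel₀ _ hs.ne'
    linarith

/-! ### Complete Bernstein functions in logarithmic coordinates. -/

/-- Logarithms (in the variable `log λ`) of functions mapping the upper half-plane to itself, with
values in the closed strip. -/
structure PreCBF (L : ℂ → ℂ) : Prop where
  diff : ∀ z ∈ Strip, DifferentiableAt ℂ L z
  conj : ∀ z ∈ Strip, L (starRingEnd ℂ z) = starRingEnd ℂ (L z)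
  im_mem : ∀ z ∈ Strip, 0 < z.im → (L z).im ∈ Ioc 0 Real.pi
  top : Tendsto (fun z => (L z).re) stripTop atTop
  bot : Tendsto (fun z => (L z).re) stripBot atBot
  gap_top : ∀ᶠ z in stripTop, 0 ≤ z.re - (L z).re
  gap_bot : ∀ᶠ z in stripBot, z.re - (L z).re ≤ 0

/-- Logarithms (in the variable `log λ`) of complete Bernstein functions which are unbounded, vanish
at `0`, and have neither drift nor finite slope at `0`. -/
structure LogCBF (L : ℂ → ℂ) : Prop where
  diff : ∀ z ∈ Strip, DifferentiableAt ℂ L z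
  conj : ∀ z ∈ Strip, L (starRingEnd ℂ z) = starRingEnd ℂ (L z)
  im_mem : ∀ z ∈ Strip, 0 < z.im → (L z).im ∈ Ioo 0 Real.pi
  top : Tendsto (fun z => (L z).re) stripTop atTop
  bot : Tendsto (fun z => (L z).re) stripBot atBot
  gap_top : Tendsto (fun z => z.re - (L z).re) stripTop atTop
  gap_bot : Tendsto (fun z => z.re - (L z).re) stripBot atBot

theorem preCBF_id : PreCBF id :=
  ⟨fun _ _ => differentiableAt_id, fun _ _ => rfl, fun _ hz h0 => ⟨h0, (le_abs_self _).trans hz⟩,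
    tendsto_re_stripTop, tendsto_re_stripBot, by simp, by simp⟩

theorem LogCBF.pre {L : ℂ → ℂ} (h : LogCBF L) : PreCBF L :=
  ⟨h.diff, h.conj, fun z hz h0 => Ioo_subset_Ioc_self (h.im_mem z hz h0), h.top, h.bot,
    h.gap_top.eventually_ge_atTop 0, h.gap_bot.eventually_le_atBot 0⟩

theorem im_eq_zero_of_conj {L : ℂ → ℂ}
    (hc : ∀ z ∈ Strip, L (starRingEnd ℂ z) = starRingEnd ℂ (L z)) {z : ℂ} (hz : z ∈ Strip)
    (h0 : z.im = 0) : (L z).im = 0 := by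
  have h1 := hc z hz
  rw [Complex.conj_eq_iff_im.2 h0] at h1
  exact Complex.conj_eq_iff_im.1 h1.symm

theorem PreCBF.abs_im_le {L : ℂ → ℂ} (h : PreCBF L) {z : ℂ} (hz : z ∈ Strip) :
    |(L z).im| ≤ Real.pi := by
  rcases lt_trichotomy z.im 0 with h0 | h0 | h0
  · have h1 := h.im_mem _ (conj_mem_strip hz) (by simpa using h0)
    rw [h.conj z hz, Complex.conj_im] at h1
    exact abs_le.2 ⟨by linarith [h1.2], by linarith [h1.1, Real.pi_pos]⟩
  · rw [im_eq_zero_of_conj h.conj hz h0, abs_zero]; exact Real.pi_pos.le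
  · have h1 := h.im_mem z hz h0
    exact abs_le.2 ⟨by linarith [h1.1, Real.pi_pos], h1.2⟩

theorem LogCBF.abs_im_lt {L : ℂ → ℂ} (h : LogCBF L) {z : ℂ} (hz : z ∈ Strip) :
    |(L z).im| < Real.pi := by
  rcases lt_trichotomy z.im 0 with h0 | h0 | h0
  · have h1 := h.im_mem _ (conj_mem_strip hz) (by simpa using h0)
    rw [h.conj z hz, Complex.conj_im] at h1
    exact abs_lt.2 ⟨by linarith [h1.2], by linarith [h1.1, Real.pi_pos]⟩
  · rw [im_eq_zero_of_conj h.conj hz h0, abs_zero]; exact Real.pi_pos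
  · have h1 := h.im_mem z hz h0
    exact abs_lt.2 ⟨by linarith [h1.1, Real.pi_pos], h1.2⟩

theorem log_conj_of_mem {w : ℂ} (h : w ∈ Complex.slitPlane) :
    Complex.log (starRingEnd ℂ w) = starRingEnd ℂ (Complex.log w) :=
  Complex.log_conj _ (Complex.mem_slitPlane_iff_arg.1 h).1

theorem log_im_mem {w : ℂ} (h : 0 < w.im) : (Complex.log w).im ∈ Ioo 0 Real.pi := by
  rw [Complex.log_im]
  refine ⟨?_, ?_⟩
  · refine lt_of_le_of_ne (Complex.arg_nonneg_iff.2 h.le) fun h0 => ?_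
    exact h.ne' (Complex.arg_eq_zero_iff.1 h0.symm).2
  · exact Complex.arg_lt_pi_iff.2 (Or.inr h.ne')

/-- The map `g ↦ (g - 1) / log g` in logarithmic coordinates. -/
noncomputable def stepLog (L : ℂ → ℂ) (z : ℂ) : ℂ := Complex.log (expQuot (L z))

/-- The step gains on every count: arguments move from `(0, π]` into `(0, π)`, and division by `log
g` turns a gap of the right sign into an infinite one. Hence the identity, which satisfies only the
weak conditions, can start the recursion. -/
theorem PreCBF.step {L : ℂ → ℂ} (h : PreCBF L) : LogCBF (stepLog L) := by
  have hslit : ∀ z ∈ Strip, expQuot (L z) ∈ Complex.slitPlane := fun z hz =>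
    expQuot_mem_slitPlane (h.abs_im_le hz)
  have hnorm : ∀ z ∈ Strip, 0 < ‖expQuot (L z)‖ := fun z hz =>
    norm_pos_iff.2 (Complex.slitPlane_ne_zero (hslit z hz))
  have h4 : Tendsto (fun z => Real.log ((L z).re / 4)) stripTop atTop :=
    Real.tendsto_log_atTop.comp (h.top.atTop_div_const (by norm_num))
  have h2 : Tendsto (fun z => Real.log ((L z).re / 2)) stripTop atTop :=
    Real.tendsto_log_atTop.comp (h.top.atTop_div_const (by norm_num))
  have hb : Tendsto (fun z => -(L z).re) stripBot atTop := tendsto_neg_atBot_atTop.comp h.bot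
  have h5 : Tendsto (fun z => -Real.log (-(L z).re / 4)) stripBot atBot :=
    tendsto_neg_atTop_atBot.comp
      (Real.tendsto_log_atTop.comp (hb.atTop_div_const (by norm_num)))
  have h6 : Tendsto (fun z => -Real.log (-(L z).re / 2)) stripBot atBot :=
    tendsto_neg_atTop_atBot.comp
      (Real.tendsto_log_atTop.comp (hb.atTop_div_const (by norm_num)))
  refine ⟨fun z hz => ?_, fun z hz => ?_, fun z hz h0 => ?_, ?_, ?_, ?_, ?_⟩
  · exact DifferentiableAt.clog ((differentiable_expQuot _).comp z (h.diff z hz)) (hslit z hz)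
  · rw [stepLog, stepLog, h.conj z hz, expQuot_conj, log_conj_of_mem (hslit z hz)]
  · have h1 := h.im_mem z hz h0
    exact log_im_mem (expQuot_im_pos h1.1 h1.2)
  · refine tendsto_atTop_mono' _ ?_ h4
    filter_upwards [eventually_mem_stripTop, h.top.eventually_gt_atTop 0] with z hz hpos
    rw [stepLog, Complex.log_re]
    exact Real.log_le_log (by positivity) (norm_expQuot_of_re_pos (h.abs_im_le hz) hpos).1
  · refine tendsto_atBot_mono' _ ?_ h6
    filter_upwards [eventually_mem_stripBot, h.bot.eventually_lt_atBot 0] with z hz hneg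
    rw [stepLog, Complex.log_re, ← Real.log_inv, inv_div]
    exact Real.log_le_log (hnorm z hz) (norm_expQuot_of_re_neg (h.abs_im_le hz) hneg).2
  · refine tendsto_atTop_mono' _ ?_ h2
    filter_upwards [eventually_mem_stripTop, h.top.eventually_gt_atTop 0, h.gap_top]
      with z hz hpos hgap
    rw [stepLog, Complex.log_re]
    have h7 := Real.log_le_log (hnorm z hz) (norm_expQuot_of_re_pos (h.abs_im_le hz) hpos).2
    rw [Real.log_mul (Real.exp_pos _).ne' (by positivity), Real.log_exp, ← inv_div,
      Real.log_inv] at h7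
    linarith
  · refine tendsto_atBot_mono' _ ?_ h5
    filter_upwards [eventually_mem_stripBot, h.bot.eventually_lt_atBot 0, h.gap_bot]
      with z hz hneg hgap
    rw [stepLog, Complex.log_re]
    have hs : 0 < -(L z).re := by linarith
    have h7 := Real.log_le_log (by positivity) (norm_expQuot_of_re_neg (h.abs_im_le hz) hneg).1
    rw [Real.log_mul (Real.exp_pos _).ne' (by positivity), Real.log_exp] at h7
    linarith

/-- The logarithm of `g_n`, where `g_0 = λ` and `g_{n+1} = (g_n - 1) / log g_n`. -/
noncomputable def logG : ℕ → ℂ → ℂ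
  | 0 => id
  | n + 1 => stepLog (logG n)

theorem preCBF_logG (n : ℕ) : PreCBF (logG n) := by
  induction n with
  | zero => exact preCBF_id
  | succ n ih => exact ih.step.pre

theorem logCBF_logG (n : ℕ) : LogCBF (logG (n + 1)) := (preCBF_logG n).step

/-! ### Stieltjes functions built from a complete Bernstein function. -/

section kernels

variable {L : ℂ → ℂ}

/-- At the left end `Re z ≤ δ Re z`, because `Re z ≤ 0` and `δ ≤ 1`, so the decay reduces to `δ`
times the gap between `z` and `L`. The same device serves at the right end for `exp(δL - z)`. -/
theorem LogCBF.stripFun_exp_neg (h : LogCBF L) {δ : ℝ} (h0 : 0 < δ) (h1 : δ ≤ 1) :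
    StripFun fun z => Complex.exp (-(δ * L z)) := by
  refine ⟨fun z hz => ?_, fun z hz => ?_, ?_, ?_⟩
  · have := h.diff z hz
    fun_prop
  · rw [h.conj z hz, ← Complex.exp_conj]
    simp
  · rw [tendsto_zero_iff_norm_tendsto_zero]
    simp only [Complex.norm_exp]
    refine Real.tendsto_exp_atBot.comp ?_
    simp only [Complex.neg_re, Complex.re_ofReal_mul]
    exact tendsto_neg_atTop_atBot.comp (h.top.const_mul_atTop h0)
  · rw [tendsto_zero_iff_norm_tendsto_zero]
    simp only [← Complex.exp_add, Complex.norm_exp]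
    refine Real.tendsto_exp_atBot.comp ?_
    refine tendsto_atBot_mono' _ ?_ (h.gap_bot.const_mul_atBot h0)
    filter_upwards [tendsto_re_stripBot.eventually_le_atBot 0] with z hz
    simp only [Complex.add_re, Complex.neg_re, Complex.re_ofReal_mul]
    nlinarith

theorem LogCBF.sin_nonneg (h : LogCBF L) {δ : ℝ} (h0 : 0 < δ) (h1 : δ ≤ 1) (x : ℝ) :
    0 ≤ Real.sin (δ * (L (edge x)).im) := by
  have := h.im_mem (edge x) (edge_mem x) (by simp [Real.pi_pos])
  exact Real.sin_nonneg_of_nonneg_of_le_pi (by nlinarith [this.1]) (by nlinarith [this.1, this.2])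

theorem LogCBF.exp_neg_im_nonpos (h : LogCBF L) {δ : ℝ} (h0 : 0 < δ) (h1 : δ ≤ 1) (x : ℝ) :
    (Complex.exp (-(δ * L (edge x)))).im ≤ 0 := by
  have := h.sin_nonneg h0 h1 x
  rw [Complex.exp_im, Complex.neg_im, Complex.im_ofReal_mul, Real.sin_neg]
  nlinarith [Real.exp_pos (-(δ * L (edge x))).re]

theorem LogCBF.stripFun_exp_sub (h : LogCBF L) {δ : ℝ} (h0 : 0 < δ) (h1 : δ ≤ 1) :
    StripFun fun z => Complex.exp (δ * L z - z) := by
  refine ⟨fun z hz => ?_, fun z hz => ?_, ?_, ?_⟩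
  · have := h.diff z hz
    fun_prop
  · rw [h.conj z hz, ← Complex.exp_conj]
    simp
  · rw [tendsto_zero_iff_norm_tendsto_zero]
    simp only [Complex.norm_exp]
    refine Real.tendsto_exp_atBot.comp ?_
    refine tendsto_atBot_mono' _ ?_
      (tendsto_neg_atTop_atBot.comp (h.gap_top.const_mul_atTop h0))
    filter_upwards [tendsto_re_stripTop.eventually_ge_atTop 0] with z hz
    simp only [Function.comp, Complex.sub_re, Complex.re_ofReal_mul]
    nlinarith
  · rw [tendsto_zero_iff_norm_tendsto_zero]
    simp only [← Complex.exp_add, Complex.norm_exp]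
    refine Real.tendsto_exp_atBot.comp ?_
    simp only [add_sub_cancel, Complex.re_ofReal_mul]
    exact h.bot.const_mul_atBot h0

theorem exp_sub_edge (w : ℂ) (x : ℝ) :
    Complex.exp (w - edge x) = ((-Real.exp (-x) : ℝ) : ℂ) * Complex.exp w := by
  rw [sub_eq_add_neg, Complex.exp_add, Complex.exp_neg, exp_edge, Real.exp_neg]
  push_cast
  rw [inv_neg, mul_comm]

theorem dens_exp_sub (L : ℂ → ℂ) (δ x : ℝ) :
    dens (fun z => Complex.exp (δ * L z - z)) x =
      (Complex.exp (δ * L (edge x))).im / Real.pi := by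
  rw [dens, exp_sub_edge, Complex.im_ofReal_mul]
  have : Real.exp (-x) * Real.exp x = 1 := by rw [← Real.exp_add]; simp
  congr 1
  linear_combination (Complex.exp (δ * L (edge x))).im * this

theorem LogCBF.exp_sub_im_nonpos (h : LogCBF L) {δ : ℝ} (h0 : 0 < δ) (h1 : δ ≤ 1) (x : ℝ) :
    (Complex.exp (δ * L (edge x) - edge x)).im ≤ 0 := by
  have := h.sin_nonneg h0 h1 x
  rw [exp_sub_edge, Complex.im_ofReal_mul, Complex.exp_im, Complex.im_ofReal_mul]
  have h2 := mul_nonneg (Real.exp_pos (-x)).le (mul_nonneg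
    (Real.exp_pos (δ * L (edge x)).re).le this)
  linarith

theorem exp_mem_slitPlane {w : ℂ} (h : |w.im| < Real.pi) : Complex.exp w ∈ Complex.slitPlane := by
  have h' := abs_lt.1 h
  rw [Complex.mem_slitPlane_iff_arg]
  refine ⟨?_, Complex.exp_ne_zero _⟩
  rw [Complex.arg_exp, (toIocMod_eq_self _).2 ⟨h'.1, by linarith⟩]
  exact h'.2.ne

theorem add_mem_slitPlane {w : ℂ} (h : w ∈ Complex.slitPlane) {η : ℝ} (hη : 0 ≤ η) :
    w + η ∈ Complex.slitPlane := by
  rcases h with h | h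
  · exact Or.inl (by simp; linarith)
  · exact Or.inr (by simpa using h)

theorem LogCBF.exp_add_mem (h : LogCBF L) {η : ℝ} (hη : 0 ≤ η) {z : ℂ} (hz : z ∈ Strip) :
    Complex.exp (L z) + η ∈ Complex.slitPlane :=
  add_mem_slitPlane (exp_mem_slitPlane (h.abs_im_lt hz)) hη

theorem LogCBF.exp_im_pos (h : LogCBF L) {z : ℂ} (hz : z ∈ Strip) (h0 : 0 < z.im) :
    0 < (Complex.exp (L z)).im := by
  have := h.im_mem z hz h0
  rw [Complex.exp_im]
  exact mul_pos (Real.exp_pos _) (Real.sin_pos_of_pos_of_lt_pi this.1 this.2)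

theorem LogCBF.tendsto_exp_neg_top (h : LogCBF L) :
    Tendsto (fun z => Complex.exp (-L z)) stripTop (𝓝 0) := by
  rw [tendsto_zero_iff_norm_tendsto_zero]
  simp only [Complex.norm_exp, Complex.neg_re]
  exact Real.tendsto_exp_neg_atTop_nhds_zero.comp h.top

theorem LogCBF.tendsto_exp_bot (h : LogCBF L) :
    Tendsto (fun z => Complex.exp (L z)) stripBot (𝓝 0) := by
  rw [tendsto_zero_iff_norm_tendsto_zero]
  simp only [Complex.norm_exp]
  exact Real.tendsto_exp_atBot.comp h.bot

theorem LogCBF.stripFun_inv (h : LogCBF L) {η : ℝ} (hη : 0 < η) :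
    StripFun fun z => (Complex.exp (L z) + η)⁻¹ := by
  refine ⟨fun z hz => ?_, fun z hz => ?_, ?_, ?_⟩
  · have := h.diff z hz
    have h2 := Complex.slitPlane_ne_zero (h.exp_add_mem hη.le hz)
    fun_prop (disch := exact h2)
  · rw [h.conj z hz, Complex.exp_conj]
    simp
  · have h1 : Tendsto (fun z => Complex.exp (-L z) * (1 + η * Complex.exp (-L z))⁻¹) stripTop
        (𝓝 (0 * (1 + (η : ℂ) * 0)⁻¹)) :=
      h.tendsto_exp_neg_top.mul (((h.tendsto_exp_neg_top.const_mul _).const_add 1).inv₀ (by simp))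
    rw [zero_mul] at h1
    refine h1.congr fun z => ?_
    have := Complex.exp_ne_zero (L z)
    rw [Complex.exp_neg, ← mul_inv, mul_add, mul_one]
    congr 2
    field_simp
  · have h1 : Tendsto (fun z => Complex.exp z * (Complex.exp (L z) + η)⁻¹) stripBot
        (𝓝 (0 * (0 + (η : ℂ))⁻¹)) :=
      tendsto_exp_stripBot.mul ((h.tendsto_exp_bot.add_const _).inv₀ (by simpa using hη.ne'))
    rwa [zero_mul] at h1

theorem LogCBF.inv_im_nonpos (h : LogCBF L) (η x : ℝ) :
    ((Complex.exp (L (edge x)) + η)⁻¹).im ≤ 0 := by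
  have h1 := h.exp_im_pos (edge_mem x) (by simp [Real.pi_pos])
  rw [Complex.inv_im]
  refine div_nonpos_of_nonpos_of_nonneg ?_ (Complex.normSq_nonneg _)
  simp only [Complex.add_im, Complex.ofReal_im, add_zero]
  linarith

/-- The logarithm of `sqrt (g (g + η))`. -/
noncomputable def logM (L : ℂ → ℂ) (η : ℝ) (z : ℂ) : ℂ :=
  (L z + Complex.log (Complex.exp (L z) + η)) / 2

/-- The argument is the mean of two arguments in `(0, π)`. In the real part, `log |g + η|` follows
`Re L` at the right end and tends to `log η` at the left, where the function is thus comparable to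
`sqrt (ηg)` and the gap only gets larger. -/
theorem LogCBF.logM (h : LogCBF L) {η : ℝ} (hη : 0 < η) : LogCBF (logM L η) := by
  have hre : ∀ z, (SlowVariance.logM L η z).re =
      ((L z).re + Real.log ‖Complex.exp (L z) + η‖) / 2 := by
    intro z
    rw [SlowVariance.logM, Complex.div_ofNat_re, Complex.add_re, Complex.log_re]
  have htop : Tendsto (fun z => Real.log ‖Complex.exp (L z) + η‖ - (L z).re) stripTop (𝓝 0) := by
    have h1 : Tendsto (fun z => Real.log ‖1 + η * Complex.exp (-L z)‖) stripTop
        (𝓝 (Real.log ‖1 + η * (0 : ℂ)‖)) :=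
      ((h.tendsto_exp_neg_top.const_mul _).const_add 1).norm.log (by simp)
    simp only [mul_zero, add_zero, norm_one, Real.log_one] at h1
    refine h1.congr' ?_
    filter_upwards [eventually_mem_stripTop] with z hz
    have h2 : Complex.exp (L z) + η = Complex.exp (L z) * (1 + η * Complex.exp (-L z)) := by
      rw [mul_add, mul_one, mul_left_comm, ← Complex.exp_add]; simp
    have h3 := Complex.slitPlane_ne_zero (h.exp_add_mem hη.le hz)
    rw [h2] at h3 ⊢
    rw [norm_mul, Complex.norm_exp, Real.log_mul (Real.exp_pos _).ne'
      (norm_ne_zero_iff.2 (right_ne_zero_of_mul h3)), Real.log_exp]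
    ring
  have hbot : Tendsto (fun z => Real.log ‖Complex.exp (L z) + η‖) stripBot (𝓝 (Real.log η)) := by
    have h1 : Tendsto (fun z => Real.log ‖Complex.exp (L z) + η‖) stripBot
        (𝓝 (Real.log ‖(0 : ℂ) + η‖)) :=
      (h.tendsto_exp_bot.add_const _).norm.log (by simpa using hη.ne')
    simpa [abs_of_pos hη] using h1
  refine ⟨fun z hz => ?_, fun z hz => ?_, fun z hz h0 => ?_, ?_, ?_, ?_, ?_⟩
  · have := h.diff z hz
    exact (this.add ((this.cexp.add_const _).clog (h.exp_add_mem hη.le hz))).div_const _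
  · rw [SlowVariance.logM, SlowVariance.logM, h.conj z hz, Complex.exp_conj,
      show starRingEnd ℂ (Complex.exp (L z)) + η = starRingEnd ℂ (Complex.exp (L z) + η) by simp,
      log_conj_of_mem (h.exp_add_mem hη.le hz), map_div₀, map_add, Complex.conj_ofNat]
  · have h1 := h.im_mem z hz h0
    have h2 := log_im_mem (w := Complex.exp (L z) + η) (by simpa using h.exp_im_pos hz h0)
    rw [SlowVariance.logM, Complex.div_ofNat_im, Complex.add_im]
    exact ⟨by linarith [h1.1, h2.1], by linarith [h1.2, h2.2]⟩
  · have h1 := htop.add_atTop (h.top.const_mul_atTop (two_pos))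
    refine (h1.atTop_div_const two_pos).congr fun z => ?_
    rw [hre]; ring
  · refine ((hbot.add_atBot h.bot).atBot_div_const two_pos).congr fun z => ?_
    rw [hre]; ring
  · have h1 := htop.neg.add_atTop (h.gap_top.const_mul_atTop (two_pos))
    refine (h1.atTop_div_const two_pos).congr fun z => ?_
    rw [hre]; ring
  · have h1 := hbot.neg.add_atBot ((h.gap_bot.atBot_add_atBot tendsto_re_stripBot))
    refine (h1.atBot_div_const two_pos).congr fun z => ?_
    rw [hre]; ring

end kernels

/-! ### Identification of the kernels of the recursion. -/

/-- `f` is the locally integrable completely monotone function with Laplace transform `F`. -/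
structure CMFor (f F : ℝ → ℝ) : Prop where
  cm : IsCM f
  locInt : LocInt f
  laplace : ∀ x : ℝ, 0 < x → laplace f x = F x

theorem CMFor.kern {f F : ℝ → ℝ} (h : CMFor f F) : Kern f := h.cm.kern h.locInt
theorem CMFor.dom {f F : ℝ → ℝ} (h : CMFor f F) : Dom f := h.cm.dom h.locInt
theorem CMFor.la {f F : ℝ → ℝ} (h : CMFor f F) : LA f := h.kern.laplace_integrable

theorem CMFor.congr_right {f F G : ℝ → ℝ} (h : CMFor f F) (hFG : ∀ x : ℝ, 0 < x → F x = G x) :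
    CMFor f G := ⟨h.cm, h.locInt, fun x hx => (h.laplace x hx).trans (hFG x hx)⟩

theorem CMFor.unique {f g F : ℝ → ℝ} (hf : CMFor f F) (hg : CMFor g F) {t : ℝ} (ht : 0 < t) :
    f t = g t :=
  eq_of_laplace_eq hf.la hg.la hf.cm.continuousOn hg.cm.continuousOn
    (fun x hx => (hf.laplace x hx).trans (hg.laplace x hx).symm) t ht

theorem CMFor.congr_left {f g F : ℝ → ℝ} (h : CMFor f F) (hfg : ∀ t : ℝ, 0 < t → g t = f t) :
    CMFor g F := by
  refine ⟨⟨h.cm.1.congr hfg, fun m t ht => ?_⟩, fun T hT => ?_, fun x hx => ?_⟩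
  · have : g =ᶠ[𝓝 t] f := by
      filter_upwards [Ioi_mem_nhds ht] with s hs using hfg s hs
    rw [this.iteratedDeriv_eq m]
    exact h.cm.2 m t ht
  · exact (h.locInt T hT).congr_fun (fun t ht => (hfg t ht.1).symm) measurableSet_Ioc
  · rw [laplace_congr hfg, h.laplace x hx]

theorem CMFor.conv_eq_one {f g F G : ℝ → ℝ} (hf : CMFor f F) (hg : CMFor g G)
    (h : ∀ x : ℝ, 0 < x → F x * G x = 1 / x) : ∀ t : ℝ, 0 < t → conv f g t = 1 :=
  (conv_eq_one_iff hf.kern hf.cm.continuousOn hg.kern hg.cm.continuousOn).2 fun x hx => by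
    rw [hf.laplace x hx, hg.laplace x hx, h x hx]

theorem StripFun.cmFor {Φ : ℂ → ℂ} (h : StripFun Φ) (h0 : ∀ x, (Φ (edge x)).im ≤ 0) :
    CMFor (sFun (dens Φ)) fun x => (Φ (Real.log x)).re :=
  have hw := h.sDens h0
  ⟨hw.isCM (dens_nonneg h0), hw.la.locInt, fun _ hx => h.laplace_eq hw hx⟩

/-- The function `g` whose logarithm, in the variable `log λ`, is `L`. -/
noncomputable def gOf (L : ℂ → ℂ) (x : ℝ) : ℝ := Real.exp (L (Real.log x)).re

theorem gOf_pos (L : ℂ → ℂ) (x : ℝ) : 0 < gOf L x := Real.exp_pos _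

section
variable {L : ℂ → ℂ}

theorem PreCBF.ofReal (h : PreCBF L) (a : ℝ) : L a = ((L a).re : ℂ) := by
  apply Complex.ext
  · simp
  · simpa using im_eq_zero_of_conj h.conj (ofReal_mem_strip a) (by simp)

theorem PreCBF.exp_ofReal (h : PreCBF L) (x : ℝ) :
    Complex.exp (L (Real.log x)) = (gOf L x : ℂ) := by
  rw [h.ofReal, gOf, Complex.ofReal_exp]

theorem LogCBF.cmFor_exp_neg (h : LogCBF L) {δ : ℝ} (h0 : 0 < δ) (h1 : δ ≤ 1) :
    CMFor (sFun (dens fun z => Complex.exp (-(δ * L z)))) fun x => ((gOf L x)⁻¹) ^ δ := by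
  refine ((h.stripFun_exp_neg h0 h1).cmFor (h.exp_neg_im_nonpos h0 h1)).congr_right fun x _ => ?_
  rw [h.pre.ofReal, gOf, ← Real.exp_neg, ← Real.exp_mul, ← Complex.ofReal_mul, ← Complex.ofReal_neg,
    Complex.exp_ofReal_re]
  congr 1; ring

theorem LogCBF.cmFor_exp_sub (h : LogCBF L) {δ : ℝ} (h0 : 0 < δ) (h1 : δ ≤ 1) :
    CMFor (sFun (dens fun z => Complex.exp (δ * L z - z))) fun x => (gOf L x) ^ δ / x := by
  refine ((h.stripFun_exp_sub h0 h1).cmFor (h.exp_sub_im_nonpos h0 h1)).congr_right fun x hx => ?_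
  rw [h.pre.ofReal, gOf, ← Real.exp_mul, ← Complex.ofReal_mul, ← Complex.ofReal_sub,
    Complex.exp_ofReal_re, Real.exp_sub, Real.exp_log hx, mul_comm]

theorem LogCBF.cmFor_inv (h : LogCBF L) {η : ℝ} (hη : 0 < η) :
    CMFor (sFun (dens fun z => (Complex.exp (L z) + η)⁻¹)) fun x => (gOf L x + η)⁻¹ := by
  refine ((h.stripFun_inv hη).cmFor (h.inv_im_nonpos η)).congr_right fun x _ => ?_
  rw [h.pre.exp_ofReal, ← Complex.ofReal_add, ← Complex.ofReal_inv, Complex.ofReal_re]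

/-- The choice operator says nothing until a candidate exists; the Stieltjes function with boundary
values of `exp(-δL)` is that candidate. `CMFor.partner` settles the other choice in the same way. -/
theorem CMFor.powKernel {ψ : ℝ → ℝ} (h : LogCBF L) (hψ : CMFor ψ fun x => (gOf L x)⁻¹) {δ : ℝ}
    (h0 : 0 < δ) (h1 : δ ≤ 1) :
    CMFor (powKernel ψ δ) fun x => ((gOf L x)⁻¹) ^ δ := by
  have hex : ∃ f : ℝ → ℝ, IsCM f ∧ LocInt f ∧
      ∀ x : ℝ, 0 < x → SlowVariance.laplace f x = SlowVariance.laplace ψ x ^ δ := by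
    have := h.cmFor_exp_neg h0 h1
    exact ⟨_, this.cm, this.locInt, fun x hx => by rw [this.laplace x hx, hψ.laplace x hx]⟩
  have := Classical.epsilon_spec hex
  exact ⟨this.1, this.2.1, fun x hx => (this.2.2 x hx).trans (by rw [hψ.laplace x hx])⟩

theorem CMFor.partner {k l F G : ℝ → ℝ} (hk : CMFor k F) (hl : CMFor l G)
    (hF : ∀ x : ℝ, 0 < x → 0 < F x) (hFG : ∀ x : ℝ, 0 < x → F x * G x = 1 / x) :
    CMFor (partner k) G ∧ ∀ t : ℝ, 0 < t → SlowVariance.conv k (SlowVariance.partner k) t = 1 := by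
  have hex : ∃ l : ℝ → ℝ, IsCM l ∧ LocInt l ∧ ∀ t : ℝ, 0 < t → SlowVariance.conv k l t = 1 :=
    ⟨l, hl.cm, hl.locInt, hk.conv_eq_one hl hFG⟩
  have hp : IsCM (SlowVariance.partner k) ∧ LocInt (SlowVariance.partner k) ∧
      ∀ t : ℝ, 0 < t → SlowVariance.conv k (SlowVariance.partner k) t = 1 :=
    Classical.epsilon_spec hex
  refine ⟨⟨hp.1, hp.2.1, fun x hx => ?_⟩, hp.2.2⟩
  have := (conv_eq_one_iff hk.kern hk.cm.continuousOn (hp.1.kern hp.2.1) hp.1.continuousOn).1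
    hp.2.2 x hx
  rw [hk.laplace x hx, ← hFG x hx] at this
  exact mul_left_cancel₀ (hF x hx).ne' this

/-- The transform must be `g^δ/λ`, and uniqueness then gives the function with its density. The
integral over `δ` can therefore be carried out on densities. -/
theorem partner_powKernel {ψ : ℝ → ℝ} (h : LogCBF L) (hψ : CMFor ψ fun x => (gOf L x)⁻¹) {δ : ℝ}
    (h0 : 0 < δ) (h1 : δ ≤ 1) {t : ℝ} (ht : 0 < t) :
    partner (powKernel ψ δ) t = sFun (dens fun z => Complex.exp (δ * L z - z)) t := by
  have hk := CMFor.powKernel h hψ h0 h1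
  have hl := h.cmFor_exp_sub h0 h1
  refine (hk.partner hl (fun x _ => Real.rpow_pos_of_pos (inv_pos.2 (gOf_pos L x)) δ)
    fun x hx => ?_).1.unique hl ht
  rw [mul_div_assoc', ← Real.mul_rpow (inv_pos.2 (gOf_pos L x)).le (gOf_pos L x).le,
    inv_mul_cancel₀ (gOf_pos L x).ne', Real.one_rpow]

theorem exp_stepLog (h : PreCBF L) {z : ℂ} (hz : z ∈ Strip) :
    Complex.exp (stepLog L z) = expQuot (L z) :=
  Complex.exp_log (Complex.slitPlane_ne_zero (expQuot_mem_slitPlane (h.abs_im_le hz)))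

/-- This is where the recursion for `g` originates: on the edge `∫₀¹ exp(δL) dδ` is `expQuot L`,
that is `(g - 1) / log g`. -/
theorem integral_dens_exp_sub (h : PreCBF L) (x : ℝ) :
    ∫ δ in (0 : ℝ)..1, dens (fun z => Complex.exp (δ * L z - z)) x =
      dens (fun z => Complex.exp ((1 : ℝ) * stepLog L z - z)) x := by
  simp only [dens_exp_sub]
  rw [intervalIntegral.integral_div, Complex.ofReal_one, one_mul, exp_stepLog h (edge_mem x),
    expQuot_im]
  simp [Complex.exp_im]

theorem integral_sFun_exp_sub (h : LogCBF L) {t : ℝ} (ht : 0 < t) :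
    ∫ δ in (0 : ℝ)..1, sFun (dens fun z => Complex.exp (δ * L z - z)) t =
      sFun (dens fun z => Complex.exp ((1 : ℝ) * stepLog L z - z)) t := by
  have hs := h.pre.step
  have hcE := StripFun.continuous_edge h.diff
  have hint : Integrable (Function.uncurry fun (δ x : ℝ) =>
      Real.exp (-(t * Real.exp x)) * dens (fun z => Complex.exp (δ * L z - z)) x)
      ((volume.restrict (Ioc 0 1)).prod volume) := by
    have hm : AEStronglyMeasurable (Function.uncurry fun (δ x : ℝ) =>
        Real.exp (-(t * Real.exp x)) * dens (fun z => Complex.exp (δ * L z - z)) x)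
        ((volume.restrict (Ioc 0 1)).prod volume) := by
      refine Continuous.aestronglyMeasurable ?_
      simp only [Function.uncurry_def, dens_exp_sub]
      have : Continuous fun p : ℝ × ℝ => Complex.exp (p.1 * L (edge p.2)) := by
        have h2 : Continuous fun p : ℝ × ℝ => L (edge p.2) := hcE.comp (continuous_snd (X := ℝ))
        exact Complex.continuous_exp.comp ((by fun_prop : Continuous fun p : ℝ × ℝ =>
          (p.1 : ℂ)).mul h2)
      exact Continuous.mul (by fun_prop) ((Complex.continuous_im.comp this).div_const _)
    refine (integrable_prod_iff' hm).2 ⟨ae_of_all _ fun x => ?_, ?_⟩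
    · simp only [Function.uncurry_apply_pair, dens_exp_sub]
      refine Integrable.const_mul ?_ _
      have : Continuous fun δ : ℝ => (Complex.exp (δ * L (edge x))).im / Real.pi :=
        (Complex.continuous_im.comp (by fun_prop)).div_const _
      exact this.integrableOn_Ioc
    · simp only [Function.uncurry_apply_pair]
      -- The densities are nonnegative, so the inner integral of the norm is the density belonging
      -- to `stepLog L`, whose integrability is already known.
      have h1 := ((hs.stripFun_exp_sub one_pos le_rfl).sDens
        (hs.exp_sub_im_nonpos one_pos le_rfl)).integrable_exp 0 ht
      simp only [pow_zero, one_mul] at h1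
      refine h1.congr (ae_of_all _ fun x => ?_)
      simp only
      rw [← integral_dens_exp_sub h.pre, intervalIntegral.integral_of_le zero_le_one,
        ← integral_const_mul]
      refine setIntegral_congr_fun measurableSet_Ioc fun δ hδ => ?_
      rw [Real.norm_eq_abs, abs_of_nonneg]
      exact mul_nonneg (Real.exp_pos _).le (dens_nonneg (h.exp_sub_im_nonpos hδ.1 hδ.2) x)
  rw [intervalIntegral.integral_of_le zero_le_one]
  simp only [sFun]
  rw [integral_integral_swap hint]
  congr 1 with x
  rw [integral_const_mul, ← intervalIntegral.integral_of_le zero_le_one,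
    integral_dens_exp_sub h.pre]

theorem CMFor.nextPhi {ψ : ℝ → ℝ} (h : LogCBF L) (hψ : CMFor ψ fun x => (gOf L x)⁻¹) :
    CMFor (nextPhi ψ) fun x => gOf (stepLog L) x / x := by
  have hs := h.pre.step.cmFor_exp_sub one_pos le_rfl
  simp only [Real.rpow_one] at hs
  refine hs.congr_left fun t ht => ?_
  rw [SlowVariance.nextPhi, ← integral_sFun_exp_sub h ht]
  refine intervalIntegral.integral_congr_ae (ae_of_all _ fun δ hδ => ?_)
  rw [uIoc_of_le zero_le_one] at hδ
  exact partner_powKernel h hψ hδ.1 hδ.2 ht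

theorem CMFor.partner_nextPhi {ψ : ℝ → ℝ} (h : LogCBF L) (hψ : CMFor ψ fun x => (gOf L x)⁻¹) :
    CMFor (SlowVariance.partner (SlowVariance.nextPhi ψ)) (fun x => (gOf (stepLog L) x)⁻¹) ∧
      ∀ t : ℝ, 0 < t →
        SlowVariance.conv (SlowVariance.nextPhi ψ) (SlowVariance.partner (SlowVariance.nextPhi ψ)) t
          = 1 := by
  have hl := h.pre.step.cmFor_exp_neg one_pos le_rfl
  simp only [Real.rpow_one] at hl
  refine (CMFor.nextPhi h hψ).partner hl (fun x hx => div_pos (gOf_pos _ x) hx) fun x hx => ?_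
  have := (gOf_pos (stepLog L) x).ne'
  field_simp

end

/-- On the upper edge `1/g_1 = -(x + iπ)/(exp x + 1)`, whose imaginary part no longer contains the
logarithm. With `s = exp x` the density becomes `ds/(1 + s)`, the one which defines `ψ₁`. -/
theorem dens_psiOne (x : ℝ) : dens (fun z => Complex.exp (-((1 : ℝ) * logG 1 z))) x =
    Real.exp x / (Real.exp x + 1) := by
  have hne : edge x ≠ 0 := fun h => by
    have := congrArg Complex.im h
    simp [Real.pi_ne_zero] at this
  have hpos := add_pos (Real.exp_pos x) one_pos
  have e1 : Complex.exp (-((1 : ℝ) * logG 1 (edge x))) =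
      ((-(Real.exp x + 1)⁻¹ : ℝ) : ℂ) * edge x := by
    rw [Complex.ofReal_one, one_mul, Complex.exp_neg, show logG 1 = stepLog id from rfl,
      exp_stepLog preCBF_id (edge_mem x), id, expQuot_of_ne hne, exp_edge, inv_div,
      show (-((Real.exp x : ℝ) : ℂ) - 1) = ((-(Real.exp x + 1) : ℝ) : ℂ) by push_cast; ring,
      div_eq_inv_mul, ← Complex.ofReal_inv, inv_neg]
  rw [dens, e1, Complex.im_ofReal_mul, edge_im]
  field_simp

theorem psiOne_eq (t : ℝ) :
    psiOne t = sFun (dens fun z => Complex.exp (-((1 : ℝ) * logG 1 z))) t := by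
  have h := integral_image_eq_integral_abs_deriv_smul (s := univ) MeasurableSet.univ
    (fun x _ => (Real.hasDerivAt_exp x).hasDerivWithinAt) Real.exp_injective.injOn
    (fun s => Real.exp (-(s * t)) / (1 + s))
  rw [image_univ, Real.range_exp] at h
  rw [psiOne, h, Measure.restrict_univ, sFun]
  congr 1 with x
  rw [dens_psiOne, abs_of_pos (Real.exp_pos x), smul_eq_mul, mul_comm (Real.exp x) t,
    add_comm 1 (Real.exp x)]
  ring

/-- The induction runs through the second components alone. It starts from the explicit density of
`ψ₁`; the function `φ₁` plays no part for `n ≥ 2`. Entry `m` belongs to `g_{m+1}`. -/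
theorem cmFor_kernelPair (m : ℕ) :
    CMFor (kernelPair m).2 fun x => (gOf (logG (m + 1)) x)⁻¹ := by
  induction m with
  | zero =>
    have h := (logCBF_logG 0).cmFor_exp_neg one_pos le_rfl
    simp only [Real.rpow_one] at h
    exact h.congr_left fun t _ => psiOne_eq t
  | succ m ih => exact (CMFor.partner_nextPhi (logCBF_logG m) ih).1

theorem cmFor_psi {n : ℕ} (hn : 1 ≤ n) : CMFor (psi n) fun x => (gOf (logG n) x)⁻¹ := by
  obtain ⟨m, rfl⟩ := Nat.exists_eq_add_of_le' hn
  exact cmFor_kernelPair m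

theorem cmFor_phi {n : ℕ} (hn : 2 ≤ n) : CMFor (phi n) fun x => gOf (logG n) x / x := by
  obtain ⟨m, rfl⟩ := Nat.exists_eq_add_of_le' hn
  exact CMFor.nextPhi (logCBF_logG m) (cmFor_kernelPair m)

theorem conv_phi_psi {n : ℕ} (hn : 2 ≤ n) {t : ℝ} (ht : 0 < t) : conv (phi n) (psi n) t = 1 := by
  obtain ⟨m, rfl⟩ := Nat.exists_eq_add_of_le' hn
  exact (CMFor.partner_nextPhi (logCBF_logG m) (cmFor_kernelPair m)).2 t ht

theorem isPC_phi_psi {n : ℕ} (hn : 2 ≤ n) : IsPC (phi n) (psi n) :=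
  have hk := (cmFor_phi hn).kern
  ⟨hk.locInt, (cmFor_psi (by omega)).locInt, hk.nonneg, hk.anti, fun _ ht => conv_phi_psi hn ht⟩

/-! ### Bounded approximations of a complete Bernstein function. -/

/-- The reason for regularising the square root of `exp Λ`: its argument is below `π/2`, so the
denominator never drops below one. The values of `exp Λ` itself may approach the negative axis,
where `1 + ε exp Λ` can be small. -/
theorem one_le_norm_one_add {v : ℂ} (hr : 0 ≤ v.re) {ε : ℝ} (hε : 0 ≤ ε) : 1 ≤ ‖1 + ε * v‖ := by
  have h1 := Complex.re_le_norm (1 + ε * v)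
  simp only [Complex.add_re, Complex.one_re, Complex.re_ofReal_mul] at h1
  nlinarith [mul_nonneg hε hr]

theorem one_add_ne_zero {v : ℂ} (hr : 0 ≤ v.re) {ε : ℝ} (hε : 0 ≤ ε) : 1 + ε * v ≠ 0 :=
  norm_pos_iff.1 (one_pos.trans_le (one_le_norm_one_add hr hε))

theorem reg_norm_le {v : ℂ} (hr : 0 ≤ v.re) {ε : ℝ} (hε : 0 ≤ ε) : ‖v / (1 + ε * v)‖ ≤ ‖v‖ := by
  rw [norm_div]
  exact div_le_self (norm_nonneg _) (one_le_norm_one_add hr hε)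

/-- The map `v ↦ v/(1 + εv)` preserves the closed first quadrant, so the square of the image remains
in the closed upper half-plane; and it does not increase imaginary parts, which makes domination
uniform in `ε` possible. -/
theorem reg_re_im {v : ℂ} (hr : 0 ≤ v.re) (hi : 0 ≤ v.im) {ε : ℝ} (hε : 0 ≤ ε) :
    0 ≤ (v / (1 + ε * v)).re ∧ 0 ≤ (v / (1 + ε * v)).im ∧ (v / (1 + ε * v)).im ≤ v.im := by
  have hN : Complex.normSq (1 + ε * v) = ‖1 + ε * v‖ ^ 2 := Complex.normSq_eq_norm_sq _
  have hN1 : 1 ≤ Complex.normSq (1 + ε * v) := by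
    rw [hN]; nlinarith [one_le_norm_one_add hr hε]
  have hN0 : 0 < Complex.normSq (1 + ε * v) := by linarith
  have him : (v / (1 + ε * v)).im = v.im / Complex.normSq (1 + ε * v) := by
    rw [Complex.div_im]
    simp only [Complex.add_re, Complex.one_re, Complex.re_ofReal_mul, Complex.add_im,
      Complex.one_im, Complex.im_ofReal_mul]
    ring
  refine ⟨?_, ?_, ?_⟩
  · rw [Complex.div_re]
    simp only [Complex.add_re, Complex.one_re, Complex.re_ofReal_mul, Complex.add_im,
      Complex.one_im, Complex.im_ofReal_mul, zero_add]
    positivity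
  · rw [him]; positivity
  · rw [him]; exact div_le_self hi hN1

theorem sq_im (y : ℂ) : (y ^ 2).im = 2 * y.re * y.im := by
  rw [pow_two, Complex.mul_im]; ring

/-- The control on the imaginary part which makes the representation of the solution converge. -/
theorem abs_im_mul_exp_le {b : ℂ} (hb : 0 ≤ b.im) {τ : ℝ} (hτ : 0 ≤ τ) :
    |(b * Complex.exp (-(τ * b))).im| ≤ Real.exp (2 * τ * ‖b‖) * b.im := by
  have hre : |b.re| ≤ ‖b‖ := Complex.abs_re_le_norm b
  have h1 : (b * Complex.exp (-(τ * b))).im = Real.exp (-(τ * b.re)) *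
      (b.im * Real.cos (τ * b.im) - b.re * Real.sin (τ * b.im)) := by
    rw [Complex.mul_im, Complex.exp_re, Complex.exp_im, Complex.neg_re, Complex.neg_im,
      Complex.re_ofReal_mul, Complex.im_ofReal_mul, Real.cos_neg, Real.sin_neg]
    ring
  rw [h1, abs_mul, abs_of_pos (Real.exp_pos _)]
  have h2 : Real.exp (-(τ * b.re)) ≤ Real.exp (τ * ‖b‖) := by
    rw [Real.exp_le_exp]
    have := neg_abs_le b.re
    nlinarith
  have h3 : |b.im * Real.cos (τ * b.im) - b.re * Real.sin (τ * b.im)| ≤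
      Real.exp (τ * ‖b‖) * b.im := by
    have hsin : |Real.sin (τ * b.im)| ≤ τ * b.im := by
      have := Real.abs_sin_le_abs (x := τ * b.im)
      rwa [abs_of_nonneg (mul_nonneg hτ hb)] at this
    have hcos := Real.abs_cos_le_one (τ * b.im)
    calc _ ≤ |b.im * Real.cos (τ * b.im)| + |b.re * Real.sin (τ * b.im)| := abs_sub _ _
      _ = b.im * |Real.cos (τ * b.im)| + |b.re| * |Real.sin (τ * b.im)| := by
        rw [abs_mul, abs_mul, abs_of_nonneg hb]
      _ ≤ b.im * 1 + ‖b‖ * (τ * b.im) := by gcongr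
      _ = (τ * ‖b‖ + 1) * b.im := by ring
      _ ≤ _ := mul_le_mul_of_nonneg_right (Real.add_one_le_exp _) hb
  calc _ ≤ Real.exp (τ * ‖b‖) * (Real.exp (τ * ‖b‖) * b.im) := by gcongr
    _ = _ := by rw [← mul_assoc, ← Real.exp_add]; ring_nf

/-- The square root of `exp Λ`. -/
noncomputable def rootM (Λ : ℂ → ℂ) (z : ℂ) : ℂ := Complex.exp (Λ z / 2)

/-- Bounded complete Bernstein functions which approximate `exp Λ`. -/
noncomputable def regM (Λ : ℂ → ℂ) (ε : ℝ) (z : ℂ) : ℂ := (rootM Λ z / (1 + ε * rootM Λ z)) ^ 2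

theorem regM_zero (Λ : ℂ → ℂ) (z : ℂ) : regM Λ 0 z = Complex.exp (Λ z) := by
  rw [regM, rootM, Complex.ofReal_zero, zero_mul, add_zero, div_one, ← Complex.exp_nat_mul]
  congr 1; push_cast; ring

section
variable {Λ : ℂ → ℂ} (h : LogCBF Λ)
include h

theorem LogCBF.rootM_re {z : ℂ} (hz : z ∈ Strip) : 0 < (rootM Λ z).re := by
  have := abs_lt.1 (h.abs_im_lt hz)
  rw [rootM, Complex.exp_re, Complex.div_ofNat_im]
  exact mul_pos (Real.exp_pos _) (Real.cos_pos_of_mem_Ioo ⟨by linarith, by linarith⟩)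

theorem LogCBF.rootM_im (x : ℝ) : 0 ≤ (rootM Λ (edge x)).im := by
  have := h.sin_nonneg (δ := 1 / 2) (by norm_num) (by norm_num) x
  rw [rootM, Complex.exp_im, Complex.div_ofNat_im]
  rw [one_div_mul_eq_div] at this
  exact mul_nonneg (Real.exp_pos _).le this

theorem LogCBF.regM_im {ε : ℝ} (hε : 0 ≤ ε) (x : ℝ) : 0 ≤ (regM Λ ε (edge x)).im := by
  have := reg_re_im (h.rootM_re (edge_mem x)).le (h.rootM_im x) hε
  rw [regM, sq_im]
  have h1 := mul_nonneg this.1 this.2.1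
  linarith

theorem LogCBF.regM_im_le {ε : ℝ} (hε : 0 ≤ ε) (x : ℝ) :
    (regM Λ ε (edge x)).im ≤ 2 * ‖rootM Λ (edge x)‖ * (rootM Λ (edge x)).im := by
  have h1 := reg_re_im (h.rootM_re (edge_mem x)).le (h.rootM_im x) hε
  have h2 := reg_norm_le (h.rootM_re (edge_mem x)).le hε
  rw [regM, sq_im]
  have h3 := (Complex.re_le_norm _).trans h2
  have := mul_le_mul h3 h1.2.2 h1.2.1 (norm_nonneg _)
  linarith

theorem LogCBF.regM_norm_le {ε : ℝ} (hε : 0 ≤ ε) {z : ℂ} (hz : z ∈ Strip) :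
    ‖regM Λ ε z‖ ≤ ‖Complex.exp (Λ z)‖ := by
  have h2 := reg_norm_le (h.rootM_re hz).le hε
  rw [← regM_zero, regM, regM, norm_pow, norm_pow]
  simp only [Complex.ofReal_zero, zero_mul, add_zero, div_one]
  gcongr

theorem LogCBF.regM_diff {ε : ℝ} (hε : 0 ≤ ε) {z : ℂ} (hz : z ∈ Strip) :
    DifferentiableAt ℂ (regM Λ ε) z := by
  have h1 : DifferentiableAt ℂ (rootM Λ) z := ((h.diff z hz).div_const 2).cexp
  exact (h1.div ((h1.const_mul _).const_add 1) (one_add_ne_zero (h.rootM_re hz).le hε)).pow 2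

theorem LogCBF.regM_conj (ε : ℝ) {z : ℂ} (hz : z ∈ Strip) :
    regM Λ ε (starRingEnd ℂ z) = starRingEnd ℂ (regM Λ ε z) := by
  have : rootM Λ (starRingEnd ℂ z) = starRingEnd ℂ (rootM Λ z) := by
    rw [rootM, rootM, h.conj z hz, ← Complex.exp_conj, map_div₀, Complex.conj_ofNat]
  rw [regM, regM, this]
  simp

theorem LogCBF.regM_top {ε : ℝ} (hε : 0 < ε) :
    Tendsto (regM Λ ε) stripTop (𝓝 ((ε : ℂ)⁻¹ ^ 2)) := by
  have h1 : Tendsto (fun z => Complex.exp (-(Λ z / 2))) stripTop (𝓝 0) := by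
    rw [tendsto_zero_iff_norm_tendsto_zero]
    simp only [Complex.norm_exp, Complex.neg_re, Complex.div_ofNat_re]
    exact Real.tendsto_exp_neg_atTop_nhds_zero.comp (h.top.atTop_div_const two_pos)
  have hε' : (ε : ℂ) ≠ 0 := by exact_mod_cast hε.ne'
  have h2 : Tendsto (fun z => ((Complex.exp (-(Λ z / 2)) + ε)⁻¹) ^ 2) stripTop
      (𝓝 (((0 : ℂ) + ε)⁻¹ ^ 2)) :=
    ((h1.add_const _).inv₀ (by simpa using hε')).pow 2
  rw [zero_add] at h2
  refine h2.congr fun z => ?_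
  have := Complex.exp_ne_zero (Λ z / 2)
  rw [regM, rootM, Complex.exp_neg]
  congr 1
  rw [← inv_div]
  field_simp

theorem LogCBF.regM_bot {ε : ℝ} : Tendsto (regM Λ ε) stripBot (𝓝 0) := by
  have h1 : Tendsto (rootM Λ) stripBot (𝓝 0) := by
    rw [tendsto_zero_iff_norm_tendsto_zero]
    simp only [rootM, Complex.norm_exp, Complex.div_ofNat_re]
    exact Real.tendsto_exp_atBot.comp (h.bot.atBot_div_const two_pos)
  have h2 : Tendsto (regM Λ ε) stripBot (𝓝 ((0 / (1 + (ε : ℂ) * 0)) ^ 2)) :=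
    (h1.div ((h1.const_mul _).const_add 1) (by simp)).pow 2
  simpa using h2

/-- The constant `ε⁻²` is the limit of `regM` at the right end, so the difference decays there. It
is the Stieltjes function in whose powers the exponential will be expanded. -/
theorem LogCBF.stripFun_sub_regM {ε : ℝ} (hε : 0 < ε) :
    StripFun fun z => (ε : ℂ)⁻¹ ^ 2 - regM Λ ε z := by
  refine ⟨fun z hz => (h.regM_diff hε.le hz).const_sub _, fun z hz => ?_, ?_, ?_⟩
  · rw [h.regM_conj ε hz]; simp
  · have := (h.regM_top hε).const_sub ((ε : ℂ)⁻¹ ^ 2)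
    rwa [sub_self] at this
  · have h1 : Tendsto (fun z => (ε : ℂ)⁻¹ ^ 2 - regM Λ ε z) stripBot (𝓝 ((ε : ℂ)⁻¹ ^ 2 - 0)) :=
      h.regM_bot.const_sub _
    have h2 := tendsto_exp_stripBot.mul h1
    rwa [zero_mul] at h2

/-- As `b = regM` has finite limits at both ends, so has `b exp(-τb)`. The factor `exp(-z) = 1/λ`
supplies the decay on the right, and `b → 0` the decay on the left. -/
theorem LogCBF.stripFun_regM {ε : ℝ} (hε : 0 < ε) (τ : ℝ) :
    StripFun fun z => regM Λ ε z * Complex.exp (-(τ * regM Λ ε z)) * Complex.exp (-z) := by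
  have hE : ∀ {F : Filter ℂ} {c : ℂ}, Tendsto (regM Λ ε) F (𝓝 c) →
      Tendsto (fun z => regM Λ ε z * Complex.exp (-(τ * regM Λ ε z))) F
        (𝓝 (c * Complex.exp (-(τ * c)))) := fun hF =>
    hF.mul ((Complex.continuous_exp.tendsto _).comp (hF.const_mul _).neg)
  refine ⟨fun z hz => ?_, fun z hz => ?_, ?_, ?_⟩
  · have := h.regM_diff hε.le hz
    fun_prop
  · rw [h.regM_conj ε hz]
    simp [← Complex.exp_conj]
  · simpa using (hE (h.regM_top hε)).mul tendsto_exp_neg_stripTop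
  · have h1 := hE (h.regM_bot (ε := ε))
    rw [zero_mul] at h1
    refine h1.congr fun z => ?_
    rw [mul_comm (Complex.exp z), mul_assoc _ (Complex.exp (-z)), ← Complex.exp_add]
    simp

omit h in
theorem dens_mul_exp_neg (F : ℂ → ℂ) (x : ℝ) :
    dens (fun z => F z * Complex.exp (-z)) x = (F (edge x)).im / Real.pi := by
  rw [dens, Complex.exp_neg, exp_edge, mul_comm (F (edge x)),
    show (-((Real.exp x : ℝ) : ℂ))⁻¹ = ((-(Real.exp x)⁻¹ : ℝ) : ℂ) by push_cast; rw [inv_neg],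
    Complex.im_ofReal_mul]
  have := (Real.exp_pos x).ne'
  field_simp

theorem LogCBF.regM_norm_le_inv {ε : ℝ} (hε : 0 < ε) {z : ℂ} (hz : z ∈ Strip) :
    ‖regM Λ ε z‖ ≤ ε⁻¹ ^ 2 := by
  have hr := h.rootM_re hz
  rw [regM, norm_pow]
  refine pow_le_pow_left₀ (norm_nonneg _) ?_ 2
  have h1 := one_le_norm_one_add hr.le hε.le
  rw [norm_div, div_le_iff₀ (by linarith), inv_mul_eq_div, le_div_iff₀ hε]
  refine le_of_sq_le_sq ?_ (norm_nonneg _)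
  rw [mul_pow, ← Complex.normSq_eq_norm_sq, ← Complex.normSq_eq_norm_sq, Complex.normSq_apply,
    Complex.normSq_apply]
  simp only [Complex.add_re, Complex.one_re, Complex.re_ofReal_mul, Complex.add_im,
    Complex.one_im, Complex.im_ofReal_mul]
  nlinarith [mul_pos hε hr]

/-- For `τ > 0` the density may change sign, so integrability does not come from
`StripFun.integrable`. It is dominated by a multiple of the density for `τ = 0`, which is
nonnegative. -/
theorem LogCBF.sDens_regM {ε : ℝ} (hε : 0 < ε) {τ : ℝ} (hτ : 0 ≤ τ) :
    SDens (dens fun z => regM Λ ε z * Complex.exp (-(τ * regM Λ ε z)) * Complex.exp (-z)) := by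
  have h0 := (h.stripFun_regM hε 0).sDens fun x => by
    simp only [Complex.ofReal_zero, zero_mul, neg_zero, Complex.exp_zero, mul_one]
    rw [Complex.exp_neg, exp_edge, mul_comm,
      show (-((Real.exp x : ℝ) : ℂ))⁻¹ = ((-(Real.exp x)⁻¹ : ℝ) : ℂ) by push_cast; rw [inv_neg],
      Complex.im_ofReal_mul]
    have := mul_nonneg (inv_pos.2 (Real.exp_pos x)).le (h.regM_im hε.le x)
    linarith
  refine ⟨continuous_dens (h.stripFun_regM hε τ).diff, ?_⟩
  refine Integrable.mono' (h0.int.const_mul (Real.exp (2 * τ * ε⁻¹ ^ 2))) ?_ (ae_of_all _ fun x => ?_)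
  · exact ((continuous_dens (h.stripFun_regM hε τ).diff).div (by fun_prop) fun x =>
      (add_pos (Real.exp_pos x) one_pos).ne').aestronglyMeasurable
  · have hp := add_pos (Real.exp_pos x) one_pos
    rw [dens_mul_exp_neg (fun z => regM Λ ε z * Complex.exp (-(τ * regM Λ ε z))),
      dens_mul_exp_neg (fun z => regM Λ ε z * Complex.exp (-((0 : ℝ) * regM Λ ε z)))]
    simp only [Complex.ofReal_zero, zero_mul, neg_zero, Complex.exp_zero, mul_one]
    rw [Real.norm_eq_abs, abs_div, abs_div, abs_of_pos Real.pi_pos, abs_of_pos hp, mul_div_assoc',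
      mul_div_assoc']
    gcongr
    refine (abs_im_mul_exp_le (h.regM_im hε.le x) hτ).trans ?_
    have := h.regM_norm_le_inv hε (edge_mem x)
    have := h.regM_im hε.le x
    gcongr

end

/-! ### Transforms of nonnegative functions and their limits. -/

/-- Laplace transforms of nonnegative functions. -/
def PosLT (F : ℝ → ℝ) : Prop :=
  ∃ f : ℝ → ℝ, LA f ∧ (∀ t : ℝ, 0 < t → 0 ≤ f t) ∧ ∀ x : ℝ, 0 < x → laplace f x = F x

theorem PosLT.mul {F G : ℝ → ℝ} (hF : PosLT F) (hG : PosLT G) : PosLT fun x => F x * G x := by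
  obtain ⟨f, hf, hf0, hfF⟩ := hF
  obtain ⟨g, hg, hg0, hgG⟩ := hG
  refine ⟨conv f g, hf.conv hg, fun t ht => ?_, fun x hx => ?_⟩
  · rw [conv, intervalIntegral.integral_of_le ht.le, integral_Ioc_eq_integral_Ioo]
    exact setIntegral_nonneg measurableSet_Ioo fun s hs =>
      mul_nonneg (hf0 _ (by linarith [hs.2])) (hg0 _ hs.1)
  · rw [laplace_conv hf hg hx, hfF x hx, hgG x hx]

theorem PosLT.const_mul {F : ℝ → ℝ} (hF : PosLT F) {c : ℝ} (hc : 0 ≤ c) :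
    PosLT fun x => c * F x := by
  obtain ⟨f, hf, hf0, hfF⟩ := hF
  exact ⟨fun t => c * f t, hf.const_mul c, fun t ht => mul_nonneg hc (hf0 t ht), fun x hx => by
    rw [laplace_const_mul, hfF x hx]⟩

theorem PosLT.add {F G : ℝ → ℝ} (hF : PosLT F) (hG : PosLT G) : PosLT fun x => F x + G x := by
  obtain ⟨f, hf, hf0, hfF⟩ := hF
  obtain ⟨g, hg, hg0, hgG⟩ := hG
  exact ⟨fun t => f t + g t, hf.add hg, fun t ht => add_nonneg (hf0 t ht) (hg0 t ht), fun x hx => by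
    rw [laplace_add hf hg hx, hfF x hx, hgG x hx]⟩

theorem PosLT.mul_pow {F G : ℝ → ℝ} (hF : PosLT F) (hG : PosLT G) (n : ℕ) :
    PosLT fun x => F x * G x ^ n := by
  induction n with
  | zero => simpa using hF
  | succ n ih => simpa only [pow_succ, mul_assoc] using ih.mul hG

theorem PosLT.mul_exp_sum {F G : ℝ → ℝ} (hF : PosLT F) (hG : PosLT G) {τ : ℝ} (hτ : 0 ≤ τ) (n : ℕ) :
    PosLT fun x => F x * ∑ j ∈ Finset.range n, (τ * G x) ^ j / j.factorial := by
  induction n with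
  | zero => exact ⟨fun _ => 0, (Kern.const le_rfl).laplace_integrable, fun _ _ => le_rfl,
      fun x hx => by rw [laplace_const hx]; simp⟩
  | succ n ih =>
    have h1 := ih.add ((hF.mul_pow hG n).const_mul (c := τ ^ n / n.factorial) (by positivity))
    simp only [Finset.sum_range_succ, mul_add]
    convert h1 using 3
    ring

theorem CMFor.posLT {f F : ℝ → ℝ} (h : CMFor f F) : PosLT F :=
  ⟨f, h.la, h.kern.nonneg, h.laplace⟩

/-- Passage to the limit in Laplace transforms of nonnegative functions. -/
theorem laplace_of_tendsto {u : ℕ → ℝ → ℝ} {v F : ℝ → ℝ} {A : ℝ} (hu : ∀ k, LA (u k))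
    (hu0 : ∀ k, ∀ t : ℝ, 0 < t → 0 ≤ u k t) (hvc : ContinuousOn v (Ioi 0))
    (hlim : ∀ t : ℝ, 0 < t → Tendsto (fun k => u k t) atTop (𝓝 (v t)))
    (hbd : ∀ t₀ : ℝ, 0 < t₀ → ∃ B : ℝ, ∀ k, ∀ t : ℝ, t₀ ≤ t → u k t ≤ B)
    (hA : ∀ k, ∀ x : ℝ, 0 < x → laplace (u k) x ≤ A / x)
    (hF : ∀ x : ℝ, 0 < x → Tendsto (fun k => laplace (u k) x) atTop (𝓝 (F x))) :
    LA v ∧ ∀ x : ℝ, 0 < x → laplace v x = F x := by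
  have hv0 : ∀ t : ℝ, 0 < t → 0 ≤ v t := fun t ht => ge_of_tendsto' (hlim t ht) fun k => hu0 k t ht
  have hvm : ∀ x : ℝ, AEStronglyMeasurable (fun t => Real.exp (-(x * t)) * v t)
      (volume.restrict (Ioi 0)) := fun x =>
    (ContinuousOn.mul (by fun_prop) hvc).aestronglyMeasurable measurableSet_Ioi
  have hpos : ∀ {f : ℝ → ℝ}, (∀ t : ℝ, 0 < t → 0 ≤ f t) → ∀ x : ℝ,
      0 ≤ᵐ[volume.restrict (Ioi 0)] fun t => Real.exp (-(x * t)) * f t := fun hf x =>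
    (ae_restrict_iff' measurableSet_Ioi).2 (ae_of_all _ fun t ht =>
      mul_nonneg (Real.exp_pos _).le (hf t ht))
  have hA0 : 0 ≤ A := by
    have h1 := hA 0 1 one_pos
    rw [div_one] at h1
    exact (integral_nonneg_of_ae (hpos (hu0 0) 1)).trans h1
  -- Fatou's lemma supplies integrability of the limit and one of the two inequalities.
  have hfatou : ∀ x : ℝ, 0 < x → ∫⁻ t in Ioi 0, ENNReal.ofReal (Real.exp (-(x * t)) * v t) ≤
      ENNReal.ofReal (F x) := by
    intro x hx
    have h1 : ∀ k, ∫⁻ t in Ioi 0, ENNReal.ofReal (Real.exp (-(x * t)) * u k t) =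
        ENNReal.ofReal (laplace (u k) x) := fun k =>
      (ofReal_integral_eq_lintegral_ofReal (hu k x hx) (hpos (hu0 k) x)).symm
    have h2 : Tendsto (fun k => ENNReal.ofReal (laplace (u k) x)) atTop
        (𝓝 (ENNReal.ofReal (F x))) := (ENNReal.continuous_ofReal.tendsto _).comp (hF x hx)
    rw [← h2.liminf_eq]
    simp only [← h1]
    refine le_trans (le_of_eq (setLIntegral_congr_fun measurableSet_Ioi fun t ht => ?_))
      (lintegral_liminf_le' fun k => (hu k x hx).aestronglyMeasurable.aemeasurable.ennreal_ofReal)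
    exact ((ENNReal.continuous_ofReal.tendsto _).comp
      ((hlim t ht).const_mul _)).liminf_eq.symm
  have hLA : LA v := fun x hx => by
    refine ⟨hvm x, ?_⟩
    rw [hasFiniteIntegral_iff_ofReal (hpos hv0 x)]
    exact (hfatou x hx).trans_lt ENNReal.ofReal_lt_top
  refine ⟨hLA, fun x hx => ?_⟩
  have hvA : ∀ x : ℝ, 0 < x → laplace v x ≤ A / x := by
    intro x hx
    have h1 := hfatou x hx
    rw [← ofReal_integral_eq_lintegral_ofReal (hLA x hx) (hpos hv0 x)] at h1
    have h2 : F x ≤ A / x := le_of_tendsto' (hF x hx) fun k => hA k x hx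
    have h3 : 0 ≤ F x := ge_of_tendsto' (hF x hx) fun k => integral_nonneg_of_ae (hpos (hu0 k) x)
    exact ((ENNReal.ofReal_le_ofReal_iff h3).1 h1).trans h2
  -- The bound `A/x` taken at `x = 1/t₀` limits the mass on `(0, t₀]` to a multiple of `t₀`. Hence
  -- no mass can concentrate at time zero, where pointwise bounds are missing.
  have hsmall : ∀ {f : ℝ → ℝ}, LA f → (∀ t : ℝ, 0 < t → 0 ≤ f t) →
      (∀ x : ℝ, 0 < x → laplace f x ≤ A / x) → ∀ t₀ : ℝ, 0 < t₀ →
      ∫ t in Ioc 0 t₀, Real.exp (-(x * t)) * f t ≤ Real.exp 1 * A * t₀ := by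
    intro f hf hf0 hfA t₀ ht₀
    have hx' : 0 < t₀⁻¹ := inv_pos.2 ht₀
    calc ∫ t in Ioc 0 t₀, Real.exp (-(x * t)) * f t
        ≤ ∫ t in Ioc 0 t₀, Real.exp 1 * (Real.exp (-(t₀⁻¹ * t)) * f t) := by
          refine setIntegral_mono_on ((hf x hx).mono_set Ioc_subset_Ioi_self)
            (((hf _ hx').mono_set Ioc_subset_Ioi_self).const_mul _) measurableSet_Ioc fun t ht => ?_
          rw [← mul_assoc, ← Real.exp_add]
          refine mul_le_mul_of_nonneg_right (Real.exp_le_exp.2 ?_) (hf0 t ht.1)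
          have h1 : t₀⁻¹ * t ≤ 1 := by rw [inv_mul_le_iff₀ ht₀]; linarith [ht.2]
          have := mul_pos hx ht.1
          linarith
      _ = Real.exp 1 * ∫ t in Ioc 0 t₀, Real.exp (-(t₀⁻¹ * t)) * f t := integral_const_mul _ _
      _ ≤ Real.exp 1 * laplace f t₀⁻¹ := by
          gcongr
          exact setIntegral_mono_set (hf _ hx') (hpos hf0 _) Ioc_subset_Ioi_self.eventuallyLE
      _ ≤ Real.exp 1 * (A / t₀⁻¹) := by gcongr; exact hfA _ hx'
      _ = _ := by rw [div_inv_eq_mul]; ring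
  have hsplit : ∀ {f : ℝ → ℝ}, LA f → ∀ t₀ : ℝ, 0 < t₀ → laplace f x =
      (∫ t in Ioc 0 t₀, Real.exp (-(x * t)) * f t) + ∫ t in Ioi t₀, Real.exp (-(x * t)) * f t := by
    intro f hf t₀ ht₀
    rw [laplace, ← Ioc_union_Ioi_eq_Ioi ht₀.le]
    exact setIntegral_union (Ioc_disjoint_Ioi le_rfl) measurableSet_Ioi
      ((hf x hx).mono_set Ioc_subset_Ioi_self) ((hf x hx).mono_set (Ioi_subset_Ioi ht₀.le))
  have hlarge : ∀ t₀ : ℝ, 0 < t₀ → Tendsto (fun k => ∫ t in Ioi t₀, Real.exp (-(x * t)) * u k t)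
      atTop (𝓝 (∫ t in Ioi t₀, Real.exp (-(x * t)) * v t)) := by
    intro t₀ ht₀
    obtain ⟨B, hB⟩ := hbd t₀ ht₀
    have hi : IntegrableOn (fun t => Real.exp (-(x * t)) * B) (Ioi t₀) := by
      have := (exp_neg_integrableOn_Ioi t₀ hx).mul_const B
      simp only [neg_mul] at this
      exact this
    refine tendsto_integral_of_dominated_convergence _
      (fun k => ((hu k x hx).mono_set (Ioi_subset_Ioi ht₀.le)).aestronglyMeasurable) hi
      (fun k => ?_) ?_
    · refine (ae_restrict_iff' measurableSet_Ioi).2 (ae_of_all _ fun t ht => ?_)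
      have ht' : t₀ < t := ht
      rw [Real.norm_eq_abs, abs_of_nonneg (mul_nonneg (Real.exp_pos _).le
        (hu0 k t (ht₀.trans ht')))]
      exact mul_le_mul_of_nonneg_left (hB k t ht'.le) (Real.exp_pos _).le
    · exact (ae_restrict_iff' measurableSet_Ioi).2 (ae_of_all _ fun t ht =>
        (hlim t (ht₀.trans ht)).const_mul _)
  have hclose : ∀ t₀ : ℝ, 0 < t₀ → |laplace v x - F x| ≤ Real.exp 1 * A * t₀ := by
    intro t₀ ht₀
    have h1 : Tendsto (fun k => laplace v x - laplace (u k) x -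
        ((∫ t in Ioi t₀, Real.exp (-(x * t)) * v t) - ∫ t in Ioi t₀, Real.exp (-(x * t)) * u k t))
        atTop (𝓝 (laplace v x - F x - ((∫ t in Ioi t₀, Real.exp (-(x * t)) * v t) -
          ∫ t in Ioi t₀, Real.exp (-(x * t)) * v t))) :=
      ((hF x hx).const_sub _).sub ((hlarge t₀ ht₀).const_sub _)
    rw [sub_self, sub_zero] at h1
    refine le_of_tendsto' h1.abs fun k => ?_
    have e1 := hsmall hLA hv0 hvA t₀ ht₀
    have e2 := hsmall (hu k) (hu0 k) (hA k) t₀ ht₀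
    have e3 : 0 ≤ ∫ t in Ioc 0 t₀, Real.exp (-(x * t)) * v t :=
      setIntegral_nonneg measurableSet_Ioc fun t ht => mul_nonneg (Real.exp_pos _).le (hv0 t ht.1)
    have e4 : 0 ≤ ∫ t in Ioc 0 t₀, Real.exp (-(x * t)) * u k t :=
      setIntegral_nonneg measurableSet_Ioc fun t ht => mul_nonneg (Real.exp_pos _).le (hu0 k t ht.1)
    rw [hsplit hLA t₀ ht₀, hsplit (hu k) t₀ ht₀]
    exact abs_le.2 ⟨by linarith, by linarith⟩
  have hz : |laplace v x - F x| ≤ 0 := by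
    refine le_of_forall_pos_le_add fun e he => ?_
    have h1 := hclose (e / (Real.exp 1 * A + 1)) (by positivity)
    refine h1.trans ?_
    rw [zero_add, mul_div_assoc', div_le_iff₀ (by positivity)]
    nlinarith [mul_nonneg (Real.exp_pos 1).le hA0]
  exact sub_eq_zero.1 (abs_nonpos_iff.1 hz)

/-! ### Nonnegativity and transform of the solution kernel. -/

/-- The boundary values which represent the kernel `b exp (-τ b) / λ`, `b = regM Λ ε`. -/
noncomputable def solDens (Λ : ℂ → ℂ) (ε τ : ℝ) : ℝ → ℝ :=
  dens fun z => regM Λ ε z * Complex.exp (-(τ * regM Λ ε z)) * Complex.exp (-z)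

theorem solDens_eq (Λ : ℂ → ℂ) (ε τ x : ℝ) : solDens Λ ε τ x =
    (regM Λ ε (edge x) * Complex.exp (-(τ * regM Λ ε (edge x)))).im / Real.pi :=
  dens_mul_exp_neg (fun z => regM Λ ε z * Complex.exp (-(τ * regM Λ ε z))) x

/-- The restriction of `regM` to the positive half-line, in the variable `λ`. -/
noncomputable def regR (Λ : ℂ → ℂ) (ε x : ℝ) : ℝ :=
  (Real.exp ((Λ (Real.log x)).re / 2) / (1 + ε * Real.exp ((Λ (Real.log x)).re / 2))) ^ 2

theorem regR_zero (Λ : ℂ → ℂ) (x : ℝ) : regR Λ 0 x = gOf Λ x := by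
  rw [regR, zero_mul, add_zero, div_one, gOf, ← Real.exp_nat_mul]
  congr 1; push_cast; ring

theorem tendsto_regR (Λ : ℂ → ℂ) (x : ℝ) :
    Tendsto (fun k : ℕ => regR Λ (1 / ((k : ℝ) + 1)) x) atTop (𝓝 (gOf Λ x)) := by
  rw [← regR_zero]
  have h := tendsto_one_div_add_atTop_nhds_zero_nat (𝕜 := ℝ)
  exact (tendsto_const_nhds.div ((h.mul_const _).const_add 1) (by simp)).pow 2

section
variable {Λ : ℂ → ℂ} (h : LogCBF Λ)
include h

theorem LogCBF.regM_ofReal (ε x : ℝ) : regM Λ ε (Real.log x) = (regR Λ ε x : ℂ) := by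
  rw [regM, rootM, h.pre.ofReal, regR]
  push_cast
  rfl

theorem LogCBF.laplace_solReg {ε : ℝ} (hε : 0 < ε) {τ : ℝ} (hτ : 0 ≤ τ) {x : ℝ} (hx : 0 < x) :
    laplace (sFun (solDens Λ ε τ)) x = regR Λ ε x / x * Real.exp (-(τ * regR Λ ε x)) := by
  rw [solDens, (h.stripFun_regM hε τ).laplace_eq (h.sDens_regM hε hτ) hx, h.regM_ofReal,
    ← Complex.ofReal_mul, ← Complex.ofReal_neg, ← Complex.ofReal_neg, ← Complex.ofReal_exp,
    ← Complex.ofReal_exp, ← Complex.ofReal_mul, ← Complex.ofReal_mul, Complex.ofReal_re,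
    Real.exp_neg (Real.log x), Real.exp_log hx]
  ring

/-- With `b = regR`, write `exp(-τb) = exp(-τε⁻²) exp(τ(ε⁻² - b))`. The partial sums of the last
exponential have nonnegative coefficients, so multiplied by `b/λ` they are transforms of nonnegative
functions, and they converge pointwise. -/
theorem LogCBF.solReg_nonneg {ε : ℝ} (hε : 0 < ε) {τ : ℝ} (hτ : 0 ≤ τ) :
    ∀ t : ℝ, 0 < t → 0 ≤ sFun (solDens Λ ε τ) t := by
  have h1 : PosLT fun x => regR Λ ε x / x := by
    refine ⟨sFun (solDens Λ ε 0), (h.sDens_regM hε le_rfl).la, ?_, fun x hx => ?_⟩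
    · intro t _
      refine integral_nonneg fun x => mul_nonneg (Real.exp_pos _).le ?_
      rw [solDens_eq]
      simpa using div_nonneg (h.regM_im hε.le x) Real.pi_pos.le
    · rw [h.laplace_solReg hε le_rfl hx]; simp
  have h2 : PosLT fun x => ε⁻¹ ^ 2 - regR Λ ε x := by
    refine (((h.stripFun_sub_regM hε).cmFor fun x => ?_).congr_right fun x _ => ?_).posLT
    · rw [Complex.sub_im, ← Complex.ofReal_inv, ← Complex.ofReal_pow, Complex.ofReal_im]
      linarith [h.regM_im hε.le x]
    · rw [h.regM_ofReal, ← Complex.ofReal_inv, ← Complex.ofReal_pow, ← Complex.ofReal_sub,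
        Complex.ofReal_re]
  have h3 : ∀ J : ℕ, PosLT fun x => Real.exp (-(τ * ε⁻¹ ^ 2)) * (regR Λ ε x / x *
      ∑ j ∈ Finset.range J, (τ * (ε⁻¹ ^ 2 - regR Λ ε x)) ^ j / j.factorial) := fun J =>
    (h1.mul_exp_sum h2 hτ J).const_mul (Real.exp_pos _).le
  choose f hf hf0 hfF using h3
  refine nonneg_of_tendsto_laplace (h.sDens_regM hε hτ).la (h.sDens_regM hε hτ).continuousOn
    f hf hf0 fun x hx => ?_
  simp only [hfF _ x hx]
  have h4 : laplace (sFun (solDens Λ ε τ)) x = Real.exp (-(τ * ε⁻¹ ^ 2)) *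
        (regR Λ ε x / x * Real.exp (τ * (ε⁻¹ ^ 2 - regR Λ ε x))) := by
    rw [mul_left_comm, ← Real.exp_add]
    refine (h.laplace_solReg hε hτ hx).trans ?_
    congr 2; ring
  rw [h4]
  have h5 := (NormedSpace.expSeries_div_hasSum_exp (τ * (ε⁻¹ ^ 2 - regR Λ ε x))).tendsto_sum_nat
  rw [← Real.exp_eq_exp_ℝ] at h5
  exact (h5.const_mul _).const_mul _

/-- Absence of drift makes `exp Λ` of smaller order than `exp x` at the right end. An arbitrarily
small `c` is needed so that `exp(-t exp x)` absorbs an exponential of `exp Λ`. -/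
theorem LogCBF.norm_exp_edge_le {c : ℝ} (hc : 0 < c) :
    ∃ C : ℝ, 0 ≤ C ∧ ∀ x : ℝ, ‖Complex.exp (Λ (edge x))‖ ≤ c * Real.exp x + C := by
  have ht := h.gap_top.comp (tendsto_stripTop (f := edge) (by simp only [edge_re]; exact tendsto_id) edge_mem)
  have hb := h.bot.comp (tendsto_stripBot (f := edge) (by simp only [edge_re]; exact tendsto_id) edge_mem)
  obtain ⟨A, hA⟩ := eventually_atTop.1 (ht.eventually_ge_atTop (-Real.log c))
  obtain ⟨B, hB⟩ := eventually_atBot.1 (hb.eventually_le_atBot 0)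
  have hcont : Continuous fun x => Complex.exp (Λ (edge x)) :=
    Complex.continuous_exp.comp (StripFun.continuous_edge h.diff)
  obtain ⟨C, hC⟩ := (isCompact_Icc (a := B) (b := A)).exists_bound_of_continuousOn
    hcont.continuousOn
  refine ⟨max C 1, le_max_of_le_right zero_le_one, fun x => ?_⟩
  have hpos : 0 < c * Real.exp x := by positivity
  rcases le_total A x with hx | hx
  · have h1 := hA x hx
    simp only [Function.comp, edge_re] at h1
    have h2 : ‖Complex.exp (Λ (edge x))‖ ≤ c * Real.exp x := by
      rw [Complex.norm_exp]
      calc _ ≤ Real.exp (Real.log c + x) := Real.exp_le_exp.2 (by linarith)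
        _ = _ := by rw [Real.exp_add, Real.exp_log hc]
    linarith [le_max_right C 1]
  · rcases le_total x B with hx' | hx'
    · have h1 := hB x hx'
      simp only [Function.comp] at h1
      have : ‖Complex.exp (Λ (edge x))‖ ≤ 1 := by
        rw [Complex.norm_exp]; exact Real.exp_le_one_iff.2 h1
      linarith [le_max_right C 1]
    · linarith [hC x ⟨hx', hx⟩, le_max_left C 1]

omit h in
theorem rootM_norm_sq (Λ : ℂ → ℂ) (x : ℝ) :
    ‖rootM Λ (edge x)‖ ^ 2 = ‖Complex.exp (Λ (edge x))‖ := by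
  rw [← regM_zero, regM, norm_pow]; simp

/-- Uniform domination of the integrands which represent the solution. -/
theorem LogCBF.solDens_bound {t₀ : ℝ} (ht₀ : 0 < t₀) (τ₀ : ℝ) (hτ₀ : 0 ≤ τ₀) :
    ∃ D : ℝ → ℝ, Integrable D ∧ ∀ ε t τ x : ℝ, 0 ≤ ε → t₀ ≤ t → 0 ≤ τ → τ ≤ τ₀ →
      |Real.exp (-(t * Real.exp x)) * solDens Λ ε τ x| ≤ D x := by
  -- With this `c`, the growth `exp((2τ₀ + 1)M)` costs half of the exponent `t₀ exp x`. The other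
  -- half keeps the density of `exp(Λ/2 - z)` integrable. The summand `1` pays for the crude bound
  -- `‖rootM‖ ≤ exp M`.
  obtain ⟨C, hC0, hC⟩ := h.norm_exp_edge_le (c := t₀ / 2 / (2 * τ₀ + 1)) (by positivity)
  have hs := (h.stripFun_exp_sub (δ := 1 / 2) (by norm_num) (by norm_num)).sDens
    (h.exp_sub_im_nonpos (by norm_num) (by norm_num))
  have hi := (hs.integrable_exp 0 (half_pos ht₀)).const_mul (2 * Real.exp ((2 * τ₀ + 1) * C))
  refine ⟨_, hi, fun ε t τ x hε ht hτ hτ' => ?_⟩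
  have him := h.regM_im hε x
  have hV := h.rootM_im x
  have hpi := Real.pi_pos
  have hdens : dens (fun z => Complex.exp (((1 / 2 : ℝ) : ℂ) * Λ z - z)) x =
      (rootM Λ (edge x)).im / Real.pi := by
    rw [dens_exp_sub, rootM, show ((1 / 2 : ℝ) : ℂ) * Λ (edge x) = Λ (edge x) / 2 by push_cast; ring]
  rw [hdens, solDens_eq, abs_mul, abs_of_pos (Real.exp_pos _), abs_div, abs_of_pos hpi, pow_zero,
    one_mul]
  set M := ‖Complex.exp (Λ (edge x))‖ with hM
  have hM0 : 0 ≤ M := norm_nonneg _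
  have h1 : |(regM Λ ε (edge x) * Complex.exp (-(τ * regM Λ ε (edge x)))).im| ≤
      Real.exp (2 * τ₀ * M) * (2 * Real.exp M * (rootM Λ (edge x)).im) := by
    refine (abs_im_mul_exp_le him hτ).trans ?_
    have h2 := h.regM_norm_le hε (edge_mem x)
    have h3 : ‖rootM Λ (edge x)‖ ≤ Real.exp M := by
      have h4 := rootM_norm_sq Λ x
      have h5 := Real.add_one_le_exp M
      nlinarith [sq_nonneg (‖rootM Λ (edge x)‖ - 1)]
    have h6 : (regM Λ ε (edge x)).im ≤ 2 * Real.exp M * (rootM Λ (edge x)).im :=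
      (h.regM_im_le hε x).trans (by gcongr)
    gcongr
  have h7 : Real.exp (-(t * Real.exp x)) * (Real.exp (2 * τ₀ * M) * Real.exp M) ≤
      Real.exp ((2 * τ₀ + 1) * C) * Real.exp (-(t₀ / 2 * Real.exp x)) := by
    rw [← Real.exp_add, ← Real.exp_add, ← Real.exp_add, Real.exp_le_exp]
    have h8 := mul_le_mul_of_nonneg_left (hC x) (by positivity : 0 ≤ 2 * τ₀ + 1)
    rw [← hM] at h8
    have h9 : (2 * τ₀ + 1) * (t₀ / 2 / (2 * τ₀ + 1) * Real.exp x + C) =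
        t₀ / 2 * Real.exp x + (2 * τ₀ + 1) * C := by
      have : 2 * τ₀ + 1 ≠ 0 := by positivity
      field_simp
    rw [h9] at h8
    have := mul_le_mul_of_nonneg_right ht (Real.exp_pos x).le
    linarith
  calc _ ≤ Real.exp (-(t * Real.exp x)) * (Real.exp (2 * τ₀ * M) *
        (2 * Real.exp M * (rootM Λ (edge x)).im) / Real.pi) := by gcongr
    _ = (Real.exp (-(t * Real.exp x)) * (Real.exp (2 * τ₀ * M) * Real.exp M)) *
        (2 * ((rootM Λ (edge x)).im / Real.pi)) := by ring
    _ ≤ (Real.exp ((2 * τ₀ + 1) * C) * Real.exp (-(t₀ / 2 * Real.exp x))) *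
        (2 * ((rootM Λ (edge x)).im / Real.pi)) := by gcongr
    _ = _ := by ring

theorem LogCBF.continuous_solDens {ε : ℝ} (hε : 0 ≤ ε) :
    Continuous fun p : ℝ × ℝ => solDens Λ ε p.1 p.2 := by
  simp only [solDens_eq]
  have h1 : Continuous fun x => regM Λ ε (edge x) :=
    StripFun.continuous_edge fun z hz => h.regM_diff hε hz
  have h2 : Continuous fun p : ℝ × ℝ => regM Λ ε (edge p.2) := h1.comp continuous_snd
  have h3 : Continuous fun p : ℝ × ℝ => (p.1 : ℂ) := by fun_prop
  exact (Complex.continuous_im.comp (h2.mul (Complex.continuous_exp.comp (h3.mul h2).neg))).div_const _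

theorem LogCBF.continuous_solDens_right {ε : ℝ} (hε : 0 ≤ ε) (τ : ℝ) :
    Continuous (solDens Λ ε τ) := by
  have h1 := (h.continuous_solDens hε).comp (by fun_prop : Continuous fun x : ℝ => (τ, x))
  simpa only [Function.comp_def] using h1

theorem LogCBF.continuous_solDens_left {ε : ℝ} (hε : 0 ≤ ε) (x : ℝ) :
    Continuous fun τ => solDens Λ ε τ x := by
  have h1 := (h.continuous_solDens hε).comp (by fun_prop : Continuous fun τ : ℝ => (τ, x))
  simpa only [Function.comp_def] using h1

/-- The kernel in the time variable of the fundamental solution is jointly continuous. -/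
theorem LogCBF.continuousAt_sol {p : ℝ × ℝ} (hp : 0 < p.1) :
    ContinuousAt (fun p : ℝ × ℝ => sFun (solDens Λ 0 |p.2|) p.1) p := by
  obtain ⟨D, hD, hDb⟩ := h.solDens_bound (half_pos hp) (|p.2| + 1) (by positivity)
  simp only [sFun]
  refine continuousAt_of_dominated (bound := D) ?_ ?_ hD ?_
  · refine Eventually.of_forall fun q => Continuous.aestronglyMeasurable ?_
    have := h.continuous_solDens_right le_rfl |q.2|
    fun_prop
  · have h1 : ∀ᶠ q : ℝ × ℝ in 𝓝 p, p.1 / 2 ≤ q.1 := by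
      refine (continuous_fst.continuousAt.eventually_const_lt (half_lt_self hp)).mono
        fun _ hq => le_of_lt hq
    have h2 : ∀ᶠ q : ℝ × ℝ in 𝓝 p, |q.2| ≤ |p.2| + 1 := by
      refine ((by fun_prop : Continuous fun q : ℝ × ℝ => |q.2|).continuousAt.eventually_lt_const
        (lt_add_one |p.2|)).mono fun _ hq => le_of_lt hq
    filter_upwards [h1, h2] with q hq1 hq2
    exact ae_of_all _ fun x => hDb 0 q.1 |q.2| x le_rfl hq1 (abs_nonneg _) hq2
  · refine ae_of_all _ fun x => Continuous.continuousAt ?_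
    have h1 : Continuous fun q : ℝ × ℝ => |q.2| := by fun_prop
    have h2 := (h.continuous_solDens_left le_rfl x).comp h1
    simp only [Function.comp_def] at h2
    fun_prop

theorem LogCBF.tendsto_solReg {τ t : ℝ} (hτ : 0 ≤ τ) (ht : 0 < t) :
    Tendsto (fun k : ℕ => sFun (solDens Λ (1 / ((k : ℝ) + 1)) τ) t) atTop
      (𝓝 (sFun (solDens Λ 0 τ) t)) := by
  obtain ⟨D, hD, hDb⟩ := h.solDens_bound ht τ hτ
  simp only [sFun]
  refine tendsto_integral_of_dominated_convergence D (fun k => ?_) hD (fun k => ae_of_all _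
    fun x => hDb _ t τ x (by positivity) le_rfl hτ le_rfl) (ae_of_all _ fun x => ?_)
  · refine Continuous.aestronglyMeasurable ?_
    have := h.continuous_solDens_right (ε := 1 / ((k : ℝ) + 1)) (by positivity) τ
    fun_prop
  · refine Tendsto.const_mul _ ?_
    simp only [solDens_eq]
    have h1 : Tendsto (fun k : ℕ => ((1 / ((k : ℝ) + 1) : ℝ) : ℂ)) atTop (𝓝 ((0 : ℝ) : ℂ)) :=
      (Complex.continuous_ofReal.tendsto _).comp (tendsto_one_div_add_atTop_nhds_zero_nat (𝕜 := ℝ))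
    have h2 : Tendsto (fun k : ℕ => regM Λ (1 / ((k : ℝ) + 1)) (edge x)) atTop
        (𝓝 (regM Λ 0 (edge x))) :=
      (tendsto_const_nhds.div ((h1.mul_const _).const_add 1) (by simp)).pow 2
    exact ((Complex.continuous_im.tendsto _).comp
      (h2.mul ((Complex.continuous_exp.tendsto _).comp (h2.const_mul _).neg))).div_const _

theorem LogCBF.sol_nonneg {τ t : ℝ} (hτ : 0 ≤ τ) (ht : 0 < t) : 0 ≤ sFun (solDens Λ 0 τ) t :=
  ge_of_tendsto' (h.tendsto_solReg hτ ht) fun _ => h.solReg_nonneg (by positivity) hτ t ht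

/-- The inequality `b exp(-τb) ≤ 1/τ` bounds the approximating transforms uniformly. It requires `τ
> 0`, which is why `GreenKernel` leaves out `z = 0`. -/
theorem LogCBF.sol_laplace {τ : ℝ} (hτ : 0 < τ) :
    LA (sFun (solDens Λ 0 τ)) ∧ ∀ x : ℝ, 0 < x →
      laplace (sFun (solDens Λ 0 τ)) x = gOf Λ x / x * Real.exp (-(τ * gOf Λ x)) := by
  refine laplace_of_tendsto (u := fun k : ℕ => sFun (solDens Λ (1 / ((k : ℝ) + 1)) τ)) (A := 1 / τ)
    (fun k => (h.sDens_regM (by positivity) hτ.le).la)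
    (fun k => h.solReg_nonneg (by positivity) hτ.le) ?_ (fun t ht => h.tendsto_solReg hτ.le ht)
    (fun t₀ ht₀ => ?_) (fun k x hx => ?_) fun x hx => ?_
  · intro t ht
    have h1 := (h.continuousAt_sol (p := (t, τ)) ht).comp
      (f := fun s : ℝ => (s, τ)) (by fun_prop : ContinuousAt (fun s : ℝ => (s, τ)) t)
    simp only [Function.comp_def, abs_of_pos hτ] at h1
    exact h1.continuousWithinAt
  · obtain ⟨D, hD, hDb⟩ := h.solDens_bound ht₀ τ hτ.le
    refine ⟨∫ x, D x, fun k t ht => ?_⟩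
    simp only [sFun]
    refine (Real.le_norm_self _).trans (norm_integral_le_of_norm_le hD (ae_of_all _ fun x => ?_))
    exact hDb _ t τ x (by positivity) ht hτ.le le_rfl
  · rw [h.laplace_solReg (by positivity) hτ.le hx, div_mul_eq_mul_div]
    refine div_le_div_of_nonneg_right ?_ hx.le
    set b := regR Λ (1 / ((k : ℝ) + 1)) x
    rw [le_div_iff₀ hτ]
    have h1 := Real.add_one_le_exp (τ * b)
    have h2 : Real.exp (τ * b) * Real.exp (-(τ * b)) = 1 := by rw [← Real.exp_add]; simp
    have h3 := Real.exp_pos (-(τ * b))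
    nlinarith
  · simp only [fun k : ℕ => h.laplace_solReg (ε := 1 / ((k : ℝ) + 1)) (by positivity) hτ.le hx]
    have h1 := tendsto_regR Λ x
    exact (h1.div_const x).mul ((Real.continuous_exp.tendsto _).comp (h1.const_mul τ).neg)

end

/-! ### Green kernels and their total mass. -/

/-- The kernels `k`, `ℓ`, `r` with Laplace transforms `g(λ)/λ`, `1/g(λ)`, `1/(g(λ) + η)`. -/
structure KernelTriple (η : ℝ) (g k l r : ℝ → ℝ) : Prop where
  eta_pos : 0 < η
  pos : ∀ x : ℝ, 0 < x → 0 < g x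
  k : CMFor k fun x => g x / x
  l : CMFor l fun x => (g x)⁻¹
  r : CMFor r fun x => (g x + η)⁻¹

section triple
variable {η : ℝ} {g k l r : ℝ → ℝ} (h : KernelTriple η g k l r)
include h

theorem KernelTriple.conv_k_l {t : ℝ} (ht : 0 < t) : conv k l t = 1 :=
  h.k.conv_eq_one h.l (fun x hx => by have := h.pos x hx; field_simp) t ht

theorem KernelTriple.conv_k_r {t : ℝ} (ht : 0 < t) :
    conv k r t = 1 - η * conv (fun _ => 1) r t := by
  have h1 := (Kern.const zero_le_one).laplace_integrable
  have hd := (Dom.const 1).conv h.r.dom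
  refine eq_of_laplace_eq (f := conv k r) (g := fun t => 1 - η * conv (fun _ => 1) r t)
    (h.k.la.conv h.r.la) (h1.sub ((h1.conv h.r.la).const_mul η)) (h.k.dom.conv h.r.dom).cont
    (continuousOn_const.sub (hd.const_mul η).cont) (fun x hx => ?_) t ht
  rw [laplace_conv h.k.la h.r.la hx, laplace_sub h1 ((h1.conv h.r.la).const_mul η) hx,
    laplace_const_mul, laplace_conv h1 h.r.la hx, laplace_const hx, h.k.laplace x hx,
    h.r.laplace x hx]
  have := h.pos x hx
  have := h.eta_pos
  field_simp
  ring

end triple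

/-- A nonnegative continuous function `U` whose Laplace transform in time is
`a/(2λ) exp (-a |z|)`, `a = a(λ)`. -/
structure GreenKernel (a : ℝ → ℝ) (U : ℝ → ℝ → ℝ) : Prop where
  pos : ∀ x : ℝ, 0 < x → 0 < a x
  cont : ∀ p : ℝ × ℝ, 0 < p.1 → ContinuousAt (fun p : ℝ × ℝ => U p.1 p.2) p
  nonneg : ∀ t z : ℝ, 0 < t → 0 ≤ U t z
  la : ∀ z : ℝ, z ≠ 0 → LA fun t => U t z
  laplace : ∀ z : ℝ, z ≠ 0 → ∀ x : ℝ, 0 < x →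
    laplace (fun t => U t z) x = a x / (2 * x) * Real.exp (-(a x * |z|))

/-- The truncated pairing in the space variable. -/
noncomputable def cutPairing (U : ℝ → ℝ → ℝ) (R : ℝ) (χ : ℝ → ℝ) (t : ℝ) : ℝ :=
  ∫ z in (-R)..R, χ z * U t z

section green
variable {a : ℝ → ℝ} {U : ℝ → ℝ → ℝ} (h : GreenKernel a U)
include h

theorem GreenKernel.continuous {t : ℝ} (ht : 0 < t) : Continuous (U t) :=
  continuous_iff_continuousAt.2 fun z =>
    (h.cont (t, z) ht).comp (f := fun z : ℝ => (t, z)) (by fun_prop)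

theorem GreenKernel.continuousOn_cutPairing (R : ℝ) {χ : ℝ → ℝ} (hχ : Continuous χ) :
    ContinuousOn (cutPairing U R χ) (Ioi 0) := by
  intro t₀ ht₀
  have ht₀ : 0 < t₀ := ht₀
  refine ContinuousAt.continuousWithinAt ?_
  -- Replacing `t` by `max t (t₀/2)` changes nothing near `t₀` and gives a function continuous on
  -- the whole plane.
  have h1 : Continuous fun p : ℝ × ℝ => χ p.2 * U (max p.1 (t₀ / 2)) p.2 := by
    refine (hχ.comp continuous_snd).mul (continuous_iff_continuousAt.2 fun p => ?_)
    exact (h.cont (max p.1 (t₀ / 2), p.2) (lt_max_of_lt_right (half_pos ht₀))).comp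
      (f := fun p : ℝ × ℝ => (max p.1 (t₀ / 2), p.2)) (by fun_prop)
  have h2 := intervalIntegral.continuous_parametric_intervalIntegral_of_continuous' (μ := volume)
    (f := fun t z => χ z * U (max t (t₀ / 2)) z) h1 (-R) R
  refine h2.continuousAt.congr ?_
  filter_upwards [Ioi_mem_nhds (half_lt_self ht₀)] with t ht
  simp only [cutPairing]
  rw [max_eq_left (le_of_lt ht)]

theorem GreenKernel.integrable_cut (R : ℝ) {χ : ℝ → ℝ} (hχ : Continuous χ) {x : ℝ}
    (hx : 0 < x) : Integrable (Function.uncurry fun (t z : ℝ) =>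
      Real.exp (-(x * t)) * (χ z * U t z))
      ((volume.restrict (Ioi 0)).prod (volume.restrict (Ioc (-R) R))) := by
  have hm : AEStronglyMeasurable (Function.uncurry fun (t z : ℝ) =>
      Real.exp (-(x * t)) * (χ z * U t z))
      ((volume.restrict (Ioi 0)).prod (volume.restrict (Ioc (-R) R))) := by
    rw [Measure.prod_restrict]
    refine ContinuousOn.aestronglyMeasurable (fun p hp => ContinuousAt.continuousWithinAt ?_)
      (measurableSet_Ioi.prod measurableSet_Ioc)
    have h1 := h.cont p hp.1
    have h2 : Continuous fun p : ℝ × ℝ => Real.exp (-(x * p.1)) := by fun_prop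
    have h3 : Continuous fun p : ℝ × ℝ => χ p.2 := by fun_prop
    exact h2.continuousAt.mul (h3.continuousAt.mul h1)
  have hz : ∀ᵐ z ∂(volume.restrict (Ioc (-R) R)), z ≠ 0 := by
    refine ae_restrict_of_ae ?_
    simp [ae_iff]
  rw [integrable_prod_iff' hm]
  constructor
  · filter_upwards [hz] with z hz
    refine ((h.la z hz x hx).const_mul (χ z)).congr (ae_of_all _ fun t => ?_)
    simp only [Function.uncurry_apply_pair]; ring
  · have hc : Continuous fun z => |χ z| * (a x / (2 * x) * Real.exp (-(a x * |z|))) := by fun_prop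
    have hi : IntegrableOn (fun z => |χ z| * (a x / (2 * x) * Real.exp (-(a x * |z|))))
        (Ioc (-R) R) := (hc.integrableOn_Icc).mono_set Ioc_subset_Icc_self
    refine Integrable.congr hi ?_
    filter_upwards [hz] with z hz
    rw [← h.laplace z hz x hx, SlowVariance.laplace, ← integral_const_mul]
    refine setIntegral_congr_fun measurableSet_Ioi fun t ht => ?_
    simp only [Function.uncurry_apply_pair, Real.norm_eq_abs, abs_mul, abs_of_pos (Real.exp_pos _),
      abs_of_nonneg (h.nonneg t z ht)]
    ring

theorem GreenKernel.la_cut {R : ℝ} (hR : 0 ≤ R) {χ : ℝ → ℝ} (hχ : Continuous χ) :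
    LA (cutPairing U R χ) := by
  intro x hx
  have := (h.integrable_cut R hχ hx).integral_prod_left
  refine this.congr (ae_of_all _ fun t => ?_)
  simp only [Function.uncurry_apply_pair, cutPairing]
  rw [integral_const_mul, intervalIntegral.integral_of_le (by linarith)]

theorem GreenKernel.laplace_cut {R : ℝ} (hR : 0 ≤ R) {χ : ℝ → ℝ} (hχ : Continuous χ) {x : ℝ}
    (hx : 0 < x) : SlowVariance.laplace (cutPairing U R χ) x =
      a x / (2 * x) * ∫ z in (-R)..R, Real.exp (-(a x * |z|)) * χ z := by
  have h1 := integral_integral_swap (h.integrable_cut R hχ hx)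
  have hz : ∀ᵐ z ∂(volume.restrict (Ioc (-R) R)), z ≠ 0 := by
    refine ae_restrict_of_ae ?_
    simp [ae_iff]
  rw [intervalIntegral.integral_of_le (by linarith), ← integral_const_mul]
  refine Eq.trans ?_ (h1.trans (integral_congr_ae ?_))
  · rw [SlowVariance.laplace]
    refine integral_congr_ae (ae_of_all _ fun t => ?_)
    simp only [cutPairing]
    rw [integral_const_mul, intervalIntegral.integral_of_le (by linarith)]
  · filter_upwards [hz] with z hz
    have h2 := h.laplace z hz x hx
    rw [SlowVariance.laplace] at h2
    rw [mul_comm (Real.exp _) (χ z), mul_left_comm, ← h2, ← integral_const_mul]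
    refine integral_congr_ae (ae_of_all _ fun t => ?_)
    ring

theorem GreenKernel.laplace_cut_one {R : ℝ} (hR : 0 ≤ R) {x : ℝ} (hx : 0 < x) :
    SlowVariance.laplace (cutPairing U R fun _ => 1) x = (1 - Real.exp (-(a x * R))) / x := by
  have ha := h.pos x hx
  rw [h.laplace_cut hR continuous_const hx]
  have hc : ∀ b c : ℝ, IntervalIntegrable (fun z => Real.exp (-(a x * |z|)) * 1) volume b c :=
    fun b c => (by fun_prop : Continuous _).intervalIntegrable b c
  have e1 : ∫ z in (0 : ℝ)..R, Real.exp (-(a x * |z|)) * 1 = (1 - Real.exp (-(a x * R))) / a x := by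
    rw [intervalIntegral.integral_congr (g := fun z => Real.exp (-a x * z))]
    · rw [intervalIntegral.integral_comp_mul_left (fun z => Real.exp z) (neg_ne_zero.2 ha.ne'),
        integral_exp, mul_zero, Real.exp_zero, smul_eq_mul, neg_mul]
      field_simp
      ring
    · intro z hz
      rw [uIcc_of_le hR] at hz
      simp only [abs_of_nonneg hz.1, mul_one, neg_mul]
  have e2 : ∫ z in (-R)..0, Real.exp (-(a x * |z|)) * 1 = (1 - Real.exp (-(a x * R))) / a x := by
    rw [← e1]
    have := intervalIntegral.integral_comp_neg (a := 0) (b := R)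
      (fun z => Real.exp (-(a x * |z|)) * 1)
    simp only [abs_neg, neg_zero] at this
    exact this.symm
  rw [← intervalIntegral.integral_add_adjacent_intervals (hc (-R) 0) (hc 0 R), e1, e2]
  field_simp
  ring

/-- The transforms of the masses on `[-(R + N), R + N]` tend to `1/λ`. So `1` minus the mass on
`[-R, R]` is, on the level of transforms, the limit of the nonnegative masses of the added shells.
Integrability of `U t` on the line is a consequence, not an assumption. -/
theorem GreenKernel.cut_one_le {R : ℝ} (hR : 0 ≤ R) {t : ℝ} (ht : 0 < t) :
    cutPairing U R (fun _ => 1) t ≤ 1 := by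
  have h1 := (Kern.const zero_le_one).laplace_integrable
  have hW : ∀ R : ℝ, 0 ≤ R → LA (cutPairing U R fun _ => 1) := fun R hR =>
    h.la_cut hR continuous_const
  have hRN : ∀ N : ℕ, 0 ≤ R + N := fun N => by positivity
  have := nonneg_of_tendsto_laplace (f := fun t => 1 - cutPairing U R (fun _ => 1) t)
    (h1.sub (hW R hR)) (continuousOn_const.sub (h.continuousOn_cutPairing R continuous_const))
    (fun N t => cutPairing U (R + N) (fun _ => 1) t - cutPairing U R (fun _ => 1) t)
    (fun N => (hW _ (hRN N)).sub (hW R hR)) (fun N t ht => ?_) (fun x hx => ?_) t ht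
  · linarith
  · rw [sub_nonneg]
    have hN : (0 : ℝ) ≤ N := Nat.cast_nonneg N
    refine intervalIntegral.integral_mono_interval (by linarith) (by linarith) (by linarith) ?_
      (((continuous_const.mul (h.continuous ht))).intervalIntegrable _ _)
    exact ae_of_all _ fun z => by simpa using h.nonneg t z ht
  · simp only [laplace_sub (hW _ (hRN _)) (hW R hR) hx, laplace_sub h1 (hW R hR) hx,
      laplace_const hx, h.laplace_cut_one (hRN _) hx]
    refine Tendsto.sub_const ?_ _
    have e : Tendsto (fun N : ℕ => Real.exp (-(a x * (R + N)))) atTop (𝓝 0) := by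
      refine Real.tendsto_exp_neg_atTop_nhds_zero.comp (Tendsto.const_mul_atTop (h.pos x hx) ?_)
      exact tendsto_atTop_add_const_left _ _ tendsto_natCast_atTop_atTop
    simpa using (e.const_sub 1).div_const x

theorem GreenKernel.integrable {t : ℝ} (ht : 0 < t) : Integrable (U t) := by
  refine integrable_of_intervalIntegral_norm_bounded 1 (a := fun N : ℕ => -(N : ℝ))
    (b := fun N : ℕ => (N : ℝ)) (l := atTop) (fun N => ?_)
    (tendsto_neg_atTop_atBot.comp tendsto_natCast_atTop_atTop) tendsto_natCast_atTop_atTop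
    (Eventually.of_forall fun N => ?_)
  · exact ((h.continuous ht).integrableOn_Icc).mono_set Ioc_subset_Icc_self
  · have h2 := h.cut_one_le (Nat.cast_nonneg N) ht
    refine le_trans (le_of_eq ?_) h2
    refine intervalIntegral.integral_congr fun z _ => ?_
    simp [abs_of_nonneg (h.nonneg t z ht)]

theorem GreenKernel.integral_abs_le {t : ℝ} (ht : 0 < t) : ∫ z, |U t z| ≤ 1 := by
  have h1 := intervalIntegral_tendsto_integral (h.integrable ht).abs
    (tendsto_neg_atTop_atBot.comp (tendsto_natCast_atTop_atTop (R := ℝ)))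
    (tendsto_natCast_atTop_atTop (R := ℝ))
  refine le_of_tendsto' h1 fun N => ?_
  have h2 := h.cut_one_le (Nat.cast_nonneg N) ht
  refine le_trans (le_of_eq ?_) h2
  refine intervalIntegral.integral_congr fun z _ => ?_
  simp [abs_of_nonneg (h.nonneg t z ht)]

end green

/-! ### Test functions paired with the Green kernel. -/

theorem IsTest.continuous {χ : ℝ → ℝ} (h : IsTest χ) : Continuous χ := h.1.continuous

theorem IsTest.deriv {χ : ℝ → ℝ} (h : IsTest χ) : IsTest (deriv χ) :=
  ⟨(contDiff_infty_iff_deriv.1 h.1).2, h.2.deriv⟩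

theorem IsTest.hasDerivAt {χ : ℝ → ℝ} (h : IsTest χ) (z : ℝ) : HasDerivAt χ (_root_.deriv χ z) z :=
  ((contDiff_infty_iff_deriv.1 h.1).1 z).hasDerivAt

theorem IsTest.exists_bound {χ : ℝ → ℝ} (h : IsTest χ) : ∃ C : ℝ, ∀ z, |χ z| ≤ C :=
  h.2.exists_bound_of_continuous h.continuous

theorem IsTest.exists_support {χ : ℝ → ℝ} (h : IsTest χ) :
    ∃ R : ℝ, 0 < R ∧ ∀ z : ℝ, R ≤ |z| → χ z = 0 ∧ _root_.deriv χ z = 0 ∧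
      _root_.deriv (_root_.deriv χ) z = 0 := by
  obtain ⟨R, hR⟩ := h.2.isBounded.subset_closedBall 0
  refine ⟨|R| + 1, by positivity, fun z hz => ?_⟩
  have hn : z ∉ tsupport χ := fun hz' => by
    have := hR hz'
    simp only [mem_closedBall_zero_iff, Real.norm_eq_abs] at this
    linarith [le_abs_self R]
  have hd : tsupport (_root_.deriv χ) ⊆ tsupport χ := tsupport_deriv_subset
  have hdd : tsupport (_root_.deriv (_root_.deriv χ)) ⊆ tsupport χ := Subset.trans tsupport_deriv_subset hd
  exact ⟨image_eq_zero_of_notMem_tsupport hn, image_eq_zero_of_notMem_tsupport fun hz' => hn (hd hz'),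
    image_eq_zero_of_notMem_tsupport fun hz' => hn (hdd hz')⟩

theorem pairing_eq_cut {U : ℝ → ℝ → ℝ} {χ : ℝ → ℝ} {R : ℝ} (hR : 0 ≤ R)
    (hχ : ∀ z : ℝ, R ≤ |z| → χ z = 0) : pairing U χ = cutPairing U R χ := by
  ext t
  rw [cutPairing, intervalIntegral.integral_of_le (by linarith), pairing]
  refine (setIntegral_eq_integral_of_forall_compl_eq_zero fun z hz => ?_).symm
  rw [hχ z, zero_mul]
  by_contra hc
  have := abs_lt.1 (not_le.1 hc)
  exact hz ⟨this.1, this.2.le⟩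

/-- Integration by parts against `exp (-a |z|)`. -/
theorem IsTest.integral_exp_abs {χ : ℝ → ℝ} (h : IsTest χ) {R : ℝ} (hR : 0 < R)
    (h0 : ∀ z : ℝ, R ≤ |z| → χ z = 0 ∧ _root_.deriv χ z = 0 ∧
      _root_.deriv (_root_.deriv χ) z = 0) (a : ℝ) :
    ∫ z in (-R)..R, Real.exp (-(a * |z|)) * _root_.deriv (_root_.deriv χ) z =
      a ^ 2 * (∫ z in (-R)..R, Real.exp (-(a * |z|)) * χ z) - 2 * a * χ 0 := by
  have hcd := h.deriv.deriv.continuous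
  have hc := h.continuous
  -- The function `exp(bz)(χ' - bχ)` is a primitive of `exp(bz)(χ'' - b²χ)`. It is used with `b =
  -- -a` to the right of the origin and `b = a` to the left; the kink at the origin leaves
  -- `-2aχ(0)`.
  have key : ∀ b p q : ℝ, ∫ z in p..q, Real.exp (b * z) *
      (_root_.deriv (_root_.deriv χ) z - b ^ 2 * χ z) =
      Real.exp (b * q) * (_root_.deriv χ q - b * χ q) -
        Real.exp (b * p) * (_root_.deriv χ p - b * χ p) := by
    intro b p q
    refine intervalIntegral.integral_eq_sub_of_hasDerivAt
      (f := fun z => Real.exp (b * z) * (_root_.deriv χ z - b * χ z)) (fun z _ => ?_)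
      ((by fun_prop : Continuous _).intervalIntegrable _ _)
    have h1 : HasDerivAt (fun z => Real.exp (b * z)) (Real.exp (b * z) * (b * 1)) z :=
      ((hasDerivAt_id z).const_mul b).exp
    have h2 : HasDerivAt (fun z => Real.exp (b * z) * (_root_.deriv χ z - b * χ z)) _ z :=
      h1.mul ((h.deriv.hasDerivAt z).sub ((h.hasDerivAt z).const_mul b))
    refine h2.congr_deriv ?_
    change Real.exp (b * z) * (b * 1) * (_root_.deriv χ z - b * χ z) + Real.exp (b * z) *
      (_root_.deriv (_root_.deriv χ) z - b * _root_.deriv χ z) = _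
    ring
  have hR' := h0 R (le_abs_self R)
  have hRn := h0 (-R) (by rw [abs_neg]; exact le_abs_self R)
  have k1 := key (-a) 0 R
  have k2 := key a (-R) 0
  simp only [hR'.1, hR'.2.1, hRn.1, hRn.2.1, mul_zero, sub_self, Real.exp_zero, one_mul, neg_sq,
    sub_zero, zero_sub] at k1 k2
  have i1 : ∫ z in (0 : ℝ)..R, Real.exp (-(a * |z|)) *
      (_root_.deriv (_root_.deriv χ) z - a ^ 2 * χ z) = -(_root_.deriv χ 0 - -a * χ 0) := by
    rw [← k1]
    refine intervalIntegral.integral_congr fun z hz => ?_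
    rw [uIcc_of_le hR.le] at hz
    simp only [abs_of_nonneg hz.1, neg_mul]
  have i2 : ∫ z in (-R)..0, Real.exp (-(a * |z|)) *
      (_root_.deriv (_root_.deriv χ) z - a ^ 2 * χ z) = _root_.deriv χ 0 - a * χ 0 := by
    rw [← k2]
    refine intervalIntegral.integral_congr fun z hz => ?_
    rw [uIcc_of_le (by linarith)] at hz
    simp only [abs_of_nonpos hz.2, mul_neg, neg_neg]
  have i3 := intervalIntegral.integral_add_adjacent_intervals (μ := volume)
    ((by fun_prop : Continuous fun z => Real.exp (-(a * |z|)) *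
      (_root_.deriv (_root_.deriv χ) z - a ^ 2 * χ z)).intervalIntegrable (-R) 0)
    ((by fun_prop : Continuous fun z => Real.exp (-(a * |z|)) *
      (_root_.deriv (_root_.deriv χ) z - a ^ 2 * χ z)).intervalIntegrable 0 R)
  have i4 : ∫ z in (-R)..R, Real.exp (-(a * |z|)) *
      (_root_.deriv (_root_.deriv χ) z - a ^ 2 * χ z) =
      (∫ z in (-R)..R, Real.exp (-(a * |z|)) * _root_.deriv (_root_.deriv χ) z) -
        a ^ 2 * ∫ z in (-R)..R, Real.exp (-(a * |z|)) * χ z := by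
    rw [← intervalIntegral.integral_const_mul, ← intervalIntegral.integral_sub
      ((by fun_prop : Continuous _).intervalIntegrable _ _)
      ((by fun_prop : Continuous _).intervalIntegrable _ _)]
    congr 1; ext z; ring
  linarith

/-! ### Existence of a fundamental solution. -/

section
variable {a : ℝ → ℝ} {U : ℝ → ℝ → ℝ} (h : GreenKernel a U)
include h

theorem GreenKernel.abs_pairing_le {χ : ℝ → ℝ} {C : ℝ} (hχ : ∀ z, |χ z| ≤ C) {t : ℝ}
    (ht : 0 < t) : |pairing U χ t| ≤ C := by
  have hC : 0 ≤ C := (abs_nonneg _).trans (hχ 0)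
  have h1 := norm_integral_le_of_norm_le ((h.integrable ht).abs.const_mul C)
    (f := fun z => χ z * U t z) (ae_of_all _ fun z => by
      rw [norm_mul, Real.norm_eq_abs, Real.norm_eq_abs]
      exact mul_le_mul_of_nonneg_right (hχ z) (abs_nonneg _))
  rw [integral_const_mul] at h1
  refine h1.trans ?_
  have := mul_le_mul_of_nonneg_left (h.integral_abs_le ht) hC
  linarith

theorem GreenKernel.continuousOn_pairing {χ : ℝ → ℝ} (hχ : IsTest χ) :
    ContinuousOn (pairing U χ) (Ioi 0) := by
  obtain ⟨R, hR, hs⟩ := hχ.exists_support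
  rw [pairing_eq_cut hR.le fun z hz => (hs z hz).1]
  exact h.continuousOn_cutPairing R hχ.continuous

theorem GreenKernel.dom_pairing {χ : ℝ → ℝ} (hχ : IsTest χ) : Dom (pairing U χ) := by
  obtain ⟨C, hC⟩ := hχ.exists_bound
  exact Dom.of_bounded (h.continuousOn_pairing hχ) fun T _ =>
    ⟨C, fun t ht => h.abs_pairing_le hC ht.1⟩

theorem GreenKernel.la_pairing {χ : ℝ → ℝ} (hχ : IsTest χ) : LA (pairing U χ) := by
  obtain ⟨C, hC⟩ := hχ.exists_bound
  exact LA.of_bounded (h.continuousOn_pairing hχ) fun t ht => h.abs_pairing_le hC ht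

/-- The kink of `exp(-a|z|)` contributes `a²χ(0)/λ`, which is precisely what replaces the pairing by
the deviation. -/
theorem GreenKernel.laplace_pairing {χ : ℝ → ℝ} (hχ : IsTest χ) {x : ℝ} (hx : 0 < x) :
    SlowVariance.laplace (pairing U (deriv (deriv χ))) x =
      a x ^ 2 * SlowVariance.laplace (deviation U χ) x := by
  obtain ⟨R, hR, hs⟩ := hχ.exists_support
  have h1 : SlowVariance.laplace (deviation U χ) x =
      SlowVariance.laplace (pairing U χ) x - χ 0 / x := by
    rw [← laplace_const hx]
    exact laplace_sub (h.la_pairing hχ) (LA.of_bounded (C := |χ 0|) continuousOn_const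
      fun _ _ => le_rfl) hx
  rw [h1, pairing_eq_cut hR.le fun z hz => (hs z hz).1,
    pairing_eq_cut hR.le fun z hz => (hs z hz).2.2, h.laplace_cut hR.le hχ.continuous hx,
    h.laplace_cut hR.le hχ.deriv.deriv.continuous hx, hχ.integral_exp_abs hR hs]
  field_simp

/-- Let `w` be the pairing with `χ''`. On transforms, `νa² = g(g + η)` says that the deviation is `ν
l * r * w`. A first convolution with `k` cancels `l`; a second one meets `r`, and `k * r = 1 - η (1
* r)`. Both convolutions in the equation thus become primitives of continuous functions, and the
required derivatives can be read off. -/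
theorem GreenKernel.isFundamentalSolution {η ν : ℝ} {g k l r : ℝ → ℝ}
    (hk : KernelTriple η g k l r)
    (ha : ∀ x : ℝ, 0 < x → ν * a x ^ 2 = g x * (g x + η)) : IsFundamentalSolution k η ν U := by
  have one := Dom.const 1
  have hdev : ∀ {χ : ℝ → ℝ}, IsTest χ → ∀ t : ℝ, 0 < t → deviation U χ t =
      ν * conv l (conv r (pairing U (deriv (deriv χ)))) t := by
    intro χ hχ t ht
    have hw := hχ.deriv.deriv
    have hc : LA (fun _ => χ 0) := LA.of_bounded (C := |χ 0|) continuousOn_const fun _ _ => le_rfl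
    refine eq_of_laplace_eq (f := deviation U χ)
      (g := fun t => ν * conv l (conv r (pairing U (deriv (deriv χ)))) t)
      ((h.la_pairing hχ).sub hc) ((hk.l.la.conv (hk.r.la.conv (h.la_pairing hw))).const_mul ν)
      ((h.continuousOn_pairing hχ).sub continuousOn_const)
      ((hk.l.dom.conv (hk.r.dom.conv (h.dom_pairing hw))).const_mul ν).cont (fun x hx => ?_) t ht
    rw [laplace_const_mul, laplace_conv hk.l.la (hk.r.la.conv (h.la_pairing hw)) hx,
      laplace_conv hk.r.la (h.la_pairing hw) hx, hk.l.laplace x hx, hk.r.laplace x hx,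
      h.laplace_pairing hχ hx]
    have := hk.pos x hx
    have := hk.eta_pos
    have e : ν * ((g x)⁻¹ * ((g x + η)⁻¹ * (a x ^ 2 * SlowVariance.laplace (deviation U χ) x))) =
      (ν * a x ^ 2) * (g x)⁻¹ * (g x + η)⁻¹ * SlowVariance.laplace (deviation U χ) x := by ring
    rw [e, ha x hx]
    field_simp
  have hkd : ∀ {χ : ℝ → ℝ}, IsTest χ → ∀ t : ℝ, 0 < t → conv k (deviation U χ) t =
      ν * conv (fun _ => 1) (conv r (pairing U (deriv (deriv χ)))) t := by
    intro χ hχ t ht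
    have hw := h.dom_pairing hχ.deriv.deriv
    have hrw := hk.r.dom.conv hw
    rw [conv_congr (fun _ _ => rfl) (fun s hs => hdev hχ s hs.1) ht, conv_const_mul,
      ← conv_assoc hk.k.dom hk.l.dom hrw ht,
      conv_congr (fun s hs => hk.conv_k_l hs.1) (fun _ _ => rfl) ht]
  have hkkd : ∀ {χ : ℝ → ℝ}, IsTest χ → ∀ t : ℝ, 0 < t → conv k (conv k (deviation U χ)) t =
      ν * conv (fun _ => 1) (fun t => conv (fun _ => 1) (pairing U (deriv (deriv χ))) t + -η *
        conv (fun _ => 1) (conv r (pairing U (deriv (deriv χ)))) t) t := by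
    intro χ hχ t ht
    have hw := h.dom_pairing hχ.deriv.deriv
    have hrw := hk.r.dom.conv hw
    rw [conv_congr (fun _ _ => rfl) (fun s hs => hkd hχ s hs.1) ht, conv_const_mul,
      conv_left_comm hk.k.dom one hrw ht]
    congr 1
    refine conv_congr (fun _ _ => rfl) (fun s hs => ?_) ht
    rw [← conv_assoc hk.k.dom hk.r.dom hw hs.1, ← conv_assoc one hk.r.dom hw hs.1,
      conv_congr (fun u hu => hk.conv_k_r hu.1) (fun _ _ => rfl) hs.1, conv_comm,
      conv_congr (f := pairing U (deriv (deriv χ))) (fun _ _ => rfl)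
        (fun u _ => sub_eq_add_neg 1 (η * conv (fun _ => 1) r u)) hs.1,
      conv_congr (f := pairing U (deriv (deriv χ))) (g' := fun u => 1 + -η * conv (fun _ => 1) r u)
        (fun _ _ => rfl) (fun u _ => by ring) hs.1,
      conv_add hw one ((one.conv hk.r.dom).const_mul _) hs.1, conv_const_mul, conv_comm,
      conv_comm _ (conv (fun _ => 1) r)]
  have hz : ∀ {χ : ℝ → ℝ}, IsTest χ → ∀ t : ℝ, 0 < t → HasDerivAt
      (conv k (conv k (deviation U χ)))
      (ν * (conv (fun _ => 1) (pairing U (deriv (deriv χ))) t + -η *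
        conv (fun _ => 1) (conv r (pairing U (deriv (deriv χ)))) t)) t := by
    intro χ hχ t ht
    have hw := h.dom_pairing hχ.deriv.deriv
    have hrw := hk.r.dom.conv hw
    refine HasDerivAt.congr_of_eventuallyEq ((Dom.hasDerivAt_conv_one
      ((one.conv hw).add ((one.conv hrw).const_mul (-η))) ht).const_mul ν) ?_
    filter_upwards [Ioi_mem_nhds ht] with s hs using hkkd hχ s hs
  have hy : ∀ {χ : ℝ → ℝ}, IsTest χ → ∀ t : ℝ, 0 < t → HasDerivAt (conv k (deviation U χ))
      (ν * conv r (pairing U (deriv (deriv χ))) t) t := by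
    intro χ hχ t ht
    have hw := h.dom_pairing hχ.deriv.deriv
    have hrw := hk.r.dom.conv hw
    refine HasDerivAt.congr_of_eventuallyEq ((Dom.hasDerivAt_conv_one hrw ht).const_mul ν) ?_
    filter_upwards [Ioi_mem_nhds ht] with s hs using hkd hχ s hs
  have hz2 : ∀ {χ : ℝ → ℝ}, IsTest χ → ∀ t : ℝ, 0 < t → HasDerivAt
      (deriv (conv k (conv k (deviation U χ))))
      (ν * (pairing U (deriv (deriv χ)) t + -η * conv r (pairing U (deriv (deriv χ))) t)) t := by
    intro χ hχ t ht
    have hw := h.dom_pairing hχ.deriv.deriv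
    have hrw := hk.r.dom.conv hw
    refine HasDerivAt.congr_of_eventuallyEq (((hw.hasDerivAt_conv_one ht).add
      ((hrw.hasDerivAt_conv_one ht).const_mul (-η))).const_mul ν) ?_
    filter_upwards [Ioi_mem_nhds ht] with s hs using (hz hχ s hs).deriv
  refine ⟨fun t ht => h.integrable ht, fun T _ => ⟨1, fun t ht => h.integral_abs_le ht.1⟩,
    fun χ hχ => h.continuousOn_pairing hχ, fun χ hχ => ?_, fun χ hχ => ?_,
    fun χ hχ t ht => (hy hχ t ht).differentiableAt, fun χ hχ t ht => (hz hχ t ht).differentiableAt,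
    fun χ hχ t ht => (hz2 hχ t ht).differentiableAt, fun χ hχ t ht => ?_⟩
  · have hw := h.dom_pairing hχ.deriv.deriv
    obtain ⟨C, hC⟩ := hχ.deriv.deriv.exists_bound
    obtain ⟨C', hC'⟩ := hk.r.dom.exists_abs_conv_le hw
      (fun T _ => ⟨C, fun t ht => h.abs_pairing_le hC ht.1⟩) 1 one_pos
    have h1 := ((hk.l.dom.tendsto_conv_zero (hk.r.dom.conv hw) one_pos hC').const_mul ν).add_const
      (χ 0)
    rw [mul_zero, zero_add] at h1
    refine h1.congr' ?_
    filter_upwards [self_mem_nhdsWithin] with t ht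
    rw [← hdev hχ t ht, deviation, sub_add_cancel]
  · have hw := h.dom_pairing hχ.deriv.deriv
    obtain ⟨C, hC⟩ := hχ.deriv.deriv.exists_bound
    have hb : ∀ s ∈ Ioc (0 : ℝ) 1, |pairing U (deriv (deriv χ)) s| ≤ C :=
      fun t ht => h.abs_pairing_le hC ht.1
    obtain ⟨C', hC'⟩ := hk.r.dom.exists_abs_conv_le hw
      (fun T _ => ⟨C, fun t ht => h.abs_pairing_le hC ht.1⟩) 1 one_pos
    have h1 := ((one.tendsto_conv_zero hw one_pos hb).add ((one.tendsto_conv_zero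
      (hk.r.dom.conv hw) one_pos hC').const_mul (-η))).const_mul ν
    rw [mul_zero, zero_add, mul_zero] at h1
    refine h1.congr' ?_
    filter_upwards [self_mem_nhdsWithin] with t ht
    exact (hz hχ t ht).deriv.symm
  · rw [(hz2 hχ t ht).deriv, (hy hχ t ht).deriv]
    ring

end

theorem LogCBF.kernelTriple {L : ℂ → ℂ} (h : LogCBF L) {η : ℝ} (hη : 0 < η) {k l : ℝ → ℝ}
    (hk : CMFor k fun x => gOf L x / x) (hl : CMFor l fun x => (gOf L x)⁻¹) :
    KernelTriple η (gOf L) k l (sFun (dens fun z => (Complex.exp (L z) + η)⁻¹)) :=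
  ⟨hη, fun x _ => gOf_pos L x, hk, hl, h.cmFor_inv hη⟩

theorem LogCBF.gOf_logM {L : ℂ → ℂ} (h : LogCBF L) {η : ℝ} (hη : 0 < η) (x : ℝ) :
    gOf (SlowVariance.logM L η) x ^ 2 = gOf L x * (gOf L x + η) := by
  have h1 := (h.logM hη).pre.exp_ofReal x
  have h2 := h.pre.exp_ofReal x
  have hp := gOf_pos L x
  have h3 : (gOf (SlowVariance.logM L η) x : ℂ) ^ 2 = gOf L x * (gOf L x + η) := by
    rw [← h1, ← Complex.exp_nat_mul, SlowVariance.logM]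
    have e : ((2 : ℕ) : ℂ) * ((L (Real.log x) + Complex.log (Complex.exp (L (Real.log x)) + η)) / 2) =
        L (Real.log x) + Complex.log (Complex.exp (L (Real.log x)) + η) := by push_cast; ring
    rw [e, Complex.exp_add, h2, Complex.exp_log]
    exact_mod_cast (add_pos hp hη).ne'
  exact_mod_cast h3

theorem LogCBF.greenKernel {Λ : ℂ → ℂ} (h : LogCBF Λ) {c : ℝ} (hc : 0 < c) :
    GreenKernel (fun x => gOf Λ x / c) fun t z => 1 / (2 * c) * sFun (solDens Λ 0 (|z| / c)) t := by
  have habs : ∀ z : ℝ, |z| / c = |z / c| := fun z => by rw [abs_div, abs_of_pos hc]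
  refine ⟨fun x _ => div_pos (gOf_pos Λ x) hc, fun p hp => ?_, fun t z ht => ?_, fun z hz => ?_,
    fun z hz x hx => ?_⟩
  · simp only [habs]
    refine ContinuousAt.const_mul ?_ _
    exact (h.continuousAt_sol (p := (p.1, p.2 / c)) hp).comp
      (f := fun p : ℝ × ℝ => (p.1, p.2 / c)) (by fun_prop)
  · exact mul_nonneg (by positivity) (h.sol_nonneg (by positivity) ht)
  · exact (h.sol_laplace (div_pos (abs_pos.2 hz) hc)).1.const_mul _
  · rw [laplace_const_mul, (h.sol_laplace (div_pos (abs_pos.2 hz) hc)).2 x hx]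
    have e : |z| / c * gOf Λ x = gOf Λ x / c * |z| := by ring
    rw [e]
    field_simp

theorem exists_isFundamentalSolution {L : ℂ → ℂ} (h : LogCBF L) {η ν : ℝ} (hη : 0 < η) (hν : 0 < ν)
    {k l : ℝ → ℝ} (hk : CMFor k fun x => gOf L x / x) (hl : CMFor l fun x => (gOf L x)⁻¹) :
    ∃ U : ℝ → ℝ → ℝ, (∀ t z : ℝ, 0 < t → 0 ≤ U t z) ∧ IsFundamentalSolution k η ν U := by
  have hg := (h.logM hη).greenKernel (Real.sqrt_pos.2 hν)
  refine ⟨_, hg.nonneg, hg.isFundamentalSolution (h.kernelTriple hη hk hl) fun x _ => ?_⟩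
  rw [div_pow, Real.sq_sqrt hν.le, h.gOf_logM hη]
  field_simp

/-! ### From the differential equation to a Volterra equation. -/

theorem eq_of_hasDerivAt {f g f' : ℝ → ℝ} (hf : ∀ t : ℝ, 0 < t → HasDerivAt f (f' t) t)
    (hg : ∀ t : ℝ, 0 < t → HasDerivAt g (f' t) t) (hf0 : Tendsto f (𝓝[>] 0) (𝓝 0))
    (hg0 : Tendsto g (𝓝[>] 0) (𝓝 0)) : ∀ t : ℝ, 0 < t → f t = g t := by
  have hd : ∀ t : ℝ, 0 < t → HasDerivAt (fun t => f t - g t) 0 t := fun t ht => by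
    have := (hf t ht).sub (hg t ht)
    rwa [sub_self] at this
  have hc : ∀ s t : ℝ, 0 < s → 0 < t → f s - g s = f t - g t := fun s t hs ht =>
    (convex_Ioi (0 : ℝ)).is_const_of_fderivWithin_eq_zero (𝕜 := ℝ) (f := fun t => f t - g t)
      (fun u hu => (hd u hu).differentiableAt.differentiableWithinAt)
      (fun u hu => by
        have h1 := (hd u hu).hasFDerivAt.hasFDerivWithinAt (s := Ioi 0)
        rw [h1.fderivWithin (isOpen_Ioi.uniqueDiffWithinAt hu)]
        ext; simp) hs ht
  intro t ht
  have h1 : Tendsto (fun s => f s - g s) (𝓝[>] 0) (𝓝 (0 - 0)) := hf0.sub hg0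
  have h2 : Tendsto (fun s => f s - g s) (𝓝[>] 0) (𝓝 (f t - g t)) := by
    refine tendsto_const_nhds.congr' ?_
    filter_upwards [self_mem_nhdsWithin] with s hs using hc t s ht hs
  have := tendsto_nhds_unique h1 h2
  linarith

theorem eq_of_conv_one_eq {f g : ℝ → ℝ} (hf : Dom f) (hg : Dom g)
    (h : ∀ t : ℝ, 0 < t → conv (fun _ => 1) f t = conv (fun _ => 1) g t) :
    ∀ t : ℝ, 0 < t → f t = g t := by
  intro t ht
  refine (hf.hasDerivAt_conv_one ht).unique ((hg.hasDerivAt_conv_one ht).congr_of_eventuallyEq ?_)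
  filter_upwards [Ioi_mem_nhds ht] with s hs using h s hs

section
variable {k : ℝ → ℝ} {η ν : ℝ} {U : ℝ → ℝ → ℝ} (h : IsFundamentalSolution k η ν U)
include h

theorem IsFundamentalSolution.exists_abs_pairing_le {χ : ℝ → ℝ} {C : ℝ} (hχ : ∀ z, |χ z| ≤ C) (T : ℝ)
    (hT : 0 < T) : ∃ C' : ℝ, ∀ t ∈ Ioc 0 T, |pairing U χ t| ≤ C' := by
  have hC : 0 ≤ C := (abs_nonneg _).trans (hχ 0)
  obtain ⟨B, hB⟩ := h.bounded T hT
  refine ⟨C * B, fun t ht => ?_⟩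
  have h1 := norm_integral_le_of_norm_le ((h.integrable t ht.1).abs.const_mul C)
    (f := fun z => χ z * U t z) (ae_of_all _ fun z => by
      rw [norm_mul, Real.norm_eq_abs, Real.norm_eq_abs]
      exact mul_le_mul_of_nonneg_right (hχ z) (abs_nonneg _))
  rw [integral_const_mul] at h1
  exact h1.trans (mul_le_mul_of_nonneg_left (hB t ht) hC)

theorem IsFundamentalSolution.dom_pairing {χ : ℝ → ℝ} (hχ : IsTest χ) : Dom (pairing U χ) := by
  obtain ⟨C, hC⟩ := hχ.exists_bound
  exact Dom.of_bounded (h.continuousOn χ hχ) (h.exists_abs_pairing_le hC)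

/-- The existence computation run backwards. Two integrations in time use up the initial conditions;
convolution with `r` and then with `l` undoes the two convolutions with `k`. -/
theorem IsFundamentalSolution.deviation_eq {g l r : ℝ → ℝ} (hk : KernelTriple η g k l r) {χ : ℝ → ℝ}
    (hχ : IsTest χ) : ∀ t : ℝ, 0 < t →
      deviation U χ t = ν * conv (conv l r) (pairing U (deriv (deriv χ))) t := by
  have one := Dom.const 1
  have dk := hk.k.dom
  have dr := hk.r.dom
  have dl := hk.l.dom
  obtain ⟨C, hC⟩ := hχ.exists_bound
  obtain ⟨C₂, hC₂⟩ := hχ.deriv.deriv.exists_bound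
  have dw := h.dom_pairing hχ.deriv.deriv
  have bw := h.exists_abs_pairing_le hC₂
  have bd : ∀ T : ℝ, 0 < T → ∃ B : ℝ, ∀ t ∈ Ioc 0 T, |deviation U χ t| ≤ B := by
    intro T hT
    obtain ⟨B, hB⟩ := h.exists_abs_pairing_le hC T hT
    exact ⟨B + |χ 0|, fun t ht => (abs_sub _ _).trans (add_le_add (hB t ht) le_rfl)⟩
  have dd : Dom (deviation U χ) :=
    Dom.of_bounded ((h.continuousOn χ hχ).sub continuousOn_const) bd
  set w := pairing U (deriv (deriv χ))
  set d := deviation U χ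
  have by1 := dk.exists_abs_conv_le dd bd
  have dy := dk.conv dd
  obtain ⟨B, hB⟩ := bd 1 one_pos
  obtain ⟨By, hBy⟩ := by1 1 one_pos
  obtain ⟨Bw, hBw⟩ := bw 1 one_pos
  obtain ⟨Bww, hBww⟩ := one.exists_abs_conv_le dw bw 1 one_pos
  have hy0 : Tendsto (conv k d) (𝓝[>] 0) (𝓝 0) := dk.tendsto_conv_zero dd one_pos hB
  have hz0 : Tendsto (conv k (conv k d)) (𝓝[>] 0) (𝓝 0) := dk.tendsto_conv_zero dy one_pos hBy
  have e1 : ∀ t : ℝ, 0 < t → deriv (conv k (conv k d)) t + η * conv k d t =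
      ν * conv (fun _ => 1) w t := by
    refine eq_of_hasDerivAt (f' := fun t => ν * w t) (fun t ht => ?_)
      (fun t ht => (dw.hasDerivAt_conv_one ht).const_mul ν) ?_ ?_
    · have := (h.differentiable_deriv χ hχ t ht).hasDerivAt.add
        ((h.differentiable_conv χ hχ t ht).hasDerivAt.const_mul η)
      refine this.congr_deriv ?_
      linarith [h.equation χ hχ t ht]
    · simpa using (h.initial_deriv χ hχ).add (hy0.const_mul η)
    · simpa using (one.tendsto_conv_zero dw one_pos hBw).const_mul ν
  have e2 : ∀ t : ℝ, 0 < t → conv k (conv k d) t + η * conv (fun _ => 1) (conv k d) t =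
      ν * conv (fun _ => 1) (conv (fun _ => 1) w) t := by
    refine eq_of_hasDerivAt (f' := fun t => ν * conv (fun _ => 1) w t) (fun t ht => ?_)
      (fun t ht => ((one.conv dw).hasDerivAt_conv_one ht).const_mul ν) ?_ ?_
    · exact ((h.differentiable_conv_conv χ hχ t ht).hasDerivAt.add
        ((dy.hasDerivAt_conv_one ht).const_mul η)).congr_deriv (e1 t ht)
    · simpa using hz0.add ((one.tendsto_conv_zero dy one_pos hBy).const_mul η)
    · simpa using (one.tendsto_conv_zero (one.conv dw) one_pos hBww).const_mul ν
  -- Convolving with `r` and using `r * k + η (1 * r) = 1` leaves `1 * (k * d)`; the outer `1` is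
  -- then removed by differentiation. The next step removes the remaining `k` in the same way, by `l
  -- * k = 1`.
  have e3 : ∀ t : ℝ, 0 < t → conv k d t = ν * conv (fun _ => 1) (conv r w) t := by
    refine eq_of_conv_one_eq dy ((one.conv (dr.conv dw)).const_mul ν) fun t ht => ?_
    have s1 : conv r (fun t => conv k (conv k d) t + η * conv (fun _ => 1) (conv k d) t) t =
        conv r (fun t => ν * conv (fun _ => 1) (conv (fun _ => 1) w) t) t :=
      conv_congr (fun _ _ => rfl) (fun s hs => e2 s hs.1) ht
    rw [conv_add dr (dk.conv dy) ((one.conv dy).const_mul η) ht, conv_const_mul, conv_const_mul,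
      conv_left_comm dr one (one.conv dw) ht,
      conv_congr (f := fun _ => (1 : ℝ)) (fun _ _ => rfl)
        (fun s hs => conv_left_comm dr one dw hs.1) ht, ← conv_assoc dr dk dy ht,
      conv_left_comm dr one dy ht, ← conv_assoc one dr dy ht] at s1
    have s2 : conv (conv k d) (fun s => conv r k s + η * conv (fun _ => 1) r s) t =
        conv (conv k d) (fun _ => 1) t := conv_congr (fun _ _ => rfl)
      (fun s hs => by rw [conv_comm r k, hk.conv_k_r hs.1]; ring) ht
    rw [conv_add dy (dr.conv dk) ((one.conv dr).const_mul η) ht, conv_const_mul] at s2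
    rw [conv_const_mul, ← s1, conv_comm (fun _ => 1), ← s2, conv_comm (conv k d),
      conv_comm (conv k d)]
  have e4 : ∀ t : ℝ, 0 < t → d t = ν * conv l (conv r w) t := by
    refine eq_of_conv_one_eq dd ((dl.conv (dr.conv dw)).const_mul ν) fun t ht => ?_
    have s1 : conv l (conv k d) t = conv l (fun t => ν * conv (fun _ => 1) (conv r w) t) t :=
      conv_congr (fun _ _ => rfl) (fun s hs => e3 s hs.1) ht
    rw [conv_const_mul, conv_left_comm dl one (dr.conv dw) ht, ← conv_assoc dl dk dd ht,
      conv_congr (fun s hs => (conv_comm l k s).trans (hk.conv_k_l hs.1)) (fun _ _ => rfl) ht] at s1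
    rw [s1, conv_const_mul]
  intro t ht
  rw [e4 t ht, conv_assoc dl dr dw ht]

end

/-! ### Weak Volterra equations and scalar uniqueness. -/

/-- A Volterra equation in the time variable, satisfied weakly in the space variable. -/
structure WeakVolterra (κ : ℝ → ℝ) (ν c : ℝ) (W : ℝ → ℝ → ℝ) : Prop where
  dom : Dom κ
  kernel_nonneg : ∀ t : ℝ, 0 < t → 0 ≤ κ t
  la : LA κ
  integrable : ∀ t : ℝ, 0 < t → Integrable (W t)
  bounded : ∀ T : ℝ, 0 < T → ∃ C : ℝ, ∀ t ∈ Ioc 0 T, ∫ z, |W t z| ≤ C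
  continuousOn : ∀ χ : ℝ → ℝ, IsTest χ → ContinuousOn (pairing W χ) (Ioi 0)
  eq : ∀ χ : ℝ → ℝ, IsTest χ → ∀ t : ℝ, 0 < t →
    pairing W χ t - c * χ 0 = ν * conv κ (pairing W (deriv (deriv χ))) t

theorem Kern.conv_nonneg {f g : ℝ → ℝ} (hf : Kern f) (hg : Kern g) {t : ℝ} (ht : 0 < t) :
    0 ≤ conv f g t := by
  rw [conv, intervalIntegral.integral_of_le ht.le, integral_Ioc_eq_integral_Ioo]
  exact setIntegral_nonneg measurableSet_Ioo fun s hs =>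
    mul_nonneg (hf.nonneg _ (by linarith [hs.2])) (hg.nonneg _ hs.1)

theorem IsFundamentalSolution.weakVolterra {η ν : ℝ} {g k l r : ℝ → ℝ} {U : ℝ → ℝ → ℝ}
    (h : IsFundamentalSolution k η ν U) (hk : KernelTriple η g k l r) :
    WeakVolterra (conv l r) ν 1 U :=
  ⟨hk.l.dom.conv hk.r.dom, fun _ ht => hk.l.kern.conv_nonneg hk.r.kern ht, hk.l.la.conv hk.r.la,
    h.integrable, h.bounded, h.continuousOn, fun χ hχ t ht => by
      rw [one_mul]; exact h.deviation_eq hk hχ t ht⟩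

theorem pairing_sub {U V : ℝ → ℝ → ℝ} {χ : ℝ → ℝ} (hχ : IsTest χ) {t : ℝ} (hU : Integrable (U t))
    (hV : Integrable (V t)) :
    pairing (fun t z => U t z - V t z) χ t = pairing U χ t - pairing V χ t := by
  obtain ⟨C, hC⟩ := hχ.exists_bound
  have h1 : ∀ {f : ℝ → ℝ}, Integrable f → Integrable fun z => χ z * f z := fun hf =>
    hf.bdd_mul hχ.continuous.aestronglyMeasurable (ae_of_all _ hC)
  simp only [pairing]
  rw [← integral_sub (h1 hU) (h1 hV)]
  congr 1; ext z; ring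

theorem WeakVolterra.sub {κ : ℝ → ℝ} {ν c c' : ℝ} {U V : ℝ → ℝ → ℝ} (hU : WeakVolterra κ ν c U)
    (hV : WeakVolterra κ ν c' V) : WeakVolterra κ ν (c - c') fun t z => U t z - V t z := by
  have hp : ∀ {χ : ℝ → ℝ}, IsTest χ → ∀ t : ℝ, 0 < t →
      pairing (fun t z => U t z - V t z) χ t = pairing U χ t - pairing V χ t := fun hχ t ht =>
    pairing_sub hχ (hU.integrable t ht) (hV.integrable t ht)
  have hd : ∀ {W : ℝ → ℝ → ℝ} {c : ℝ}, WeakVolterra κ ν c W → ∀ {χ : ℝ → ℝ}, IsTest χ →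
      Dom (pairing W χ) := by
    intro W c hW χ hχ
    obtain ⟨C, hC⟩ := hχ.exists_bound
    refine Dom.of_bounded (hW.continuousOn χ hχ) fun T hT => ?_
    obtain ⟨B, hB⟩ := hW.bounded T hT
    refine ⟨C * B, fun t ht => ?_⟩
    have h1 := norm_integral_le_of_norm_le ((hW.integrable t ht.1).abs.const_mul C)
      (f := fun z => χ z * W t z) (ae_of_all _ fun z => by
        rw [norm_mul, Real.norm_eq_abs, Real.norm_eq_abs]
        exact mul_le_mul_of_nonneg_right (hC z) (abs_nonneg _))
    rw [integral_const_mul] at h1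
    exact h1.trans (mul_le_mul_of_nonneg_left (hB t ht) ((abs_nonneg _).trans (hC 0)))
  refine ⟨hU.dom, hU.kernel_nonneg, hU.la, fun t ht => (hU.integrable t ht).sub (hV.integrable t ht),
    fun T hT => ?_, fun χ hχ => ?_, fun χ hχ t ht => ?_⟩
  · obtain ⟨B, hB⟩ := hU.bounded T hT
    obtain ⟨B', hB'⟩ := hV.bounded T hT
    refine ⟨B + B', fun t ht => ?_⟩
    have i1 := (hU.integrable t ht.1).abs
    have i2 := (hV.integrable t ht.1).abs
    calc ∫ z, |U t z - V t z| ≤ ∫ z, (|U t z| + |V t z|) :=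
          integral_mono ((hU.integrable t ht.1).sub (hV.integrable t ht.1)).abs (i1.add i2)
            fun z => abs_sub _ _
      _ = (∫ z, |U t z|) + ∫ z, |V t z| := integral_add i1 i2
      _ ≤ _ := add_le_add (hB t ht) (hB' t ht)
  · exact ((hU.continuousOn χ hχ).sub (hV.continuousOn χ hχ)).congr fun t ht => hp hχ t ht
  · have h2 := hχ.deriv.deriv
    rw [hp hχ t ht, conv_congr (f := κ) (g' := fun s => pairing U (deriv (deriv χ)) s + (-1) *
      pairing V (deriv (deriv χ)) s) (fun _ _ => rfl) (fun s hs => by rw [hp h2 s hs.1]; ring) ht,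
      conv_add hU.dom (hd hU h2) ((hd hV h2).const_mul _) ht, conv_const_mul]
    linarith [hU.eq χ hχ t ht, hV.eq χ hχ t ht]

/-- Uniqueness for the scalar Volterra equation. -/
theorem volterra_unique {κ Q : ℝ → ℝ} (hκ : ∀ t : ℝ, 0 < t → 0 ≤ κ t) (hl : LA κ) {b T : ℝ}
    (hQ : ∃ C : ℝ, ∀ t ∈ Ioc 0 T, |Q t| ≤ C) (heq : ∀ t ∈ Ioc 0 T, Q t = b * conv κ Q t) :
    ∀ t ∈ Ioc 0 T, Q t = 0 := by
  obtain ⟨C, hC⟩ := hQ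
  -- For a large weight `exp(-σt)` the norm of convolution with `κ` is the transform at `σ`, which
  -- tends to zero; so `b κ *` becomes a contraction with factor `1/2`.
  have hlim : Tendsto (fun n : ℕ => laplace κ (n + 1)) atTop (𝓝 0) := by
    have : Tendsto (fun n : ℕ => ∫ t in Ioi (0 : ℝ), Real.exp (-((n + 1 : ℝ) * t)) * κ t) atTop
        (𝓝 (∫ t in Ioi (0 : ℝ), 0)) := by
      refine tendsto_integral_of_dominated_convergence (fun t => Real.exp (-(1 * t)) * κ t)
        (fun n => (hl _ (by positivity)).aestronglyMeasurable) (hl 1 one_pos) (fun n => ?_) ?_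
      · refine (ae_restrict_iff' measurableSet_Ioi).2 (ae_of_all _ fun t ht => ?_)
        have ht' : 0 < t := ht
        rw [Real.norm_eq_abs, abs_of_nonneg (mul_nonneg (Real.exp_pos _).le (hκ t ht))]
        refine mul_le_mul_of_nonneg_right (Real.exp_le_exp.2 ?_) (hκ t ht)
        have : (0 : ℝ) ≤ n * t := by positivity
        linarith
      · refine (ae_restrict_iff' measurableSet_Ioi).2 (ae_of_all _ fun t ht => ?_)
        have ht' : 0 < t := ht
        have h1 : Tendsto (fun n : ℕ => Real.exp (-((n + 1 : ℝ) * t))) atTop (𝓝 0) := by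
          refine Real.tendsto_exp_neg_atTop_nhds_zero.comp (Tendsto.atTop_mul_const ht' ?_)
          exact tendsto_atTop_add_const_right _ _ tendsto_natCast_atTop_atTop
        simpa using h1.mul_const (κ t)
    simpa [laplace] using this
  obtain ⟨n, hn⟩ := ((hlim.const_mul |b|).eventually_lt_const (u := 1 / 2) (by simp)).exists
  set σ : ℝ := n + 1
  have hσ : 0 < σ := by positivity
  have hint : ∀ t : ℝ, 0 < t → IntervalIntegrable (fun s => κ (t - s) * Real.exp (σ * s))
      volume 0 t := fun t ht =>
    ((hl.locInt).intervalIntegrable_sub ht).mul_continuousOn (by fun_prop)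
  have hval : ∀ t : ℝ, 0 < t → ∫ s in (0 : ℝ)..t, κ (t - s) * Real.exp (σ * s) ≤
      Real.exp (σ * t) * laplace κ σ := by
    intro t ht
    have e1 := intervalIntegral.integral_comp_sub_left (a := 0) (b := t)
      (fun s => κ s * Real.exp (σ * (t - s))) t
    simp only [sub_sub_cancel, sub_self, sub_zero] at e1
    rw [e1, intervalIntegral.integral_of_le ht.le, laplace, ← integral_const_mul]
    have e2 : ∀ s, κ s * Real.exp (σ * (t - s)) = Real.exp (σ * t) * (Real.exp (-(σ * s)) * κ s) := by
      intro s
      rw [← mul_assoc, ← Real.exp_add, mul_comm]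
      congr 2; ring
    simp only [e2]
    refine setIntegral_mono_set ((hl σ hσ).const_mul _) ?_ Ioc_subset_Ioi_self.eventuallyLE
    exact (ae_restrict_iff' measurableSet_Ioi).2 (ae_of_all _ fun s hs =>
      mul_nonneg (Real.exp_pos _).le (mul_nonneg (Real.exp_pos _).le (hκ s hs)))
  have key : ∀ j : ℕ, ∀ t ∈ Ioc 0 T, |Q t| ≤ C * (1 / 2) ^ j * Real.exp (σ * t) := by
    intro j
    induction j with
    | zero =>
      intro t ht
      have := hC t ht
      have h1 : 1 ≤ Real.exp (σ * t) := Real.one_le_exp (mul_nonneg hσ.le ht.1.le)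
      nlinarith [abs_nonneg (Q t)]
    | succ j ih =>
      intro t ht
      have hA : 0 ≤ C * (1 / 2) ^ j := mul_nonneg ((abs_nonneg _).trans (hC t ht)) (by positivity)
      have h1 : |conv κ Q t| ≤ C * (1 / 2) ^ j * (Real.exp (σ * t) * laplace κ σ) := by
        refine le_trans ?_ (mul_le_mul_of_nonneg_left (hval t ht.1) hA)
        rw [← intervalIntegral.integral_const_mul, ← Real.norm_eq_abs, conv]
        refine intervalIntegral.norm_integral_le_of_norm_le ht.1.le ?_ ((hint t ht.1).const_mul _)
        have hne : ∀ᵐ s : ℝ, s ≠ t := by simp [ae_iff]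
        filter_upwards [hne] with s hs hs'
        have h2 : s < t := lt_of_le_of_ne hs'.2 hs
        rw [norm_mul, Real.norm_eq_abs, Real.norm_eq_abs, abs_of_nonneg (hκ _ (by linarith))]
        have h3 := mul_le_mul_of_nonneg_left (ih s ⟨hs'.1, h2.le.trans ht.2⟩)
          (hκ (t - s) (by linarith))
        linarith
      rw [heq t ht, abs_mul]
      have h4 := mul_le_mul_of_nonneg_left h1 (abs_nonneg b)
      have h5 := mul_le_mul_of_nonneg_right hn.le (mul_nonneg hA (Real.exp_pos (σ * t)).le)
      rw [pow_succ]
      linarith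
  intro t ht
  have h1 : Tendsto (fun j : ℕ => C * (1 / 2 : ℝ) ^ j * Real.exp (σ * t)) atTop (𝓝 0) := by
    have := ((tendsto_pow_atTop_nhds_zero_of_lt_one (r := (1 / 2 : ℝ)) (by norm_num)
      (by norm_num)).const_mul C).mul_const (Real.exp (σ * t))
    simpa using this
  exact abs_nonpos_iff.1 (ge_of_tendsto' h1 fun j => key j t ht)

/-! ### Extension to test functions of quadratic growth. -/

/-- Smooth functions with at most quadratic growth and a bounded second derivative. -/
structure QuadGrowth (f f₁ f₂ : ℝ → ℝ) : Prop where
  smooth : ContDiff ℝ ∞ f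
  deriv₁ : ∀ z, HasDerivAt f (f₁ z) z
  deriv₂ : ∀ z, HasDerivAt f₁ (f₂ z) z
  growth : ∃ K : ℝ, ∀ z, |f z| ≤ K * (1 + z ^ 2) ∧ |f₁ z| ≤ K * (1 + |z|) ∧ |f₂ z| ≤ K

/-- A cut-off function. -/
noncomputable def unitBump : ContDiffBump (0 : ℝ) := ⟨1, 2, one_pos, one_lt_two⟩

theorem isTest_unitBump : IsTest unitBump := ⟨unitBump.contDiff, unitBump.hasCompactSupport⟩

theorem unitBump_eq_one {z : ℝ} (hz : |z| ≤ 1) : unitBump z = 1 :=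
  unitBump.one_of_mem_closedBall (by simpa [unitBump] using hz)

theorem unitBump_eq_zero {z : ℝ} (hz : z ∉ tsupport unitBump) : unitBump z = 0 ∧
    deriv unitBump z = 0 ∧ deriv (deriv unitBump) z = 0 :=
  ⟨image_eq_zero_of_notMem_tsupport hz,
    image_eq_zero_of_notMem_tsupport fun h => hz (tsupport_deriv_subset h),
    image_eq_zero_of_notMem_tsupport fun h => hz (tsupport_deriv_subset (tsupport_deriv_subset h))⟩

theorem abs_le_of_mem_tsupport_unitBump {z : ℝ} (hz : z ∈ tsupport unitBump) : |z| ≤ 2 := by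
  rw [unitBump.tsupport_eq] at hz
  simpa [unitBump] using hz

/-- The restriction of `f` to `|z| ≤ 2 (N + 1)` by a cut-off function. -/
noncomputable def cutTest (f : ℝ → ℝ) (N : ℕ) (z : ℝ) : ℝ := f z * unitBump (z / (N + 1))

theorem abs_cutTest_le (f : ℝ → ℝ) (N : ℕ) (z : ℝ) : |cutTest f N z| ≤ |f z| := by
  rw [cutTest, abs_mul, abs_of_nonneg unitBump.nonneg]
  exact mul_le_of_le_one_right (abs_nonneg _) unitBump.le_one

theorem cutTest_zero (f : ℝ → ℝ) (N : ℕ) : cutTest f N 0 = f 0 := by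
  rw [cutTest, zero_div, unitBump_eq_one (by simp), mul_one]

theorem cutTest_eventuallyEq (f : ℝ → ℝ) {N : ℕ} {z : ℝ} (hz : |z| < N + 1) :
    cutTest f N =ᶠ[𝓝 z] f := by
  filter_upwards [(continuous_abs.continuousAt (x := z)).eventually_lt_const hz] with y hy
  have hN : (0 : ℝ) < N + 1 := by positivity
  rw [cutTest, unitBump_eq_one, mul_one]
  rw [abs_div, abs_of_pos hN, div_le_one hN]
  exact hy.le

section
variable {f f₁ f₂ : ℝ → ℝ} (h : QuadGrowth f f₁ f₂)
include h

theorem QuadGrowth.deriv_deriv : deriv (deriv f) = f₂ := by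
  rw [show deriv f = f₁ from funext fun z => (h.deriv₁ z).deriv]
  exact funext fun z => (h.deriv₂ z).deriv

theorem QuadGrowth.isTest (N : ℕ) : IsTest (cutTest f N) := by
  have hN : (N + 1 : ℝ) ≠ 0 := by positivity
  refine ⟨h.smooth.mul (unitBump.contDiff.comp (contDiff_id.div_const _)), ?_⟩
  have h1 := isTest_unitBump.2.comp_homeomorph (Homeomorph.mulRight₀ ((N : ℝ) + 1)⁻¹ (inv_ne_zero hN))
  exact h1.mul_left

theorem QuadGrowth.deriv_deriv_cutTest (N : ℕ) (z : ℝ) : deriv (deriv (cutTest f N)) z =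
    f₂ z * unitBump (z / (N + 1)) + 2 * f₁ z * (deriv unitBump (z / (N + 1)) / (N + 1)) +
      f z * (deriv (deriv unitBump) (z / (N + 1)) / (N + 1) ^ 2) := by
  have hd : ∀ z : ℝ, HasDerivAt (fun z : ℝ => z / ((N : ℝ) + 1)) (1 / ((N : ℝ) + 1)) z := fun z =>
    (hasDerivAt_id z).div_const _
  have b1 : ∀ z : ℝ, HasDerivAt (fun z : ℝ => unitBump (z / (N + 1)))
      (deriv unitBump (z / (N + 1)) * (1 / ((N : ℝ) + 1))) z := fun z =>
    (isTest_unitBump.hasDerivAt _).comp z (hd z)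
  have b2 : ∀ z : ℝ, HasDerivAt (fun z : ℝ => deriv unitBump (z / (N + 1)))
      (deriv (deriv unitBump) (z / (N + 1)) * (1 / ((N : ℝ) + 1))) z := fun z =>
    (isTest_unitBump.deriv.hasDerivAt _).comp z (hd z)
  have e1 : deriv (cutTest f N) = fun z => f₁ z * unitBump (z / (N + 1)) +
      f z * (deriv unitBump (z / (N + 1)) * (1 / ((N : ℝ) + 1))) :=
    funext fun z => ((h.deriv₁ z).mul (b1 z)).deriv
  rw [e1]
  refine (((h.deriv₂ z).mul (b1 z)).add ((h.deriv₁ z).mul ((b2 z).mul_const _))).deriv.trans ?_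
  have hN : (N + 1 : ℝ) ≠ 0 := by positivity
  field_simp
  ring

/-- Let `M = N + 1`. Where the cut-off is not zero, `|z| ≤ 2M`, so `f` is of size `M²` and `f₁` of
size `M`, which the factors `M⁻²` and `M⁻¹` from differentiating the cut-off compensate. -/
theorem QuadGrowth.exists_bound : ∃ B : ℝ, ∀ N z, |deriv (deriv (cutTest f N)) z| ≤ B := by
  obtain ⟨K, hK⟩ := h.growth
  have hK0 : 0 ≤ K := (abs_nonneg _).trans (hK 0).2.2
  obtain ⟨C₁, hC₁⟩ := isTest_unitBump.deriv.exists_bound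
  obtain ⟨C₂, hC₂⟩ := isTest_unitBump.deriv.deriv.exists_bound
  have hC₁0 : 0 ≤ C₁ := (abs_nonneg _).trans (hC₁ 0)
  have hC₂0 : 0 ≤ C₂ := (abs_nonneg _).trans (hC₂ 0)
  refine ⟨K + 6 * K * C₁ + 5 * K * C₂, fun N z => ?_⟩
  rw [h.deriv_deriv_cutTest]
  by_cases hz : z / (N + 1) ∈ tsupport unitBump
  · have hN : (1 : ℝ) ≤ N + 1 := by linarith [Nat.cast_nonneg (α := ℝ) N]
    set M : ℝ := N + 1
    have hM : 0 < M := by linarith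
    have hz' : |z| ≤ 2 * M := by
      have := abs_le_of_mem_tsupport_unitBump hz
      rwa [abs_div, abs_of_pos hM, div_le_iff₀ hM] at this
    have hz2 : z ^ 2 ≤ 4 * M ^ 2 := by
      rw [← sq_abs]
      nlinarith [abs_nonneg z]
    obtain ⟨k0, k1, k2⟩ := hK z
    have a1 : |f₂ z * unitBump (z / M)| ≤ K := by
      rw [abs_mul, abs_of_nonneg unitBump.nonneg]
      exact (mul_le_of_le_one_right (abs_nonneg _) unitBump.le_one).trans k2
    have a2 : |2 * f₁ z * (deriv unitBump (z / M) / M)| ≤ 6 * K * C₁ := by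
      rw [abs_mul, abs_mul, abs_two, abs_div, abs_of_pos hM]
      calc 2 * |f₁ z| * (|deriv unitBump (z / M)| / M) ≤ 2 * (K * (3 * M)) * (C₁ / M) := by
            gcongr
            · exact k1.trans (mul_le_mul_of_nonneg_left (by linarith) hK0)
            · exact hC₁ _
        _ = _ := by field_simp; ring
    have a3 : |f z * (deriv (deriv unitBump) (z / M) / M ^ 2)| ≤ 5 * K * C₂ := by
      rw [abs_mul, abs_div, abs_of_pos (by positivity : 0 < M ^ 2)]
      calc |f z| * (|deriv (deriv unitBump) (z / M)| / M ^ 2) ≤ (K * (5 * M ^ 2)) * (C₂ / M ^ 2) := by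
            gcongr
            · exact k0.trans (mul_le_mul_of_nonneg_left (by nlinarith) hK0)
            · exact hC₂ _
        _ = _ := by field_simp
    exact (abs_add_three _ _ _).trans (by linarith)
  · obtain ⟨e0, e1, e2⟩ := unitBump_eq_zero hz
    rw [e0, e1, e2]
    simp only [mul_zero, zero_div, add_zero, abs_zero]
    positivity

end

theorem tendsto_pairing_of_dominated {χ : ℕ → ℝ → ℝ} {f b : ℝ → ℝ} {W : ℝ → ℝ → ℝ} {t : ℝ}
    (hc : ∀ N, Continuous (χ N)) (hW : Integrable (W t)) (hb : Integrable fun z => b z * |W t z|)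
    (hχ : ∀ N z, |χ N z| ≤ b z) (hlim : ∀ z, Tendsto (fun N => χ N z) atTop (𝓝 (f z))) :
    Tendsto (fun N => pairing W (χ N) t) atTop (𝓝 (pairing W f t)) := by
  refine tendsto_integral_of_dominated_convergence _
    (fun N => (hc N).aestronglyMeasurable.mul hW.aestronglyMeasurable) hb
    (fun N => ae_of_all _ fun z => ?_) (ae_of_all _ fun z => (hlim z).mul_const _)
  rw [norm_mul, Real.norm_eq_abs, Real.norm_eq_abs]
  exact mul_le_mul_of_nonneg_right (hχ N z) (abs_nonneg _)

theorem eventually_abs_lt_natCast (z : ℝ) : ∀ᶠ N : ℕ in atTop, |z| < N + 1 := by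
  obtain ⟨n, hn⟩ := exists_nat_gt |z|
  filter_upwards [eventually_ge_atTop n] with N hN
  have : (n : ℝ) ≤ N := by exact_mod_cast hN
  linarith

theorem tendsto_cutTest (f : ℝ → ℝ) (z : ℝ) : Tendsto (fun N => cutTest f N z) atTop (𝓝 (f z)) := by
  refine tendsto_const_nhds.congr' ?_
  filter_upwards [eventually_abs_lt_natCast z] with N hN
  exact (cutTest_eventuallyEq f hN).eq_of_nhds.symm

section
variable {κ : ℝ → ℝ} {ν c : ℝ} {W : ℝ → ℝ → ℝ} (h : WeakVolterra κ ν c W)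
include h

theorem WeakVolterra.exists_abs_pairing_le (T : ℝ) (hT : 0 < T) : ∃ B : ℝ, ∀ (χ : ℝ → ℝ) (C : ℝ),
    (∀ z, |χ z| ≤ C) → ∀ t ∈ Ioc 0 T, |pairing W χ t| ≤ C * B := by
  obtain ⟨B, hB⟩ := h.bounded T hT
  refine ⟨B, fun χ C hC t ht => ?_⟩
  have h1 := norm_integral_le_of_norm_le ((h.integrable t ht.1).abs.const_mul C)
    (f := fun z => χ z * W t z) (ae_of_all _ fun z => by
      rw [norm_mul, Real.norm_eq_abs, Real.norm_eq_abs]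
      exact mul_le_mul_of_nonneg_right (hC z) (abs_nonneg _))
  rw [integral_const_mul] at h1
  exact h1.trans (mul_le_mul_of_nonneg_left (hB t ht) ((abs_nonneg _).trans (hC 0)))

/-- The right side of the Volterra equation involves only second derivatives, which are uniformly
bounded. So the limit exists before `f * W t` is known to be integrable, and this will yield the
finite second moment. -/
theorem WeakVolterra.tendsto_pairing_cutTest {f f₁ f₂ : ℝ → ℝ} (hf : QuadGrowth f f₁ f₂) {t : ℝ}
    (ht : 0 < t) : Tendsto (fun N => pairing W (cutTest f N) t) atTop
      (𝓝 (c * f 0 + ν * conv κ (pairing W f₂) t)) := by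
  obtain ⟨K, hK⟩ := hf.exists_bound
  obtain ⟨B, hB⟩ := h.exists_abs_pairing_le t ht
  have htest := fun N => (hf.isTest N).deriv.deriv
  have h1 : Tendsto (fun N => conv κ (pairing W (deriv (deriv (cutTest f N)))) t) atTop
      (𝓝 (conv κ (pairing W f₂) t)) := by
    have hd : ∀ N, Dom (pairing W (deriv (deriv (cutTest f N)))) := fun N => by
      refine Dom.of_bounded (h.continuousOn _ (htest N)) fun T hT => ?_
      obtain ⟨B, hB⟩ := h.exists_abs_pairing_le T hT
      exact ⟨K * B, hB _ K (hK N)⟩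
    refine intervalIntegral.tendsto_integral_filter_of_dominated_convergence
      (fun s => |κ (t - s)| * (K * B)) (Eventually.of_forall fun N => ?_)
      (Eventually.of_forall fun N => ae_of_all _ fun s hs => ?_) ?_ (ae_of_all _ fun s hs => ?_)
    · have := (h.dom.intervalIntegrable_mul (hd N) ht).aestronglyMeasurable
      rwa [uIoc_of_le ht.le]
    · rw [uIoc_of_le ht.le] at hs
      rw [norm_mul, Real.norm_eq_abs, Real.norm_eq_abs]
      exact mul_le_mul_of_nonneg_left (hB _ K (hK N) s hs) (abs_nonneg _)
    · exact (h.dom.locInt.intervalIntegrable_sub ht).abs.mul_const _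
    · rw [uIoc_of_le ht.le] at hs
      refine Tendsto.const_mul _ ?_
      refine tendsto_pairing_of_dominated (b := fun _ => K) (fun N => (htest N).continuous)
        (h.integrable s hs.1) ((h.integrable s hs.1).abs.const_mul K) hK fun z => ?_
      refine tendsto_const_nhds.congr' ?_
      filter_upwards [eventually_abs_lt_natCast z] with N hN
      rw [(cutTest_eventuallyEq f hN).deriv.deriv_eq, hf.deriv_deriv]
  refine ((h1.const_mul ν).const_add (c * f 0)).congr fun N => ?_
  rw [← h.eq _ (hf.isTest N) t ht, cutTest_zero]
  ring

theorem WeakVolterra.pairing_eq {f f₁ f₂ : ℝ → ℝ} (hf : QuadGrowth f f₁ f₂) {t : ℝ} (ht : 0 < t)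
    (hi : Integrable fun z => |f z| * |W t z|) :
    pairing W f t = c * f 0 + ν * conv κ (pairing W f₂) t :=
  tendsto_nhds_unique (tendsto_pairing_of_dominated (fun N => (hf.isTest N).continuous)
    (h.integrable t ht) hi (abs_cutTest_le f) (tendsto_cutTest f)) (h.tendsto_pairing_cutTest hf ht)

theorem WeakVolterra.integrable_mul {f : ℝ → ℝ} (hc : Continuous f) {K : ℝ} (hK : ∀ z, |f z| ≤ K)
    {t : ℝ} (ht : 0 < t) : Integrable fun z => |f z| * |W t z| :=
  (h.integrable t ht).abs.bdd_mul hc.abs.aestronglyMeasurable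
    (ae_of_all _ fun z => by simpa using hK z)

/-- For an eigenfunction of the second derivative the equation closes into a scalar homogeneous
Volterra equation. -/
theorem WeakVolterra.pairing_eq_zero {f f₁ f₂ : ℝ → ℝ} (hf : QuadGrowth f f₁ f₂) {K b : ℝ}
    (hK : ∀ z, |f z| ≤ K) (hb : ∀ z, f₂ z = b * f z) (h0 : c * f 0 = 0) {t : ℝ} (ht : 0 < t) :
    pairing W f t = 0 := by
  refine volterra_unique (b := ν * b) h.kernel_nonneg h.la ?_ (fun s hs => ?_) t ⟨ht, le_rfl⟩
  · obtain ⟨B, hB⟩ := h.exists_abs_pairing_le t ht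
    exact ⟨_, hB f K hK⟩
  · rw [h.pairing_eq hf hs.1 (h.integrable_mul hf.smooth.continuous hK hs.1), h0, zero_add,
      mul_assoc, ← conv_const_mul κ _ b]
    refine congrArg (ν * ·) (congrArg (conv κ · s) (funext fun u => ?_))
    rw [pairing, pairing, ← integral_const_mul]
    refine congrArg _ (funext fun z => ?_)
    rw [hb]; ring

theorem WeakVolterra.integral_eq {t : ℝ} (ht : 0 < t) : ∫ z, W t z = c := by
  have hq : QuadGrowth (fun _ => 1) (fun _ => 0) fun _ => 0 :=
    ⟨contDiff_const, fun z => hasDerivAt_const z _, fun z => hasDerivAt_const z _, 1, fun z =>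
      ⟨by simpa using sq_nonneg z, by simpa using by positivity, by simp⟩⟩
  have h1 := h.pairing_eq hq ht (h.integrable_mul continuous_const (K := 1) (by simp) ht)
  simpa [pairing, conv] using h1

end

/-! ### Uniqueness by Fourier transform. -/

theorem quadGrowth_cos (ξ : ℝ) : QuadGrowth (fun z => Real.cos (ξ * z))
    (fun z => -Real.sin (ξ * z) * ξ) fun z => -ξ ^ 2 * Real.cos (ξ * z) := by
  have hd : ∀ z : ℝ, HasDerivAt (fun z => ξ * z) ξ z := fun z => by
    simpa using (hasDerivAt_id z).const_mul ξ
  refine ⟨by fun_prop, fun z => (hd z).cos, fun z => ?_, 1 + |ξ| + ξ ^ 2, fun z => ?_⟩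
  · refine ((hd z).sin.neg.mul_const ξ).congr_deriv ?_
    ring
  · have h1 := Real.abs_cos_le_one (ξ * z)
    have h2 := Real.abs_sin_le_one (ξ * z)
    have h3 : 0 ≤ |ξ| := abs_nonneg ξ
    have h4 := sq_nonneg ξ
    have h5 := sq_nonneg z
    have h6 := abs_nonneg z
    refine ⟨by nlinarith, ?_, ?_⟩
    · rw [abs_mul, abs_neg]
      nlinarith [mul_le_mul_of_nonneg_right h2 h3]
    · rw [abs_mul, abs_neg, abs_of_nonneg h4]
      nlinarith

theorem quadGrowth_sin (ξ : ℝ) : QuadGrowth (fun z => Real.sin (ξ * z))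
    (fun z => Real.cos (ξ * z) * ξ) fun z => -ξ ^ 2 * Real.sin (ξ * z) := by
  have hd : ∀ z : ℝ, HasDerivAt (fun z => ξ * z) ξ z := fun z => by
    simpa using (hasDerivAt_id z).const_mul ξ
  refine ⟨by fun_prop, fun z => (hd z).sin, fun z => ?_, 1 + |ξ| + ξ ^ 2, fun z => ?_⟩
  · refine ((hd z).cos.mul_const ξ).congr_deriv ?_
    ring
  · have h1 := Real.abs_sin_le_one (ξ * z)
    have h2 := Real.abs_cos_le_one (ξ * z)
    have h3 : 0 ≤ |ξ| := abs_nonneg ξ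
    have h4 := sq_nonneg ξ
    have h5 := sq_nonneg z
    have h6 := abs_nonneg z
    refine ⟨by nlinarith, ?_, ?_⟩
    · rw [abs_mul]
      nlinarith [mul_le_mul_of_nonneg_right h2 h3]
    · rw [abs_mul, abs_neg, abs_of_nonneg h4]
      nlinarith

/-- An integrable function whose Fourier transform vanishes is zero. -/
theorem ae_eq_zero_of_fourier {f : ℝ → ℝ} (hf : Integrable f)
    (hc : ∀ ξ : ℝ, ∫ z, Real.cos (ξ * z) * f z = 0) (hs : ∀ ξ : ℝ, ∫ z, Real.sin (ξ * z) * f z = 0) :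
    f =ᵐ[volume] 0 := by
  have e : ∀ ξ : ℝ, ∫ z : ℝ, Complex.exp (ξ * z * Complex.I) * (f z : ℂ) = 0 := by
    intro ξ
    have hi : Integrable fun z : ℝ => Complex.exp (ξ * z * Complex.I) * (f z : ℂ) := by
      refine hf.ofReal.bdd_mul (c := 1) (by fun_prop) (ae_of_all _ fun z => ?_)
      rw [← Complex.ofReal_mul, Complex.norm_exp_ofReal_mul_I]
    apply Complex.ext
    · refine (integral_re hi).symm.trans (Eq.trans (congrArg _ (funext fun z => ?_)) (hc ξ))
      simp [← Complex.ofReal_mul, Complex.exp_ofReal_mul_I_re]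
    · refine (integral_im hi).symm.trans (Eq.trans (congrArg _ (funext fun z => ?_)) (hs ξ))
      simp [← Complex.ofReal_mul, Complex.exp_ofReal_mul_I_im]
  have hfin : ∀ {g : ℝ → ℝ}, Integrable g →
      IsFiniteMeasure (volume.withDensity fun z => ENNReal.ofReal (g z)) := fun hg =>
    isFiniteMeasure_withDensity_ofReal hg.2
  have := hfin hf
  have := hfin hf.neg
  have hpos : ∀ {g : ℝ → ℝ}, Integrable g → ∀ ξ : ℝ,
      charFun (volume.withDensity fun z => ENNReal.ofReal (g z)) ξ =
        ∫ z : ℝ, Complex.exp (ξ * z * Complex.I) * (max (g z) 0 : ℝ) := by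
    intro g hg ξ
    rw [charFun_apply_real, integral_withDensity_eq_integral_toReal_smul₀
      hg.aestronglyMeasurable.aemeasurable.ennreal_ofReal (by simp)]
    congr 1; ext z
    rw [ENNReal.toReal_ofReal', Complex.real_smul, mul_comm]
  -- The densities are the positive and the negative part of `f`. Both measures are finite, and the
  -- vanishing Fourier transform of `f` makes their characteristic functions equal.
  have hm : (volume.withDensity fun z => ENNReal.ofReal (f z)) =
      volume.withDensity fun z => ENNReal.ofReal ((-f) z) := by
    refine Measure.ext_of_charFun (funext fun ξ => ?_)
    rw [hpos hf, hpos hf.neg, ← sub_eq_zero, ← integral_sub, ← e ξ]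
    · congr 1; ext z
      rw [← mul_sub, ← Complex.ofReal_sub]
      congr 2
      simp only [Pi.neg_apply]
      rcases le_total 0 (f z) with h | h
      · rw [max_eq_left h, max_eq_right (by linarith), sub_zero]
      · rw [max_eq_right h, max_eq_left (by linarith)]; ring
    · refine hf.pos_part.ofReal.bdd_mul (c := 1) (by fun_prop) (ae_of_all _ fun z => ?_)
      rw [← Complex.ofReal_mul, Complex.norm_exp_ofReal_mul_I]
    · refine hf.neg.pos_part.ofReal.bdd_mul (c := 1) (by fun_prop) (ae_of_all _ fun z => ?_)
      rw [← Complex.ofReal_mul, Complex.norm_exp_ofReal_mul_I]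
  have h1 := (withDensity_eq_iff hf.aestronglyMeasurable.aemeasurable.ennreal_ofReal
    hf.neg.aestronglyMeasurable.aemeasurable.ennreal_ofReal
    hf.lintegral_lt_top.ne).1 hm
  filter_upwards [h1] with z hz
  simp only [Pi.neg_apply] at hz
  rcases lt_trichotomy (f z) 0 with h | h | h
  · rw [ENNReal.ofReal_of_nonpos h.le] at hz
    have := ENNReal.ofReal_eq_zero.1 hz.symm
    linarith
  · exact h
  · rw [ENNReal.ofReal_of_nonpos (p := -f z) (by linarith)] at hz
    have := ENNReal.ofReal_eq_zero.1 hz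
    linarith

theorem WeakVolterra.ae_eq_zero {κ : ℝ → ℝ} {ν : ℝ} {W : ℝ → ℝ → ℝ} (h : WeakVolterra κ ν 0 W) {t : ℝ}
    (ht : 0 < t) : W t =ᵐ[volume] 0 :=
  ae_eq_zero_of_fourier (h.integrable t ht)
    (fun ξ => h.pairing_eq_zero (quadGrowth_cos ξ) (K := 1) (fun _ => Real.abs_cos_le_one _)
      (fun _ => rfl) (zero_mul _) ht)
    fun ξ => h.pairing_eq_zero (quadGrowth_sin ξ) (K := 1) (fun _ => Real.abs_sin_le_one _)
      (fun _ => rfl) (zero_mul _) ht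

/-! ### Moments of the solution. -/

theorem quadGrowth_sq : QuadGrowth (fun z => z ^ 2) (fun z => 2 * z) fun _ => 2 := by
  refine ⟨by fun_prop, fun z => by simpa using hasDerivAt_pow 2 z,
    fun z => by simpa using (hasDerivAt_id z).const_mul 2, 2, fun z => ⟨?_, ?_, ?_⟩⟩
  · rw [abs_of_nonneg (sq_nonneg z)]; nlinarith [sq_nonneg z]
  · rw [abs_mul, abs_two]; linarith
  · simp

theorem quadGrowth_id : QuadGrowth (fun z => z) (fun _ => 1) fun _ => 0 := by
  refine ⟨by fun_prop, fun z => hasDerivAt_id z, fun z => hasDerivAt_const z _, 1, fun z =>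
    ⟨?_, ?_, ?_⟩⟩
  · rw [abs_le]; constructor <;> nlinarith [sq_nonneg (z - 1), sq_nonneg (z + 1)]
  · simp
  · simp

section
variable {κ : ℝ → ℝ} {ν c : ℝ} {W : ℝ → ℝ → ℝ} (h : WeakVolterra κ ν c W)
include h

/-- Fatou's lemma along the cut-offs of `z²`: the integrands are nonnegative and their integrals
converge to a finite limit. -/
theorem WeakVolterra.integrable_sq {t : ℝ} (ht : 0 < t) (h0 : ∀ᵐ z, 0 ≤ W t z) :
    Integrable fun z => z ^ 2 * W t z := by
  have hlim := h.tendsto_pairing_cutTest quadGrowth_sq ht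
  have hi : ∀ N, Integrable fun z => cutTest (fun z => z ^ 2) N z * W t z := by
    intro N
    have hq := quadGrowth_sq.isTest N
    obtain ⟨C, hC⟩ := hq.exists_bound
    exact (h.integrable t ht).bdd_mul hq.continuous.aestronglyMeasurable (ae_of_all _ hC)
  have hp : ∀ N, 0 ≤ᵐ[volume] fun z => cutTest (fun z => z ^ 2) N z * W t z := by
    intro N
    filter_upwards [h0] with z hz
    exact mul_nonneg (mul_nonneg (sq_nonneg z) unitBump.nonneg) hz
  have hm : AEStronglyMeasurable (fun z => z ^ 2 * W t z) :=
    (by fun_prop : Continuous fun z : ℝ => z ^ 2).aestronglyMeasurable.mul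
      (h.integrable t ht).aestronglyMeasurable
  refine ⟨hm, ?_⟩
  rw [hasFiniteIntegral_iff_ofReal (by filter_upwards [h0] with z hz using mul_nonneg (sq_nonneg z) hz)]
  have h2 : Tendsto (fun N => ENNReal.ofReal (pairing W (cutTest (fun z => z ^ 2) N) t)) atTop _ :=
    (ENNReal.continuous_ofReal.tendsto _).comp hlim
  refine lt_of_le_of_lt ?_ (ENNReal.ofReal_lt_top (r := c * 0 ^ 2 + ν * conv κ (pairing W fun _ => 2) t))
  rw [← h2.liminf_eq]
  simp only [pairing, fun N => ofReal_integral_eq_lintegral_ofReal (hi N) (hp N)]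
  refine le_trans (le_of_eq (lintegral_congr fun z => ?_))
    (lintegral_liminf_le' fun N => (hi N).aestronglyMeasurable.aemeasurable.ennreal_ofReal)
  exact ((ENNReal.continuous_ofReal.tendsto _).comp
    ((tendsto_cutTest (fun z => z ^ 2) z).mul_const _)).liminf_eq.symm

theorem WeakVolterra.integral_sq {t : ℝ} (ht : 0 < t) (h0 : ∀ᵐ z, 0 ≤ W t z) :
    ∫ z, z ^ 2 * W t z = 2 * ν * c * ∫ s in (0 : ℝ)..t, κ s := by
  have h1 := h.pairing_eq quadGrowth_sq ht
    ((h.integrable_sq ht h0).abs.congr (ae_of_all _ fun z => abs_mul _ _))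
  have h2 : conv κ (pairing W fun _ => 2) t = conv κ (fun _ => 2 * c * 1) t := by
    refine conv_congr (fun _ _ => rfl) (fun s hs => ?_) ht
    rw [pairing, integral_const_mul, h.integral_eq hs.1, mul_one]
  rw [h2, conv_const_mul, conv_comm, conv_one] at h1
  rw [pairing] at h1
  rw [h1]; ring

theorem WeakVolterra.integral_id {t : ℝ} (ht : 0 < t) (h0 : ∀ᵐ z, 0 ≤ W t z) :
    ∫ z, z * W t z = 0 := by
  have hi : Integrable fun z => |z| * |W t z| := by
    refine Integrable.mono' ((h.integrable t ht).abs.add (h.integrable_sq ht h0).abs)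
      (continuous_abs.aestronglyMeasurable.mul (h.integrable t ht).aestronglyMeasurable.norm)
      (ae_of_all _ fun z => ?_)
    simp only [Pi.add_apply, norm_mul, Real.norm_eq_abs, abs_abs, abs_mul, abs_pow]
    nlinarith [abs_nonneg (W t z), sq_nonneg (|z| - 1), mul_nonneg (abs_nonneg (W t z))
      (sq_nonneg (|z| - 1)), mul_nonneg (abs_nonneg (W t z)) (abs_nonneg z)]
  have h1 := h.pairing_eq quadGrowth_id ht hi
  simpa [pairing, conv] using h1

end

theorem IsFundamentalSolution.ae_eq {η ν : ℝ} {g k l r : ℝ → ℝ} {U V : ℝ → ℝ → ℝ}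
    (hU : IsFundamentalSolution k η ν U) (hV : IsFundamentalSolution k η ν V)
    (hk : KernelTriple η g k l r) {t : ℝ} (ht : 0 < t) : U t =ᵐ[volume] V t := by
  have h1 := (hU.weakVolterra hk).sub (hV.weakVolterra hk)
  rw [sub_self] at h1
  filter_upwards [h1.ae_eq_zero ht] with z hz
  exact sub_eq_zero.1 hz

/-- The moments of a random variable whose density solves the weak Volterra equation. -/
theorem WeakVolterra.variance_eq {κ : ℝ → ℝ} {ν : ℝ} {W : ℝ → ℝ → ℝ} (h : WeakVolterra κ ν 1 W)
    {t : ℝ} (ht : 0 < t) (h0 : ∀ᵐ z, 0 ≤ W t z) {Ω : Type*} [MeasurableSpace Ω] {P : Measure Ω}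
    [IsProbabilityMeasure P] {Y : Ω → ℝ} (hY : HasDensity P Y (W t)) :
    MemLp Y 2 P ∧ variance Y P = 2 * ν * ∫ s in (0 : ℝ)..t, κ s := by
  obtain ⟨hm, hd⟩ := hY
  have hmeas := (h.integrable t ht).aestronglyMeasurable.aemeasurable.ennreal_ofReal
  have hval : ∀ f : ℝ → ℝ, Continuous f → ∫ o, f (Y o) ∂P = ∫ z, f z * W t z := by
    intro f hf
    rw [← integral_map hm hf.aestronglyMeasurable, hd,
      integral_withDensity_eq_integral_toReal_smul₀ hmeas (by simp)]
    refine integral_congr_ae ?_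
    filter_upwards [h0] with z hz
    rw [ENNReal.toReal_ofReal hz, smul_eq_mul, mul_comm]
  have hint : Integrable (fun o => Y o ^ 2) P := by
    have hc : Continuous fun z : ℝ => z ^ 2 := by fun_prop
    refine (integrable_map_measure (f := Y) (g := fun z : ℝ => z ^ 2) hc.aestronglyMeasurable hm).1 ?_
    rw [hd, integrable_withDensity_iff_integrable_smul₀' hmeas (by simp)]
    refine (h.integrable_sq ht h0).congr ?_
    filter_upwards [h0] with z hz
    rw [ENNReal.toReal_ofReal hz, smul_eq_mul, mul_comm]
  have hL := (memLp_two_iff_integrable_sq hm.aestronglyMeasurable).2 hint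
  refine ⟨hL, ?_⟩
  rw [variance_eq_sub hL]
  have e1 := hval (fun z => z ^ 2) (by fun_prop)
  have e2 := hval (fun z => z) continuous_id
  simp only [Pi.pow_apply]
  rw [e1, e2, h.integral_sq ht h0, h.integral_id ht h0]
  ring

/-! ### Tauberian estimates for Stieltjes functions. -/

theorem abs_integral_le_of_le {f g : ℝ → ℝ} (hg : Integrable g) (h : ∀ x, |f x| ≤ g x) :
    |∫ x, f x| ≤ ∫ x, g x :=
  norm_integral_le_of_norm_le (f := f) hg (ae_of_all _ h)

/-- Up to an explicit factor this is the difference between `exp(-u)` and `1/(1 + u)`, that is,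
between a function at `t` and its transform at `1/t` when `u = t exp x`. The comparison function
`u/(2 + u)` arises from the transforms at `1/t` and `2/t`. -/
theorem exp_kernel_bounds {u : ℝ} (hu : 0 ≤ u) : 0 ≤ 1 - (1 + u) * Real.exp (-u) ∧
    1 - (1 + u) * Real.exp (-u) ≤ u ^ 2 ∧ 1 - (1 + u) * Real.exp (-u) ≤ 1 ∧
    1 - (1 + u) * Real.exp (-u) ≤ 3 * (u / (2 + u)) := by
  have h1 := Real.add_one_le_exp u
  have h2 := Real.add_one_le_exp (-u)
  have h3 := Real.exp_pos (-u)
  have h4 : Real.exp u * Real.exp (-u) = 1 := by rw [← Real.exp_add]; simp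
  have h5 : (1 + u) * Real.exp (-u) ≤ 1 := by nlinarith
  have h6 : 1 - (1 + u) * Real.exp (-u) ≤ u ^ 2 := by nlinarith
  have h7 : 1 - (1 + u) * Real.exp (-u) ≤ 1 := by nlinarith [mul_nonneg (by linarith : 0 ≤ 1 + u) h3.le]
  refine ⟨by linarith, h6, h7, ?_⟩
  rw [mul_div_assoc', le_div_iff₀ (by linarith)]
  rcases le_total u 1 with h | h
  · nlinarith
  · nlinarith

/-- Functions on the half-line with a Stieltjes representation of the Laplace transform `F`. -/
structure StieltjesRep (f F w : ℝ → ℝ) : Prop where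
  dens : SDens w
  nonneg : ∀ x, 0 ≤ w x
  eq : ∀ t : ℝ, 0 < t → f t = sFun w t
  laplace : ∀ x : ℝ, 0 < x → laplace f x = F x

section
variable {f F w : ℝ → ℝ} (h : StieltjesRep f F w)
include h

theorem StieltjesRep.transform {x : ℝ} (hx : 0 < x) : F x = ∫ y, w y / (Real.exp y + x) := by
  rw [← h.dens.laplace_eq hx, ← h.laplace x hx]
  exact laplace_congr h.eq x

/-- The kernels are compared pointwise and integrated against the nonnegative density. If `x F(x)`
varies slowly at infinity, the right side is negligible as `t → 0`. -/
theorem StieltjesRep.abs_sub_le {t : ℝ} (ht : 0 < t) :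
    |f t - 1 / t * F (1 / t)| ≤ 3 * (2 / t * F (2 / t) - 1 / t * F (1 / t)) := by
  have h1 : 0 < 1 / t := by positivity
  have h2 : 0 < 2 / t := by positivity
  have i0 := h.dens.integrable_exp 0 ht
  have i1 := (h.dens.integrable_div h1).const_mul (1 / t)
  have i2 := (h.dens.integrable_div h2).const_mul (2 / t)
  simp only [pow_zero, one_mul] at i0
  rw [h.eq t ht, h.transform h1, h.transform h2, sFun, ← integral_const_mul, ← integral_const_mul,
    ← integral_sub i0 i1, ← integral_sub i2 i1, ← integral_const_mul]
  refine abs_integral_le_of_le ((i2.sub i1).const_mul 3) fun x => ?_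
  have hw := h.nonneg x
  have hy := Real.exp_pos x
  set y := Real.exp x
  have hu : 0 < t * y := by positivity
  obtain ⟨b0, -, -, b3⟩ := exp_kernel_bounds hu.le
  have e1 : Real.exp (-(t * y)) * w x - 1 / t * (w x / (y + 1 / t)) =
      -(w x / (1 + t * y) * (1 - (1 + t * y) * Real.exp (-(t * y)))) := by
    field_simp
    ring
  have e2 : 3 * (2 / t * (w x / (y + 2 / t)) - 1 / t * (w x / (y + 1 / t))) =
      w x / (1 + t * y) * (3 * (t * y / (2 + t * y))) := by
    field_simp
    ring
  rw [e1, e2, abs_neg, abs_of_nonneg (mul_nonneg (by positivity) b0)]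
  exact mul_le_mul_of_nonneg_left b3 (by positivity)

theorem StieltjesRep.integral_eq {t : ℝ} (ht : 0 < t) : ∫ s in (0 : ℝ)..t, f s =
    ∫ x, (1 - Real.exp (-(t * Real.exp x))) / Real.exp x * w x := by
  have h1 := (h.dens.laplace_aux one_pos).mono_measure
    (Measure.prod_mono (Measure.restrict_mono_set volume
      (Ioc_subset_Ioi_self : Ioc 0 t ⊆ Ioi 0)) le_rfl)
  have h2 : Integrable (Function.uncurry fun (s x : ℝ) => Real.exp (-(s * Real.exp x)) * w x)
      ((volume.restrict (Ioc 0 t)).prod volume) := by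
    have hb : Integrable (fun p : ℝ × ℝ => Real.exp (min p.1 t) *
        Function.uncurry (fun (s x : ℝ) => Real.exp (-(1 * s)) *
          (Real.exp (-(s * Real.exp x)) * w x)) p) ((volume.restrict (Ioc 0 t)).prod volume) := by
      refine h1.bdd_mul (c := Real.exp t) (by fun_prop) (ae_of_all _ fun p => ?_)
      rw [Real.norm_eq_abs, abs_of_pos (Real.exp_pos _)]
      exact Real.exp_le_exp.2 (min_le_right _ _)
    refine hb.congr ?_
    have : ∀ᵐ p : ℝ × ℝ ∂((volume.restrict (Ioc 0 t)).prod volume), p.1 ∈ Ioc 0 t := by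
      have := (Measure.quasiMeasurePreserving_fst (μ := volume.restrict (Ioc 0 t))
        (ν := (volume : Measure ℝ))).ae (ae_restrict_mem measurableSet_Ioc)
      exact this
    filter_upwards [this] with p hp
    simp only [Function.uncurry]
    rw [min_eq_left hp.2, ← mul_assoc, ← Real.exp_add, one_mul, add_neg_cancel, Real.exp_zero,
      one_mul]
  rw [intervalIntegral.integral_of_le ht.le]
  rw [setIntegral_congr_fun measurableSet_Ioc fun s hs => h.eq s hs.1]
  refine (integral_integral_swap h2).trans (integral_congr_ae (ae_of_all _ fun x => ?_))
  simp only
  rw [integral_mul_const, ← intervalIntegral.integral_of_le ht.le]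
  congr 1
  have hy := Real.exp_pos x
  have e : ∀ s : ℝ, -(s * Real.exp x) = -Real.exp x * s := fun s => by ring
  simp only [e]
  rw [intervalIntegral.integral_comp_mul_left (fun s => Real.exp s) (neg_ne_zero.2 hy.ne'),
    integral_exp, mul_zero, Real.exp_zero, smul_eq_mul]
  field_simp
  ring

theorem StieltjesRep.integral_sub_eq {t : ℝ} (ht : 0 < t) : (∫ s in (0 : ℝ)..t, f s) - F (1 / t) =
    ∫ x, (1 - (1 + t * Real.exp x) * Real.exp (-(t * Real.exp x))) /
      (Real.exp x * (1 + t * Real.exp x)) * w x ∧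
    Integrable fun x => (1 - (1 + t * Real.exp x) * Real.exp (-(t * Real.exp x))) /
      (Real.exp x * (1 + t * Real.exp x)) * w x := by
  have h1 : 0 < 1 / t := by positivity
  have i1 := h.dens.integrable_div h1
  have hp : ∀ x : ℝ, 0 < Real.exp x * (1 + t * Real.exp x) := fun x => by positivity
  have i0 : Integrable fun x => (1 - (1 + t * Real.exp x) * Real.exp (-(t * Real.exp x))) /
      (Real.exp x * (1 + t * Real.exp x)) * w x := by
    refine Integrable.mono' (i1.const_mul 3) ?_ (ae_of_all _ fun x => ?_)
    · have hw := h.dens.cont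
      exact (Continuous.mul (Continuous.div (by fun_prop) (by fun_prop) fun x => (hp x).ne')
        hw).aestronglyMeasurable
    · have hw := h.nonneg x
      have hy := Real.exp_pos x
      set y := Real.exp x
      have hu : 0 < t * y := by positivity
      obtain ⟨b0, -, -, b3⟩ := exp_kernel_bounds hu.le
      rw [Real.norm_eq_abs, abs_of_nonneg (mul_nonneg (div_nonneg b0 (by positivity)) hw)]
      have e : 3 * (w x / (y + 1 / t)) = 3 * (t * y) / (y * (1 + t * y)) * w x := by
        field_simp
        ring
      rw [e]
      refine mul_le_mul_of_nonneg_right (div_le_div_of_nonneg_right (b3.trans ?_)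
        (by positivity)) hw
      have : t * y / (2 + t * y) ≤ t * y := div_le_self hu.le (by linarith)
      linarith
  refine ⟨?_, i0⟩
  have e : ∀ x, (1 - Real.exp (-(t * Real.exp x))) / Real.exp x * w x =
      (1 - (1 + t * Real.exp x) * Real.exp (-(t * Real.exp x))) /
      (Real.exp x * (1 + t * Real.exp x)) * w x + w x / (Real.exp x + 1 / t) := by
    intro x
    have hy := Real.exp_pos x
    field_simp
    ring
  rw [h.integral_eq ht, h.transform h1]
  simp only [e]
  rw [integral_add i0 i1, add_sub_cancel_right]

/-- The first bound is for large times, when `F` varies slowly at zero; the second is for small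
times, when `x F(x)` varies slowly at infinity. -/
theorem StieltjesRep.abs_integral_sub_le {t : ℝ} (ht : 0 < t) :
    |(∫ s in (0 : ℝ)..t, f s) - F (1 / t)| ≤ 3 * (F (1 / t) - F (2 / t)) ∧
    |(∫ s in (0 : ℝ)..t, f s) - F (1 / t)| ≤ 3 * (2 * F (2 / t) - F (1 / t)) := by
  have h1 : 0 < 1 / t := by positivity
  have h2 : 0 < 2 / t := by positivity
  have i1 := h.dens.integrable_div h1
  have i2 := h.dens.integrable_div h2
  rw [(h.integral_sub_eq ht).1, h.transform h1, h.transform h2]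
  constructor
  · rw [← integral_sub i1 i2, ← integral_const_mul]
    refine abs_integral_le_of_le ((i1.sub i2).const_mul 3) fun x => ?_
    have hw := h.nonneg x
    have hy := Real.exp_pos x
    set y := Real.exp x
    have hu : 0 < t * y := by positivity
    obtain ⟨b0, -, -, b3⟩ := exp_kernel_bounds hu.le
    rw [abs_of_nonneg (mul_nonneg (div_nonneg b0 (by positivity)) hw)]
    have e : 3 * (w x / (y + 1 / t) - w x / (y + 2 / t)) =
        3 * (t * y / (2 + t * y)) / (y * (1 + t * y)) * w x := by
      field_simp
      ring
    rw [e]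
    exact mul_le_mul_of_nonneg_right (div_le_div_of_nonneg_right b3 (by positivity)) hw
  · rw [← integral_const_mul, ← integral_sub (i2.const_mul 2) i1, ← integral_const_mul]
    refine abs_integral_le_of_le (((i2.const_mul 2).sub i1).const_mul 3) fun x => ?_
    have hw := h.nonneg x
    have hy := Real.exp_pos x
    set y := Real.exp x
    have hu : 0 < t * y := by positivity
    obtain ⟨b0, b1, b2, b3⟩ := exp_kernel_bounds hu.le
    rw [abs_of_nonneg (mul_nonneg (div_nonneg b0 (by positivity)) hw)]
    have e : 3 * (2 * (w x / (y + 2 / t)) - w x / (y + 1 / t)) =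
        3 * (t * y * (t * y) / (2 + t * y)) / (y * (1 + t * y)) * w x := by
      field_simp
      ring
    rw [e]
    refine mul_le_mul_of_nonneg_right (div_le_div_of_nonneg_right ?_ (by positivity)) hw
    rw [mul_div_assoc', le_div_iff₀ (by linarith)]
    rcases le_total (t * y) 1 with hc | hc <;> nlinarith

end

/-! ### Bounds for convolutions of monotone kernels. -/

/-- Chebyshev's inequality for the convolution of nonincreasing functions. -/
theorem Kern.mul_conv_le {f g : ℝ → ℝ} (hf : Kern f) (hfc : ContinuousOn f (Ioi 0)) (hg : Kern g)
    {t : ℝ} (ht : 0 < t) :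
    t * conv g f t ≤ (∫ s in (0 : ℝ)..t, g s) * ∫ s in (0 : ℝ)..t, f s := by
  set m := ⨍ s in Ioo 0 t, f s with hm
  have hv : volume (Ioo 0 t) = ENNReal.ofReal t := by simp
  have hv0 : volume (Ioo 0 t) ≠ 0 := by rw [hv]; simpa using ht
  have hvt : volume (Ioo 0 t) ≠ ⊤ := by rw [hv]; simp
  have hi : IntegrableOn f (Ioo 0 t) := (hf.locInt t ht).mono_set Ioo_subset_Ioc_self
  have hmv : t * m = ∫ s in (0 : ℝ)..t, f s := by
    rw [hm, setAverage_eq, intervalIntegral.integral_of_le ht.le, integral_Ioc_eq_integral_Ioo]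
    simp [Measure.real, ht.le]
    field_simp
  obtain ⟨a, ha, hfa⟩ := exists_le_setAverage hv0 hvt hi
  obtain ⟨b, hb, hfb⟩ := exists_setAverage_le hv0 hvt hi
  obtain ⟨p, hp, hfp⟩ := isPreconnected_Ioo.intermediate_value ha hb
    (hfc.mono Ioo_subset_Ioi_self) ⟨hfa, hfb⟩
  have i1 := hg.intervalIntegrable_mul hf ht
  have i2 := hf.locInt.intervalIntegrable ht
  have i3 := hg.locInt.intervalIntegrable_sub ht
  have e3 : ∫ s in (0 : ℝ)..t, g (t - s) = ∫ s in (0 : ℝ)..t, g s := by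
    rw [intervalIntegral.integral_comp_sub_left (fun s => g s)]; simp
  -- At `p` the function `f` takes its mean value `m`. Since `g(t - s)` increases and `f(s)`
  -- decreases in `s`, `(g(t - s) - g(t - p))(f(s) - m) ≤ 0`. On integration the terms with `g(t -
  -- p)` cancel.
  have key : conv g f t ≤ ∫ s in (0 : ℝ)..t, (m * g (t - s) + (g (t - p) * f s - g (t - p) * m)) := by
    refine intervalIntegral.integral_mono_on_of_le_Ioo ht.le i1 ((i3.const_mul m).add
      ((i2.const_mul _).sub (by simp))) fun s hs => ?_
    have h1 : 0 < t - s := by linarith [hs.2]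
    have h2 : 0 < t - p := by linarith [hp.2]
    rcases le_total s p with h | h
    · have a1 := hf.anti hs.1 hp.1 h
      have a2 := hg.anti h2 h1 (by linarith)
      rw [hfp] at a1
      nlinarith
    · have a1 := hf.anti hp.1 hs.1 h
      have a2 := hg.anti h1 h2 (by linarith)
      rw [hfp] at a1
      nlinarith
  rw [intervalIntegral.integral_add (i3.const_mul m) ((i2.const_mul _).sub (by simp)),
    intervalIntegral.integral_sub (i2.const_mul _) (by simp), intervalIntegral.integral_const_mul,
    intervalIntegral.integral_const_mul, intervalIntegral.integral_const, e3, ← hmv] at key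
  rw [← hmv]
  simp only [sub_zero, smul_eq_mul] at key
  nlinarith

theorem Kern.le_conv {f g : ℝ → ℝ} (hf : Kern f) (hg : Kern g) {t : ℝ} (ht : 0 < t) :
    t * (f t * g t) ≤ conv f g t := by
  have h1 : ∫ _ in (0 : ℝ)..t, f t * g t ≤ conv f g t := by
    refine intervalIntegral.integral_mono_on_of_le_Ioo ht.le (by simp)
      (hf.intervalIntegrable_mul hg ht) fun s hs => ?_
    have h1 : 0 < t - s := by linarith [hs.2]
    exact mul_le_mul (hf.anti h1 ht (by linarith [hs.1])) (hg.anti hs.1 ht hs.2.le)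
      (hg.nonneg t ht) (hf.nonneg _ h1)
  rw [intervalIntegral.integral_const, sub_zero, smul_eq_mul] at h1
  exact h1

theorem Kern.integral_le_laplace {f : ℝ → ℝ} (hf : Kern f) {t : ℝ} (ht : 0 < t) :
    ∫ s in (0 : ℝ)..t, f s ≤ Real.exp 1 * laplace f (1 / t) := by
  have hx : 0 < 1 / t := by positivity
  have hl := hf.laplace_integrable (1 / t) hx
  rw [intervalIntegral.integral_of_le ht.le, laplace, ← integral_const_mul]
  refine (setIntegral_mono_on (hf.locInt t ht) (IntegrableOn.mono_set (hl.const_mul _) Ioc_subset_Ioi_self)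
    measurableSet_Ioc fun s hs => ?_).trans (setIntegral_mono_set (hl.const_mul _) ?_
    Ioc_subset_Ioi_self.eventuallyLE)
  · rw [← mul_assoc, ← Real.exp_add]
    refine le_mul_of_one_le_left (hf.nonneg s hs.1) (Real.one_le_exp ?_)
    have : 1 / t * s ≤ 1 := by rw [one_div_mul_eq_div, div_le_one ht]; exact hs.2
    linarith
  · exact (ae_restrict_iff' measurableSet_Ioi).2 (ae_of_all _ fun s hs =>
      mul_nonneg (Real.exp_pos _).le (mul_nonneg (Real.exp_pos _).le (hf.nonneg s hs)))

/-! ### Asymptotics of the functions `g_n`. -/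

theorem gOf_logG_zero {x : ℝ} (hx : 0 < x) : gOf (logG 0) x = x := by
  simp [gOf, logG, Real.exp_log hx]

theorem gOf_stepLog {L : ℂ → ℂ} (h : PreCBF L) {x : ℝ} (hne : gOf L x ≠ 1) :
    gOf (stepLog L) x = (gOf L x - 1) / Real.log (gOf L x) := by
  have hL : L (Real.log x) = (Real.log (gOf L x) : ℂ) := by
    rw [gOf, Real.log_exp]; exact h.ofReal _
  have h1 := h.step.pre.exp_ofReal x
  have h0 : Real.log (gOf L x) ≠ 0 :=
    Real.log_ne_zero_of_pos_of_ne_one (gOf_pos L x) hne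
  rw [exp_stepLog h (ofReal_mem_strip _), hL, expQuot_of_ne (by exact_mod_cast h0),
    ← Complex.ofReal_exp, Real.exp_log (gOf_pos L x)] at h1
  have h2 : (((gOf L x - 1) / Real.log (gOf L x) : ℝ) : ℂ) = gOf (stepLog L) x := by
    push_cast; exact h1
  exact_mod_cast h2.symm

theorem tendsto_iterate_log (n : ℕ) : Tendsto (Real.log^[n]) atTop atTop := by
  induction n with
  | zero => exact tendsto_id
  | succ n ih =>
    rw [Function.iterate_succ']
    exact Real.tendsto_log_atTop.comp ih

/-- With `q = 1/g_n(1/t) → ∞` one has `1/g_{n+1}(1/t) = log q / (1 - 1/q)`, so each step puts one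
more logarithm in front. -/
theorem isEquivalent_inv_gOf (n : ℕ) :
    (fun t : ℝ => (gOf (logG n) (1 / t))⁻¹) ~[atTop] fun t => Real.log^[n] t := by
  induction n with
  | zero =>
    refine IsEquivalent.refl.congr_left ?_
    filter_upwards [eventually_gt_atTop 0] with t ht
    rw [gOf_logG_zero (by positivity)]
    simp
  | succ n ih =>
    have hq : Tendsto (fun t : ℝ => (gOf (logG n) (1 / t))⁻¹) atTop atTop :=
      ih.symm.tendsto_atTop (tendsto_iterate_log n)
    have h1 : (fun t : ℝ => Real.log (gOf (logG n) (1 / t))⁻¹) ~[atTop]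
        fun t => Real.log (Real.log^[n] t) := ih.log (tendsto_iterate_log n)
    have h2 : (fun t : ℝ => 1 - ((gOf (logG n) (1 / t))⁻¹)⁻¹) ~[atTop] fun _ => (1 : ℝ) := by
      refine (isEquivalent_const_iff_tendsto one_ne_zero).2 ?_
      simpa using (tendsto_inv_atTop_zero.comp hq).const_sub 1
    refine ((h1.div h2).congr_left ?_).congr_right ?_
    · filter_upwards [hq.eventually_gt_atTop 1] with t ht
      have hp := gOf_pos (logG n) (1 / t)
      have hlt : gOf (logG n) (1 / t) < 1 := by
        rw [lt_inv_comm₀ one_pos hp] at ht; simpa using ht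
      have hlog := Real.log_neg hp hlt
      simp only [Pi.div_apply]
      rw [logG, gOf_stepLog (preCBF_logG n) hlt.ne, Real.log_inv, inv_inv, inv_div]
      have : 1 - gOf (logG n) (1 / t) ≠ 0 := by linarith
      have : gOf (logG n) (1 / t) - 1 ≠ 0 := by linarith
      rw [div_eq_div_iff (by assumption) (by assumption)]
      ring
    · refine Eventually.of_forall fun t => ?_
      simp only [Pi.div_apply, div_one, Function.iterate_succ_apply']

theorem tendsto_div_log_pow (n : ℕ) : Tendsto (fun x : ℝ => x / Real.log x ^ n) atTop atTop := by
  have h1 := (Real.isLittleO_pow_log_id_atTop (n := n)).tendsto_div_nhds_zero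
  have h2 : Tendsto (fun x : ℝ => Real.log x ^ n / x) atTop (𝓝[>] 0) := by
    refine tendsto_nhdsWithin_iff.2 ⟨h1, ?_⟩
    filter_upwards [eventually_gt_atTop 1] with x hx
    have := Real.log_pos hx
    exact (div_pos (pow_pos this n) (by linarith) : 0 < Real.log x ^ n / x)
  refine (tendsto_inv_nhdsGT_zero.comp h2).congr fun x => ?_
  simp

theorem isEquivalent_log_div_log_pow (n : ℕ) :
    (fun x : ℝ => Real.log (x / Real.log x ^ n)) ~[atTop] Real.log := by
  have h1 : (fun x : ℝ => (n : ℝ) * Real.log (Real.log x)) =o[atTop] Real.log :=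
    (Real.isLittleO_log_id_atTop.comp_tendsto Real.tendsto_log_atTop).const_mul_left _
  refine (IsEquivalent.refl.sub_isLittleO h1).congr_left ?_
  filter_upwards [eventually_gt_atTop 1] with x hx
  have := Real.log_pos hx
  simp only [Pi.sub_apply]
  rw [Real.log_div (by linarith) (by positivity), Real.log_pow]

/-- At infinity `log g_n(x) ~ log x` for every `n`, so each step divides by one more power of `log
x`, in contrast with the iterated logarithms at the other end. -/
theorem isEquivalent_gOf (n : ℕ) :
    gOf (logG n) ~[atTop] fun x => x / Real.log x ^ n := by
  induction n with
  | zero =>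
    refine IsEquivalent.refl.congr_left ?_
    filter_upwards [eventually_gt_atTop 0] with x hx
    rw [gOf_logG_zero hx]
    simp
  | succ n ih =>
    have hg : Tendsto (gOf (logG n)) atTop atTop := ih.symm.tendsto_atTop (tendsto_div_log_pow n)
    have h1 : (fun x => Real.log (gOf (logG n) x)) ~[atTop] Real.log :=
      (ih.log (tendsto_div_log_pow n)).trans (isEquivalent_log_div_log_pow n)
    have h2 : (fun x => gOf (logG n) x + -1) ~[atTop] fun x => x / Real.log x ^ n :=
      ih.add_const_of_norm_tendsto_atTop (tendsto_norm_atTop_atTop.comp (tendsto_div_log_pow n))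
    refine ((h2.div h1).congr_left ?_).congr_right ?_
    · filter_upwards [hg.eventually_gt_atTop 1] with x hx
      simp only [Pi.div_apply]
      rw [logG, gOf_stepLog (preCBF_logG n) hx.ne', sub_eq_add_neg]
    · refine Eventually.of_forall fun x => ?_
      simp only [Pi.div_apply, pow_succ, div_div]

theorem isEquivalent_div_gOf (n : ℕ) {η : ℝ} :
    (fun x => x * (gOf (logG n) x + η)⁻¹) ~[atTop] fun x => Real.log x ^ n := by
  have h1 : (fun x => gOf (logG n) x + η) ~[atTop] fun x => x / Real.log x ^ n :=
    (isEquivalent_gOf n).add_const_of_norm_tendsto_atTop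
      (tendsto_norm_atTop_atTop.comp (tendsto_div_log_pow n))
  refine ((IsEquivalent.refl (u := fun x : ℝ => x)).mul h1.inv).congr_right ?_
  filter_upwards [eventually_gt_atTop 1] with x hx
  have := Real.log_pos hx
  simp only [Pi.mul_apply, Pi.inv_apply]
  field_simp

theorem isEquivalent_iterate_log_div_two (n : ℕ) (hn : 1 ≤ n) :
    (fun t : ℝ => Real.log^[n] (t / 2)) ~[atTop] fun t => Real.log^[n] t := by
  induction n, hn using Nat.le_induction with
  | base =>
    simp only [Function.iterate_one]
    have h1 : (fun _ : ℝ => Real.log 2) =o[atTop] Real.log := Real.isLittleO_const_log_atTop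
    refine (IsEquivalent.refl.sub_isLittleO h1).congr_left ?_
    filter_upwards [eventually_gt_atTop 0] with t ht
    simp only [Pi.sub_apply]
    rw [Real.log_div ht.ne' two_ne_zero]
  | succ n hn ih =>
    simp only [Function.iterate_succ_apply']
    exact ih.log (tendsto_iterate_log n)

theorem isLittleO_iterate_log {n : ℕ} (hn : 2 ≤ n) {δ : ℝ} (hδ : 0 < δ) :
    (fun t : ℝ => Real.log^[n] t) =o[atTop] fun t => Real.log t ^ δ := by
  induction n, hn using Nat.le_induction with
  | base => exact (isLittleO_log_rpow_atTop hδ).comp_tendsto Real.tendsto_log_atTop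
  | succ n hn ih =>
    simp only [Function.iterate_succ_apply']
    exact (Real.isLittleO_log_id_atTop.comp_tendsto (tendsto_iterate_log n)).trans ih

/-! ### Asymptotics of the kernels and of the variance. -/

theorem tendsto_one_div_nhdsGT : Tendsto (fun t : ℝ => 1 / t) (𝓝[>] 0) atTop := by
  simpa only [one_div] using tendsto_inv_nhdsGT_zero (𝕜 := ℝ)

theorem isEquivalent_log_two_mul (n : ℕ) :
    (fun x : ℝ => Real.log (2 * x) ^ n) ~[atTop] fun x => Real.log x ^ n := by
  have h1 : (fun _ : ℝ => Real.log 2) =o[atTop] Real.log := Real.isLittleO_const_log_atTop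
  refine ((IsEquivalent.refl.add_isLittleO h1).congr_left ?_).pow n
  filter_upwards [eventually_gt_atTop 0] with t ht
  simp only [Pi.add_apply]
  rw [Real.log_mul two_ne_zero ht.ne', add_comm]

/-- Two functions equivalent to `v` differ by `o(v)`, so an error bounded by their difference is
negligible. -/
theorem isEquivalent_of_abs_sub_le {l : Filter ℝ} {f φ ψ v : ℝ → ℝ} {C : ℝ} (hφ : φ ~[l] v)
    (hψ : ψ ~[l] v) (h : ∀ᶠ t in l, |f t - φ t| ≤ C * (ψ t - φ t)) : f ~[l] v := by
  have h1 : (fun t => ψ t - φ t) =o[l] v := by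
    have := hψ.isLittleO.sub hφ.isLittleO
    simpa using this
  have h2 : (fun t => f t - φ t) =O[l] fun t => ψ t - φ t := by
    refine IsBigO.of_bound |C| ?_
    filter_upwards [h] with t ht
    rw [Real.norm_eq_abs, Real.norm_eq_abs, ← abs_mul]
    exact ht.trans (le_abs_self _)
  refine (hφ.add_isLittleO (h2.trans_isLittleO h1)).congr_left (Eventually.of_forall fun t => ?_)
  simp

theorem StieltjesRep.isEquivalent_zero {f F w : ℝ → ℝ} (h : StieltjesRep f F w) {n : ℕ}
    (hF : (fun x => x * F x) ~[atTop] fun x => Real.log x ^ n) :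
    (f ~[𝓝[>] 0] fun t => Real.log (1 / t) ^ n) ∧
      (fun t => ∫ s in (0 : ℝ)..t, f s) ~[𝓝[>] 0] fun t => t * Real.log (1 / t) ^ n := by
  have h1 : (fun t : ℝ => 1 / t * F (1 / t)) ~[𝓝[>] 0] fun t => Real.log (1 / t) ^ n :=
    hF.comp_tendsto tendsto_one_div_nhdsGT
  have h2 : (fun t : ℝ => 2 / t * F (2 / t)) ~[𝓝[>] 0] fun t => Real.log (1 / t) ^ n := by
    have a1 := hF.comp_tendsto (tendsto_one_div_nhdsGT.const_mul_atTop two_pos)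
    have a2 := (isEquivalent_log_two_mul n).comp_tendsto tendsto_one_div_nhdsGT
    have e : ∀ t : ℝ, 2 * (1 / t) = 2 / t := fun t => by ring
    simp only [Function.comp_def, e] at a1 a2
    exact a1.trans a2
  refine ⟨isEquivalent_of_abs_sub_le (C := 3) h1 h2 ?_, ?_⟩
  · filter_upwards [self_mem_nhdsWithin] with t ht using h.abs_sub_le ht
  · have h3 : (fun t => 1 / t * ∫ s in (0 : ℝ)..t, f s) ~[𝓝[>] 0]
        fun t => Real.log (1 / t) ^ n := by
      refine isEquivalent_of_abs_sub_le (C := 3) h1 h2 ?_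
      filter_upwards [self_mem_nhdsWithin] with t ht
      have ht' : (0 : ℝ) < t := ht
      have := (h.abs_integral_sub_le ht').2
      rw [← mul_sub, abs_mul, abs_of_pos (by positivity)]
      calc 1 / t * |(∫ s in (0 : ℝ)..t, f s) - F (1 / t)|
          ≤ 1 / t * (3 * (2 * F (2 / t) - F (1 / t))) := by gcongr
        _ = _ := by ring
    refine ((IsEquivalent.refl (u := fun t : ℝ => t)).mul h3).congr_left ?_
    filter_upwards [self_mem_nhdsWithin] with t ht
    have ht' : (0 : ℝ) < t := ht
    simp only [Pi.mul_apply]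
    field_simp

theorem StieltjesRep.isEquivalent_atTop {f F w : ℝ → ℝ} (h : StieltjesRep f F w) {n : ℕ}
    (hn : 1 ≤ n) (hF : (fun t => F (1 / t)) ~[atTop] fun t => Real.log^[n] t) :
    (fun t => ∫ s in (0 : ℝ)..t, f s) ~[atTop] fun t => Real.log^[n] t := by
  have h2 : (fun t => F (2 / t)) ~[atTop] fun t => Real.log^[n] t := by
    have a1 := hF.comp_tendsto (tendsto_id.atTop_div_const (two_pos : (0 : ℝ) < 2))
    have e : ∀ t : ℝ, 1 / (t / 2) = 2 / t := fun t => by rw [one_div_div]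
    simp only [Function.comp_def, id, e] at a1
    exact a1.trans (isEquivalent_iterate_log_div_two n hn)
  -- For large times the estimate contains `F(1/t) - F(2/t)`, the opposite order; hence the negative
  -- constant.
  refine isEquivalent_of_abs_sub_le (C := -3) hF h2 ?_
  filter_upwards [eventually_gt_atTop 0] with t ht
  linarith [(h.abs_integral_sub_le ht).1]

/-- Partial fractions: `η/(g(g + η)) = 1/g - 1/(g + η)`. -/
theorem KernelTriple.eta_mul_conv {η : ℝ} {g k l r : ℝ → ℝ} (h : KernelTriple η g k l r) {t : ℝ}
    (ht : 0 < t) : η * conv l r t = l t - r t := by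
  refine eq_of_laplace_eq (f := fun t => η * conv l r t) (g := fun t => l t - r t)
    ((h.l.la.conv h.r.la).const_mul η) (h.l.la.sub h.r.la)
    ((h.l.dom.conv h.r.dom).const_mul η).cont
    (h.l.cm.continuousOn.sub h.r.cm.continuousOn) (fun x hx => ?_) t ht
  rw [laplace_const_mul, laplace_conv h.l.la h.r.la hx, laplace_sub h.l.la h.r.la hx,
    h.l.laplace x hx, h.r.laplace x hx]
  have := h.pos x hx
  have := h.eta_pos
  field_simp
  ring

theorem KernelTriple.eta_mul_integral {η : ℝ} {g k l r : ℝ → ℝ} (h : KernelTriple η g k l r) {t : ℝ}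
    (ht : 0 < t) : η * ∫ s in (0 : ℝ)..t, conv l r s =
      (∫ s in (0 : ℝ)..t, l s) - ∫ s in (0 : ℝ)..t, r s := by
  rw [← intervalIntegral.integral_sub (h.l.locInt.intervalIntegrable ht)
    (h.r.locInt.intervalIntegrable ht), ← intervalIntegral.integral_const_mul,
    intervalIntegral.integral_of_le ht.le, intervalIntegral.integral_of_le ht.le]
  exact setIntegral_congr_fun measurableSet_Ioc fun s hs => h.eta_mul_conv hs.1

/-- Since `1/(g + η) ≤ 1/η`, the integral of `r` is bounded uniformly in time, and the growth comes
from `l` alone. -/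
theorem KernelTriple.isEquivalent_atTop {η : ℝ} {g k l r w : ℝ → ℝ} (h : KernelTriple η g k l r)
    (hl : StieltjesRep l (fun x => (g x)⁻¹) w) {n : ℕ} (hn : 1 ≤ n)
    (hg : (fun t => (g (1 / t))⁻¹) ~[atTop] fun t => Real.log^[n] t) :
    (fun t => ∫ s in (0 : ℝ)..t, conv l r s) ~[atTop] fun t => 1 / η * Real.log^[n] t := by
  have hη := h.eta_pos
  have h1 := hl.isEquivalent_atTop hn hg
  have h2 : (fun t => ∫ s in (0 : ℝ)..t, r s) =o[atTop] fun t => Real.log^[n] t := by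
    have b : (fun t => ∫ s in (0 : ℝ)..t, r s) =O[atTop] fun _ => (1 : ℝ) := by
      refine IsBigO.of_bound (Real.exp 1 * η⁻¹) ?_
      filter_upwards [eventually_gt_atTop 0] with t ht
      have a1 := h.r.kern.integral_le_laplace ht
      have hx : 0 < 1 / t := by positivity
      have := h.pos _ hx
      rw [h.r.laplace _ hx] at a1
      rw [Real.norm_eq_abs, abs_of_nonneg (h.r.kern.integral_nonneg ht), norm_one, mul_one]
      refine a1.trans ?_
      gcongr
      linarith
    refine b.trans_isLittleO ?_
    exact isLittleO_const_left.2 (Or.inr (tendsto_norm_atTop_atTop.comp (tendsto_iterate_log n)))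
  refine ((IsEquivalent.refl (u := fun _ : ℝ => 1 / η)).mul (h1.sub_isLittleO h2)).congr_left ?_
  filter_upwards [eventually_gt_atTop 0] with t ht
  simp only [Pi.mul_apply, Pi.sub_apply]
  rw [← h.eta_mul_integral ht]
  field_simp

theorem isEquivalent_of_squeeze {l : Filter ℝ} {f a b v : ℝ → ℝ} (ha : a ~[l] v) (hb : b ~[l] v)
    (hv : ∀ᶠ t in l, 0 < v t) (h1 : ∀ᶠ t in l, a t ≤ f t) (h2 : ∀ᶠ t in l, f t ≤ b t) :
    f ~[l] v := by
  have hne : ∀ᶠ t in l, v t ≠ 0 := hv.mono fun t ht => ht.ne'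
  rw [isEquivalent_iff_tendsto_one hne] at ha hb ⊢
  refine tendsto_of_tendsto_of_tendsto_of_le_of_le' ha hb ?_ ?_
  · filter_upwards [hv, h1] with t ht h using div_le_div_of_nonneg_right h ht.le
  · filter_upwards [hv, h2] with t ht h using div_le_div_of_nonneg_right h ht.le

theorem tendsto_log_one_div_nhdsGT : Tendsto (fun t : ℝ => Real.log (1 / t)) (𝓝[>] 0) atTop :=
  Real.tendsto_log_atTop.comp tendsto_one_div_nhdsGT

/-- In `l - r` the leading terms at zero cancel, so the convolution itself is squeezed: monotonicity
gives the lower bound `t l(t) r(t)`, Chebyshev's inequality the upper one, and both have the same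
leading term. -/
theorem KernelTriple.isEquivalent_conv_zero {η : ℝ} {g k l r : ℝ → ℝ} (h : KernelTriple η g k l r)
    {w w' : ℝ → ℝ} (hl : StieltjesRep l (fun x => (g x)⁻¹) w)
    (hr : StieltjesRep r (fun x => (g x + η)⁻¹) w') {n : ℕ}
    (hg : (fun x => x * (g x)⁻¹) ~[atTop] fun x => Real.log x ^ n)
    (hg' : (fun x => x * (g x + η)⁻¹) ~[atTop] fun x => Real.log x ^ n) :
    conv l r ~[𝓝[>] 0] fun t => t * Real.log (1 / t) ^ (2 * n) := by
  obtain ⟨a1, a2⟩ := hl.isEquivalent_zero hg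
  obtain ⟨b1, b2⟩ := hr.isEquivalent_zero hg'
  have e1 : (fun t => t * (l t * r t)) ~[𝓝[>] 0] fun t => t * Real.log (1 / t) ^ (2 * n) := by
    refine ((IsEquivalent.refl (u := fun t : ℝ => t)).mul (a1.mul b1)).congr_right
      (Eventually.of_forall fun t => ?_)
    simp only [Pi.mul_apply]
    ring
  have e2 : (fun t => ((∫ s in (0 : ℝ)..t, l s) * ∫ s in (0 : ℝ)..t, r s) / t) ~[𝓝[>] 0]
      fun t => t * Real.log (1 / t) ^ (2 * n) := by
    refine ((a2.mul b2).div (IsEquivalent.refl (u := fun t : ℝ => t))).congr_right ?_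
    filter_upwards [self_mem_nhdsWithin] with t ht
    have ht' : (0 : ℝ) < t := ht
    simp only [Pi.mul_apply, Pi.div_apply]
    field_simp
    ring
  refine isEquivalent_of_squeeze e1 e2 ?_ ?_ ?_
  · filter_upwards [self_mem_nhdsWithin, tendsto_log_one_div_nhdsGT.eventually_gt_atTop 0] with t ht hL
    exact mul_pos ht (pow_pos hL _)
  · filter_upwards [self_mem_nhdsWithin] with t ht using h.l.kern.le_conv h.r.kern ht
  · filter_upwards [self_mem_nhdsWithin] with t ht
    rw [le_div_iff₀' ht]
    exact h.r.kern.mul_conv_le h.r.cm.continuousOn h.l.kern ht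

theorem tendsto_sq_mul_log_pow (p : ℕ) :
    Tendsto (fun t : ℝ => t ^ 2 / 2 * Real.log (1 / t) ^ p) (𝓝[>] 0) (𝓝 0) := by
  have h1 := (Real.isLittleO_pow_log_id_atTop (n := p)).tendsto_div_nhds_zero.comp
    tendsto_one_div_nhdsGT
  have h2 : Tendsto (fun t : ℝ => t / 2) (𝓝[>] 0) (𝓝 (0 / 2)) :=
    (tendsto_nhdsWithin_of_tendsto_nhds tendsto_id).div_const 2
  have h3 := h2.mul h1
  rw [zero_div, zero_mul] at h3
  refine h3.congr' ?_
  filter_upwards [self_mem_nhdsWithin] with t ht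
  have ht' : (0 : ℝ) < t := ht
  simp only [Function.comp, id]
  field_simp

/-- Integration of the asymptotics `t log(1/t)^p` at zero. -/
theorem isEquivalent_integral_zero {κ : ℝ → ℝ} (hκ : Dom κ) {p : ℕ}
    (h : κ ~[𝓝[>] 0] fun t => t * Real.log (1 / t) ^ p) :
    (fun t => ∫ s in (0 : ℝ)..t, κ s) ~[𝓝[>] 0] fun t => t ^ 2 / 2 * Real.log (1 / t) ^ p := by
  -- The derivative of the claimed asymptotics, prepared for l'Hôpital's rule. For `p = 0` the
  -- truncated exponent `p - 1` is harmless, because its term carries the factor `p`.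
  set g' : ℝ → ℝ := fun t => t * Real.log (1 / t) ^ p - p / 2 * t * Real.log (1 / t) ^ (p - 1)
  have hlt := tendsto_log_one_div_nhdsGT.eventually_gt_atTop (p : ℝ)
  have hg'eq : g' ~[𝓝[>] 0] fun t => t * Real.log (1 / t) ^ p := by
    refine IsEquivalent.refl.sub_isLittleO ?_
    rcases Nat.eq_zero_or_pos p with rfl | hp
    · simp
    · have a1 : (fun _ : ℝ => (p : ℝ) / 2) =o[𝓝[>] 0] fun t => Real.log (1 / t) :=
        isLittleO_const_left.2 (Or.inr (tendsto_norm_atTop_atTop.comp tendsto_log_one_div_nhdsGT))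
      have a2 := a1.mul_isBigO (isBigO_refl (fun t : ℝ => t * Real.log (1 / t) ^ (p - 1)) (𝓝[>] 0))
      refine (a2.congr_left fun t => by ring).congr_right fun t => ?_
      obtain ⟨q, rfl⟩ := Nat.exists_eq_add_of_le' hp
      simp only [Nat.add_sub_cancel, pow_succ]
      ring
  have hder : ∀ t : ℝ, 0 < t → HasDerivAt (fun t => t ^ 2 / 2 * Real.log (1 / t) ^ p) (g' t) t := by
    intro t ht
    have b1 : HasDerivAt (fun t : ℝ => Real.log (1 / t)) (-t⁻¹) t := by
      simp only [one_div, Real.log_inv]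
      exact (Real.hasDerivAt_log ht.ne').neg
    have b2 : HasDerivAt (fun t : ℝ => t ^ 2 / 2) t t := by
      have := (hasDerivAt_pow 2 t).div_const 2
      simpa using this
    refine (b2.mul (b1.pow p)).congr_deriv ?_
    have e : ((fun t : ℝ => Real.log (1 / t)) ^ p) t = Real.log (1 / t) ^ p := rfl
    rw [e]
    simp only [g']
    field_simp
    ring
  -- With `ℓ = log(1/t)` and `p > 0`, `g' = t ℓ^(p-1) (ℓ - p/2)`, so `ℓ > p` ensures that `g'` has
  -- no zero on this interval.
  obtain ⟨b, hb, hsub⟩ := mem_nhdsGT_iff_exists_Ioo_subset.1 hlt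
  have hb' : (0 : ℝ) < b := hb
  have hLp : ∀ t ∈ Ioo 0 b, (p : ℝ) < Real.log (1 / t) := fun t ht => hsub ht
  have hne : ∀ t ∈ Ioo 0 b, g' t ≠ 0 := by
    intro t ht
    have hL := hLp t ht
    have hp0 : (0 : ℝ) ≤ p := Nat.cast_nonneg p
    have hL0 : 0 < Real.log (1 / t) := hp0.trans_lt hL
    refine ne_of_gt ?_
    simp only [g']
    rcases Nat.eq_zero_or_pos p with rfl | hp
    · simpa using ht.1
    · obtain ⟨q, hq⟩ := Nat.exists_eq_add_of_le' hp
      have e : t * Real.log (1 / t) ^ p - p / 2 * t * Real.log (1 / t) ^ (p - 1) =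
          t * Real.log (1 / t) ^ (p - 1) * (Real.log (1 / t) - p / 2) := by
        rw [hq]
        simp only [Nat.add_sub_cancel, pow_succ]
        ring
      rw [e]
      exact mul_pos (mul_pos ht.1 (pow_pos hL0 _)) (by linarith)
  have hpos : ∀ᶠ t : ℝ in 𝓝[>] 0, t ^ 2 / 2 * Real.log (1 / t) ^ p ≠ 0 := by
    filter_upwards [self_mem_nhdsWithin, tendsto_log_one_div_nhdsGT.eventually_gt_atTop 0] with t ht hL
    have ht' : (0 : ℝ) < t := ht
    positivity
  refine (isEquivalent_iff_tendsto_one hpos).2 ?_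
  refine HasDerivAt.lhopital_zero_right_on_Ioo hb' (f' := κ) (g' := g') (fun t ht => ?_)
    (fun t ht => hder t ht.1) hne hκ.locInt.tendsto_integral (tendsto_sq_mul_log_pow p) ?_
  · have := hκ.hasDerivAt_conv_one ht.1
    rwa [show SlowVariance.conv (fun _ => 1) κ = fun t => ∫ s in (0 : ℝ)..t, κ s from
      funext (conv_one κ)] at this
  · have h3 := h.trans hg'eq.symm
    refine (isEquivalent_iff_tendsto_one ?_).1 h3
    filter_upwards [Ioo_mem_nhdsGT hb'] with t ht using hne t ht

theorem LogCBF.stieltjesRep_inv {L : ℂ → ℂ} (h : LogCBF L) {η : ℝ} (hη : 0 < η) :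
    StieltjesRep (sFun (SlowVariance.dens fun z => (Complex.exp (L z) + η)⁻¹))
      (fun x => (gOf L x + η)⁻¹) (SlowVariance.dens fun z => (Complex.exp (L z) + η)⁻¹) :=
  ⟨(h.stripFun_inv hη).sDens (h.inv_im_nonpos η), dens_nonneg (h.inv_im_nonpos η), fun _ _ => rfl,
    (h.cmFor_inv hη).laplace⟩

theorem LogCBF.stieltjesRep_exp_neg {L : ℂ → ℂ} (h : LogCBF L) {l : ℝ → ℝ}
    (hl : CMFor l fun x => (gOf L x)⁻¹) :
    StieltjesRep l (fun x => (gOf L x)⁻¹)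
      (SlowVariance.dens fun z => Complex.exp (-((1 : ℝ) * L z))) := by
  have h1 := h.cmFor_exp_neg one_pos le_rfl
  simp only [Real.rpow_one] at h1
  have h0 := h.exp_neg_im_nonpos one_pos le_rfl
  exact ⟨(h.stripFun_exp_neg one_pos le_rfl).sDens h0, dens_nonneg h0, fun t ht => hl.unique h1 ht,
    hl.laplace⟩

end SlowVariance

/-! ### Assembly of the theorem. -/

theorem mainTheorem6 (n : ℕ) (hn : 2 ≤ n) (η ν : ℝ) (hη : 0 < η) (hν : 0 < ν) :
    SlowVariance.IsPC (SlowVariance.phi n) (SlowVariance.psi n) ∧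
    SlowVariance.IsCM (SlowVariance.phi n) ∧
    (∃ U : ℝ → ℝ → ℝ, SlowVariance.IsFundamentalSolution (SlowVariance.phi n) η ν U) ∧
    ∀ U : ℝ → ℝ → ℝ, SlowVariance.IsFundamentalSolution (SlowVariance.phi n) η ν U →
      (∀ t : ℝ, 0 < t → (∀ᵐ z, 0 ≤ U t z) ∧ ∫ z, U t z = 1) ∧
      ∀ (Ω : Type*) [MeasurableSpace Ω] (P : Measure Ω) [IsProbabilityMeasure P] (X : ℝ → Ω → ℝ),
        (∀ t : ℝ, 0 < t → SlowVariance.HasDensity P (X t) (U t)) →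
        (∀ t : ℝ, 0 < t → MemLp (X t) 2 P) ∧
        IsEquivalent atTop (fun t : ℝ => variance (X t) P)
          (fun t : ℝ => 2 * ν / η * Real.log^[n] t) ∧
        (∀ δ : ℝ, 0 < δ →
          (fun t : ℝ => variance (X t) P) =o[atTop] fun t : ℝ => Real.log t ^ δ) ∧
        IsEquivalent (𝓝[>] 0) (fun t : ℝ => variance (X t) P)
          (fun t : ℝ => ν * t ^ 2 * Real.log (1 / t) ^ (2 * n)) := by
  have hcbf : SlowVariance.LogCBF (SlowVariance.logG n) := by
    obtain ⟨m, rfl⟩ := Nat.exists_eq_add_of_le' hn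
    exact SlowVariance.logCBF_logG (m + 1)
  have hk := SlowVariance.cmFor_phi hn
  have hl := SlowVariance.cmFor_psi (n := n) (by omega)
  have htr := hcbf.kernelTriple hη hk hl
  obtain ⟨V, hV0, hV⟩ := SlowVariance.exists_isFundamentalSolution hcbf hη hν hk hl
  refine ⟨SlowVariance.isPC_phi_psi hn, hk.cm, ⟨V, hV⟩, fun U hU => ?_⟩
  have hW := hU.weakVolterra htr
  -- The definition of a fundamental solution contains no positivity; it is inherited by uniqueness
  -- from the solution constructed above.
  have hpos : ∀ t : ℝ, 0 < t → ∀ᵐ z, 0 ≤ U t z := fun t ht => by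
    filter_upwards [hU.ae_eq hV htr ht] with z hz
    rw [hz]
    exact hV0 t z ht
  refine ⟨fun t ht => ⟨hpos t ht, hW.integral_eq ht⟩, fun Ω _ P _ X hX => ?_⟩
  have hvar := fun t (ht : 0 < t) => hW.variance_eq ht (hpos t ht) (hX t ht)
  have hrl := hcbf.stieltjesRep_exp_neg hl
  have hrr := hcbf.stieltjesRep_inv hη
  have htop : IsEquivalent atTop (fun t : ℝ => variance (X t) P)
      (fun t : ℝ => 2 * ν / η * Real.log^[n] t) := by
    have h1 := htr.isEquivalent_atTop hrl (n := n) (by omega) (SlowVariance.isEquivalent_inv_gOf n)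
    refine ((IsEquivalent.refl (u := fun _ : ℝ => 2 * ν)).mul h1).congr_left ?_ |>.congr_right ?_
    · filter_upwards [eventually_gt_atTop 0] with t ht using (hvar t ht).2.symm
    · refine Eventually.of_forall fun t => ?_
      simp only [Pi.mul_apply]
      ring
  refine ⟨fun t ht => (hvar t ht).1, htop, fun δ hδ => ?_, ?_⟩
  · exact htop.isBigO.trans_isLittleO
      ((SlowVariance.isLittleO_iterate_log hn hδ).const_mul_left _)
  -- The shift `η = 0` gives the asymptotics for `ψ_n`, the given `η` those for `r`.
  · have hg := SlowVariance.isEquivalent_div_gOf n (η := 0)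
    simp only [add_zero] at hg
    have h1 := htr.isEquivalent_conv_zero hrl hrr hg (SlowVariance.isEquivalent_div_gOf n)
    have h2 := SlowVariance.isEquivalent_integral_zero (hl.dom.conv htr.r.dom) h1
    refine ((IsEquivalent.refl (u := fun _ : ℝ => 2 * ν)).mul h2).congr_left ?_ |>.congr_right ?_
    · filter_upwards [self_mem_nhdsWithin] with t ht using (hvar t ht).2.symm
    · refine Eventually.of_forall fun t => ?_
      simp only [Pi.mul_apply]
      ring
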